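/- Let $\mathbb{K}$ be a field of characteristic zero. A dg $\mathbb{S}$-module $\mathcal{P}$ is a family $(\mathcal{P}(n))_{n\ge 0}$ of $\mathbb{Z}$-graded chain complexes of $\mathbb{K}$-modules (differential of degree $-1$) with an action of the symmetric group $\mathbb{S}_n$ on $\mathcal{P}(n)$ by degree-preserving chain maps; it extends in the usual way to a functor on finite sets and bijections. Trees are nonplanar, rooted, with vertices having any finite number ($\geq 0$) of inputs. For a graded $\mathbb{S}$-module $\mathcal{V}$, let $\mathbb{T}\mathcal{V}$ be the tree module, spanned by the trees whose vertices are labelled by $\mathcal{V}$ (with Koszul signs for the order of the vertices); let $\overline{\mathbb{T}}\mathcal{V}$ be its part on the nontrivial trees, let $\mathbb{T}^c\mathcal{V}$ be $\mathbb{T}\mathcal{V}$ with its structure of cofree conilpotent cooperad (decomposition of trees), and let $\pi:\mathbb{T}\mathcal{V}\to\mathcal{V}$ be the projection onto the trees with one vertex. For a map $f$ on $\overline{\mathbb{T}}\mathcal{V}$, write $f(T)$ for its restriction to labellings of the tree $T$. Let $\mathcal{P}$ be a dg $\mathbb{S}$-module, and let $s\mathcal{P}\oplus\mathbb{K}\cdot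 v$ be its suspension with a generator $v$ of arity $1$ and degree $2$ added; let $\theta$ be the degree $-2$ map which sends $v$ to $1$ and vanishes on $s\mathcal{P}$ and on the trees without exactly one vertex. A *homotopy operad structure* on $\mathcal{P}$ consists of an element $1_{\mathscr P}\in\mathcal{P}(1)_0$ and a curved conilpotent cooperad structure on $\mathbb{T}^c(s\mathcal{P}\oplus\mathbb{K}\cdot v)$ with curvature $\theta$ whose coderivation is given on generators by $sx\mapsto -s(dx)$ and $v\mapsto s1_{\mathscr P}$. Explicitly, it is a map of $\mathbb{S}$-modules $\gamma_{\mathscr P}:\overline{\mathbb{T}}(s\mathcal{P}\oplus\mathbb{K}\cdot v)\to s\mathcal{P}$ of degree $-1$ with $\gamma_{\mathscr P}(sx)=-s(dx)$, $\gamma_{\mathscr P}(v)=s1_{\mathscr P}$ and, for every tree $T$, $$\sum_{T'\subset T}\gamma_{\mathscr P}(T/T')\,(\mathrm{Id}\otimes\cdots\otimes\gamma_{\mathscr P}(T')\otimes\cdots\otimes\mathrm{Id})=(\theta\otimes\pi-\pi\otimes\theta)\,\Delta_2,$$ where $T'$ runs over the nonempty subtrees, $T/T'$ is obtained by contracting $T'$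 to a vertex, and the right hand side is zero unless $T$ has exactly two vertices, in which case it is $\theta(a)b-a\,\theta(b)$ if the lower vertex is labelled by $a$ and the upper one by $b$. An *$\infty$-morphism* $\mathscr{P}\to\mathscr{Q}$ of homotopy operads is a morphism of curved conilpotent cooperads $\mathbb{T}^c(s\mathcal{P}\oplus\mathbb{K}\cdot v)\to\mathbb{T}^c(s\mathcal{Q}\oplus\mathbb{K}\cdot v)$. Explicitly, it is a map of $\mathbb{S}$-modules $f:\overline{\mathbb{T}}(s\mathcal{P}\oplus\mathbb{K}\cdot v)\to s\mathcal{Q}\oplus\mathbb{K}\cdot v$ of degree $0$ with $\theta f=\theta$ and, for every tree $T$, $$\sum_{T=T_1\sqcup\cdots\sqcup T_k}\gamma_{\mathscr Q}(T/T_1,\ldots,T_k)\,(f(T_1)\otimes\cdots\otimes f(T_k))=\sum_{T'\subset T}f(T/T')\,(\mathrm{Id}\otimes\cdots\otimes\gamma_{\mathscr P}(T')\otimes\cdots\otimes\mathrm{Id}),$$ where the first sum runs over the partitions of $T$ into subtrees. It is an *$\infty$-isotopy* if $\mathscr{P}$ and $\mathscr{Q}$ have the same underlying dg $\mathbb{S}$-module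 and the restriction of $f$ to $s\mathcal{P}$ is the identity. It is *strict* if $f$ vanishes on the trees with at least two vertices and the component of $f(v)$ in $s\mathcal{Q}$ is zero. **Theorem.** Let $p:\mathcal{P}\to\mathcal{Q}$ be an acyclic fibration of dg $\mathbb{S}$-modules, that is, a morphism which is surjective and a quasi-isomorphism in every arity. Suppose that $\mathcal{P}$ has a structure of homotopy operad, denoted by $\mathscr{P}$. Then there exist a homotopy operad structure $\mathscr{P}'$ on the dg $\mathbb{S}$-module $\mathcal{P}$, an $\infty$-isotopy $\mathscr{P}\to\mathscr{P}'$, and a homotopy operad structure $\mathscr{Q}$ on $\mathcal{Q}$, such that $p$ is a strict morphism of homotopy operads from $\mathscr{P}'$ to $\mathscr{Q}$; that is, there is a strict $\infty$-morphism $\mathscr{P}'\to\mathscr{Q}$ whose restriction to $s\mathcal{P}$ is $sx\mapsto s(p(x))$. -/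

import Mathlib

namespace HtpyOperad

universe w u u'

/-! ## Graded and dg symmetric modules -/

/-- A graded `𝕊`-module over a field `K`: for every arity `n` a `ℤ`-graded `K`-module `obj n`
(with homogeneous components `gr n k`) and a degree-preserving action of the symmetric group.
The right action `x · σ` of a contravariant functor on the groupoid `𝕊` is written as the
left action `ρ n σ⁻¹ x`. -/
structure GrSMod (K : Type w) [Field K] where
  obj : ℕ → Type u
  [instAddCommGroup : ∀ n, AddCommGroup (obj n)]
  [instModule : ∀ n, Module K (obj n)]
  gr : ∀ n, ℤ → Submodule K (obj n)
  internal : ∀ n, DirectSum.IsInternal (gr n)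
  ρ : ∀ n, Representation K (Equiv.Perm (Fin n)) (obj n)
  ρ_mem : ∀ n σ k x, x ∈ gr n k → ρ n σ x ∈ gr n k

attribute [instance] GrSMod.instAddCommGroup GrSMod.instModule

variable {K : Type w} [Field K]

/-- Maps of degree `k` between graded `𝕊`-modules: aritywise linear, raising the degree by `k`,
and commuting with the symmetric groups. -/
structure EquivMap (V : GrSMod.{w, u} K) (W : GrSMod.{w, u'} K) (k : ℤ) where
  map : ∀ n, V.obj n →ₗ[K] W.obj n
  map_mem : ∀ n l x, x ∈ V.gr n l → map n x ∈ W.gr n (l + k)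
  map_ρ : ∀ n σ x, map n (V.ρ n σ x) = W.ρ n σ (map n x)

/-- The identity of a graded `𝕊`-module. -/
def EquivMap.id (V : GrSMod.{w, u} K) : EquivMap V V 0 where
  map _ := LinearMap.id
  map_mem n l x hx := by simpa using hx
  map_ρ _ _ _ := rfl

/-- A dg `𝕊`-module: the differential has degree `-1`, is equivariant, and squares to zero. -/
structure DGSMod (K : Type w) [Field K] extends GrSMod.{w, u} K where
  d : EquivMap toGrSMod toGrSMod (-1)
  d_d : ∀ n x, d.map n (d.map n x) = 0

/-- Morphisms of dg `𝕊`-modules. -/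
structure DGSMod.Hom (P : DGSMod.{w, u} K) (Q : DGSMod.{w, u'} K) extends
    EquivMap P.toGrSMod Q.toGrSMod 0 where
  comm : ∀ n x, map n (P.d.map n x) = Q.d.map n (map n x)

/-- `p` is a surjection in every arity and every degree. -/
def DGSMod.Hom.IsFibration {P : DGSMod.{w, u} K} {Q : DGSMod.{w, u'} K} (p : P.Hom Q) : Prop :=
  ∀ n k, ∀ y ∈ Q.gr n k, ∃ x ∈ P.gr n k, p.map n x = y

/-- `p` induces an isomorphism on homology in every arity `n` and every degree `k`:
the first clause is injectivity, the second one is surjectivity. -/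
def DGSMod.Hom.IsQuasiIso {P : DGSMod.{w, u} K} {Q : DGSMod.{w, u'} K} (p : P.Hom Q) : Prop :=
  ∀ n k,
    (∀ x ∈ P.gr n k, P.d.map n x = 0 → (∃ y ∈ Q.gr n (k + 1), Q.d.map n y = p.map n x) →
      ∃ z ∈ P.gr n (k + 1), P.d.map n z = x) ∧
    (∀ y ∈ Q.gr n k, Q.d.map n y = 0 →
      ∃ x ∈ P.gr n k, P.d.map n x = 0 ∧ ∃ z ∈ Q.gr n (k + 1), p.map n x - y = Q.d.map n z)

/-- Acyclic fibrations of dg `𝕊`-modules. -/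
def DGSMod.Hom.IsAcyclicFibration {P : DGSMod.{w, u} K} {Q : DGSMod.{w, u'} K} (p : P.Hom Q) :
    Prop :=
  p.IsFibration ∧ p.IsQuasiIso

/-! ## Evaluation of a symmetric module on a finite set -/

namespace GrSMod

/-- The value `V(X)` of an `𝕊`-module on a finite set `X`. An element is a compatible family of
elements of `V(n)`, one for every numbering `X ≃ Fin n` of the set `X`; for `n` the cardinal of
`X`, evaluation at one numbering is an isomorphism from `V(X)` to `V(n)`. -/
def ext (V : GrSMod.{w, u} K) (X : Type) : Submodule K (∀ n, (X ≃ Fin n) → V.obj n) where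
  carrier := {φ | ∀ n (e : X ≃ Fin n) (σ : Equiv.Perm (Fin n)),
    φ n (e.trans σ) = V.ρ n σ (φ n e)}
  add_mem' := by
    intro a b ha hb n e σ
    simp only [Pi.add_apply, map_add, ha n e σ, hb n e σ]
  zero_mem' := by
    intro n e σ
    simp
  smul_mem' := by
    intro c a ha n e σ
    simp only [Pi.smul_apply, map_smul, ha n e σ]

/-- The degree `k` part of `V(X)`. -/
def extGr (V : GrSMod.{w, u} K) (X : Type) (k : ℤ) : Submodule K (V.ext X) where
  carrier := {φ | ∀ n e, φ.1 n e ∈ V.gr n k}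
  add_mem' := fun ha hb n e => (V.gr n k).add_mem (ha n e) (hb n e)
  zero_mem' := fun n _ => (V.gr n k).zero_mem
  smul_mem' := fun c _ ha n e => (V.gr n k).smul_mem c (ha n e)

/-- The map `V(X) → V(Y)` induced by a bijection `X ≃ Y`. -/
def reindex (V : GrSMod.{w, u} K) {X Y : Type} (h : X ≃ Y) : V.ext X →ₗ[K] V.ext Y where
  toFun φ := ⟨fun n e => φ.1 n (h.trans e), fun n e σ => φ.2 n (h.trans e) σ⟩
  map_add' _ _ := rfl
  map_smul' _ _ := rfl

end GrSMod

/-- The map `V(X) → W(X)` induced by a map of `𝕊`-modules. -/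
def EquivMap.ext {V : GrSMod.{w, u} K} {W : GrSMod.{w, u'} K} {k : ℤ} (f : EquivMap V W k)
    (X : Type) : V.ext X →ₗ[K] W.ext X where
  toFun φ := ⟨fun n e => f.map n (φ.1 n e), fun n e σ => by
    simpa only [φ.2 n e σ] using f.map_ρ n σ (φ.1 n e)⟩
  map_add' a b := by
    ext n e
    simp
  map_smul' c a := by
    ext n e
    simp

/-! ## Trees -/

/-- A nonplanar rooted tree with set of vertices `ι` and set of leaves `L`. The outgoing edge of
a vertex or of a leaf `w` ends at the vertex `target w`, or is the root of the tree
(`target w = none`). There is exactly one root edge, and following the edges downwards always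
terminates. The trivial tree is the one without vertex and with one leaf. -/
structure RTree (ι L : Type) where
  target : ι ⊕ L → Option ι
  root : ∃! z, target z = none
  wf : WellFounded (fun v v' : ι => target (Sum.inl v') = some v)

namespace RTree

variable {ι L ι' L' : Type}

/-- The set of inputs of the vertex `v`. -/
abbrev In (T : RTree ι L) (v : ι) : Type := {z : ι ⊕ L // T.target z = some v}

/-- A vertex does not equal its own parent. -/
theorem target_ne (T : RTree ι L) (v : ι) : T.target (Sum.inl v) ≠ some v := fun h =>
  T.wf.asymmetric v v h h

/-- Isomorphisms of trees: bijections on vertices and on leaves that respect the edges. -/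
def IsIso (T : RTree ι L) (T' : RTree ι' L') (φ : ι ≃ ι') (ψ : L ≃ L') : Prop :=
  ∀ z, T'.target (Equiv.sumCongr φ ψ z) = (T.target z).map φ

/-- The bijection between inputs of corresponding vertices of isomorphic trees. -/
def IsIso.inEquiv {T : RTree ι L} {T' : RTree ι' L'} {φ : ι ≃ ι'} {ψ : L ≃ L'}
    (h : T.IsIso T' φ ψ) (v : ι) : T.In v ≃ T'.In (φ v) :=
  (Equiv.sumCongr φ ψ).subtypeEquiv fun z => by
    rw [h z, Option.map_eq_some_iff]
    constructor
    · intro hz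
      exact ⟨v, hz, rfl⟩
    · rintro ⟨u, hu, hv⟩
      rw [hu, φ.injective hv]

/-- A partition of a tree into subtrees, `T = T₁ ⊔ ⋯ ⊔ Tₖ`. It is recorded by the function `low`
which sends a vertex to the lowest vertex of the subtree that it belongs to: a vertex either is
the lowest one of its subtree, or lies in the same subtree as its parent. -/
structure Partition (T : RTree ι L) where
  low : ι → ι
  cond : ∀ v, low v = v ∨ ∃ u, T.target (Sum.inl v) = some u ∧ low v = low u

noncomputable instance (T : RTree ι L) [Finite ι] : Fintype T.Partition :=
  have : Finite T.Partition := Finite.of_injective Partition.low fun a b h => by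
    cases a; cases b; cases h; rfl
  Fintype.ofFinite _

namespace Partition

variable {T : RTree ι L} (b : T.Partition)

theorem idem (v : ι) : b.low (b.low v) = b.low v := by
  induction v using T.wf.induction with
  | _ v ih =>
    rcases b.cond v with h | ⟨u, hu, h⟩
    · rw [h, h]
    · rw [h]
      exact ih u hu

/-- The lowest vertex of the subtree of `v` is `v` or lies below `v`. -/
theorem below (v : ι) :
    Relation.ReflTransGen (fun v v' : ι => T.target (Sum.inl v') = some v) (b.low v) v := by
  induction v using T.wf.induction with
  | _ v ih =>
    rcases b.cond v with h | ⟨u, hu, h⟩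
    · rw [h]
    · rw [h]
      exact (ih u hu).tail hu

/-- A vertex which is the lowest one of its subtree is not in the subtree of its parent. -/
theorem parent_ne {r u : ι} (hu : T.target (Sum.inl r) = some u) : b.low u ≠ r := by
  intro h
  have h1 : Relation.TransGen (fun v v' : ι => T.target (Sum.inl v') = some v) (b.low u) r :=
    Relation.TransGen.tail' (b.below u) hu
  rw [h] at h1
  exact T.wf.transGen.asymmetric r r h1 h1

/-- The set of subtrees of the partition, each one represented by its lowest vertex. -/
abbrev Roots : Type := {r : ι // b.low r = r}

/-- The set of vertices of the subtree with lowest vertex `r`. -/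
abbrev Block (r : b.Roots) : Type := {v : ι // b.low v = r.1}

/-- The tree `T/T₁,…,Tₖ` obtained by contracting every subtree of the partition to a vertex. -/
def quot : RTree b.Roots L where
  target z := (T.target (Sum.map Subtype.val id z)).map fun u => ⟨b.low u, b.idem u⟩
  root := by
    obtain ⟨z, hz, huniq⟩ := T.root
    have key : ∀ y : b.Roots ⊕ L,
        (T.target (Sum.map Subtype.val id y)).map (fun u => (⟨b.low u, b.idem u⟩ : b.Roots)) = none →
          Sum.map Subtype.val id y = z := by
      intro y hy
      exact huniq _ (Option.map_eq_none_iff.1 hy)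
    have hinj : Function.Injective (Sum.map (Subtype.val : b.Roots → ι) (id : L → L)) :=
      Sum.map_injective.2 ⟨Subtype.val_injective, Function.injective_id⟩
    rcases z with r | l
    · have hr : b.low r = r := by
        rcases b.cond r with h | ⟨u, hu, -⟩
        · exact h
        · rw [hz] at hu
          cases hu
      refine ⟨Sum.inl ⟨r, hr⟩, ?_, ?_⟩
      · simp [hz]
      · intro y hy
        exact hinj (key y hy)
    · refine ⟨Sum.inr l, ?_, ?_⟩
      · simp [hz]
      · intro y hy
        exact hinj (key y hy)
  wf := by
    refine Subrelation.wf ?_ (InvImage.wf (Subtype.val : b.Roots → ι) T.wf.transGen)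
    intro r r' h
    obtain ⟨u, hu, hr⟩ := Option.map_eq_some_iff.1 h
    subst hr
    exact Relation.TransGen.tail' (b.below u) hu

open scoped Classical in
/-- A vertex viewed as a vertex of the subtree with lowest vertex `r`, if it belongs to it. -/
noncomputable def toBlock (r : b.Roots) (v : ι) : Option (b.Block r) :=
  if h : b.low v = r.1 then some ⟨v, h⟩ else none

/-- Vertices of the subtree with lowest vertex `r` and inputs of this subtree, viewed as vertices
and leaves of the whole tree. -/
def incl (r : b.Roots) : b.Block r ⊕ b.quot.In r → ι ⊕ L :=
  Sum.elim (fun v => Sum.inl v.1) (fun z => Sum.map Subtype.val id z.1)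

theorem toBlock_eq_some {r : b.Roots} {v : ι} {y : b.Block r} :
    b.toBlock r v = some y ↔ v = y.1 := by
  unfold toBlock
  split_ifs with h
  · rw [Option.some_inj]
    exact ⟨fun h => h ▸ rfl, fun h => Subtype.ext h⟩
  · constructor
    · intro h
      cases h
    · rintro rfl
      exact (h y.2).elim

/-- The subtree with lowest vertex `r`. Its leaves are the inputs of the vertex `r` in the
contracted tree. -/
noncomputable def sub (r : b.Roots) : RTree (b.Block r) (b.quot.In r) where
  target z := (T.target (b.incl r z)).bind (b.toBlock r)
  root := by
    refine ⟨Sum.inl ⟨r.1, r.2⟩, ?_, ?_⟩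
    · refine Option.bind_eq_none_iff.2 fun u hu => ?_
      unfold toBlock
      rw [dif_neg]
      exact b.parent_ne hu
    · rintro (v | z) h
      · replace h := Option.bind_eq_none_iff.1 h
        rcases b.cond v.1 with hv | ⟨u, hu, hv⟩
        · congr 1
          exact Subtype.ext (hv.symm.trans v.2)
        · have := h u hu
          unfold toBlock at this
          rw [dif_pos (hv.symm.trans v.2)] at this
          cases this
      · replace h := Option.bind_eq_none_iff.1 h
        obtain ⟨u, hu, hr⟩ := Option.map_eq_some_iff.1 z.2
        have := h u hu
        unfold toBlock at this
        rw [dif_pos (congrArg Subtype.val hr)] at this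
        cases this
  wf := by
    refine Subrelation.wf ?_ (InvImage.wf (Subtype.val : b.Block r → ι) T.wf)
    intro v v' h
    obtain ⟨u, hu, hv⟩ := Option.bind_eq_some_iff.1 h
    rw [toBlock_eq_some] at hv
    subst hv
    exact hu

/-- A vertex of a subtree has the same inputs in the subtree and in the whole tree. -/
noncomputable def inEquiv (r : b.Roots) (v : b.Block r) : (b.sub r).In v ≃ T.In v.1 :=
  Equiv.ofBijective
    (fun z => ⟨b.incl r z.1, by
      obtain ⟨u, hu, hv⟩ := Option.bind_eq_some_iff.1 z.2
      rw [hu, b.toBlock_eq_some.1 hv]⟩)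
    (by
      constructor
      · rintro ⟨z, hz⟩ ⟨z', hz'⟩ h
        have h : b.incl r z = b.incl r z' := congrArg Subtype.val h
        apply Subtype.ext
        have aux : ∀ (y : b.Block r) (y' : b.quot.In r),
            b.incl r (Sum.inl y) ≠ b.incl r (Sum.inr y') := by
          rintro ⟨y, hy⟩ ⟨y' | l, hy'⟩ hyy
          · have hyy : y = y'.1 := Sum.inl_injective hyy
            obtain ⟨u, hu, hr⟩ := Option.map_eq_some_iff.1 hy'
            have hr : b.low u = r.1 := congrArg Subtype.val hr
            refine b.parent_ne hu ?_
            calc b.low u = r.1 := hr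
              _ = b.low y := hy.symm
              _ = b.low y'.1 := by rw [hyy]
              _ = y'.1 := y'.2
          · exact Sum.inl_ne_inr hyy
        rcases z with y | y <;> rcases z' with y' | y'
        · exact congrArg Sum.inl (Subtype.ext (Sum.inl_injective h))
        · exact (aux _ _ h).elim
        · exact (aux _ _ h.symm).elim
        · have hinj : Function.Injective (Sum.map (Subtype.val : b.Roots → ι) (id : L → L)) :=
            Sum.map_injective.2 ⟨Subtype.val_injective, Function.injective_id⟩
          exact congrArg Sum.inr (Subtype.ext (hinj h))
      · rintro ⟨z, hz⟩
        have fin : ∀ y : b.Block r ⊕ b.quot.In r, b.incl r y = z →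
            (T.target (b.incl r y)).bind (b.toBlock r) = some v := by
          intro y hy
          rw [hy, hz]
          exact b.toBlock_eq_some.2 rfl
        have hq : b.low v.1 = r.1 := v.2
        rcases z with u | l
        · by_cases hu : b.low u = r.1
          · exact ⟨⟨Sum.inl ⟨u, hu⟩, fin _ rfl⟩, rfl⟩
          · have hbu : b.low u = u := by
              rcases b.cond u with h | ⟨u', hu', h⟩
              · exact h
              · rw [hz] at hu'
                cases hu'
                exact (hu (h.trans hq)).elim
            have hin : b.quot.target (Sum.inl ⟨u, hbu⟩) = some r := by
              refine Option.map_eq_some_iff.2 ⟨v.1, hz, Subtype.ext hq⟩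
            exact ⟨⟨Sum.inr ⟨Sum.inl ⟨u, hbu⟩, hin⟩, fin _ rfl⟩, rfl⟩
        · have hin : b.quot.target (Sum.inr l) = some r := by
            refine Option.map_eq_some_iff.2 ⟨v.1, hz, Subtype.ext hq⟩
          exact ⟨⟨Sum.inr ⟨Sum.inr l, hin⟩, fin _ rfl⟩, rfl⟩)

/-- The restriction to a subtree of a labelling of the vertices of `T` by elements of `V`. -/
noncomputable def restrict (V : GrSMod.{w, u} K) (x : ∀ v : ι, V.ext (T.In v)) (r : b.Roots) :
    ∀ v : b.Block r, V.ext ((b.sub r).In v) :=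
  fun v => V.reindex (b.inEquiv r v).symm (x v.1)

end Partition

open scoped Classical in
/-- The map `V(In v) → V(L)` induced by the bijection from the inputs of `v` to the leaves of `T`
which is the identity on the leaves attached to `v`. It is used if `v` is the only vertex of
`T`, or if the only other vertex of `T` has exactly one input; then there is exactly one such
bijection. It is set to zero if there is no such bijection. -/
noncomputable def transfer (T : RTree ι L) (V : GrSMod.{w, u} K) (v : ι) :
    V.ext (T.In v) →ₗ[K] V.ext L :=
  if h : ∃ g : T.In v ≃ L, ∀ z l, z.1 = Sum.inr l → g z = l then V.reindex h.choose else 0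

/-- The projection of the tree module onto its generators: zero on the trees which do not have
exactly one vertex. -/
noncomputable def proj (T : RTree ι L) (V : GrSMod.{w, u} K) [Fintype ι]
    (x : ∀ v, V.ext (T.In v)) : V.ext L :=
  if Fintype.card ι = 1 then ∑ v, T.transfer V v (x v) else 0

end RTree

/-! ## Maps out of the tree module -/

/-- The Koszul sign of sorting homogeneous elements of degrees `e i`, given in the order of the
indices `i`, by increasing values of `φ` (elements with the same value keep their order). -/
def koszul {ι κ : Type} [Fintype ι] [LinearOrder ι] [LinearOrder κ] (φ : ι → κ) (e : ι → ℤ) : ℤˣ :=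
  ∏ i, ∏ j, if i < j ∧ φ j < φ i then (e i * e j).negOnePow else 1

/-- A map of `𝕊`-modules of degree `k` from the reduced tree module of `V` to `W`. The tree module
is the colimit, over the groupoid of trees, of the tensor products of the `V(In v)` over the
vertices `v` (taken in a chosen linear order). Hence such a map is a family of multilinear maps,
one for each tree with linearly ordered vertices, which is natural for isomorphisms of trees
(relabelling of the leaves included), with the Koszul sign for the change of the order of the
vertices. It vanishes on the trivial tree. -/
structure TreeMap (V : GrSMod.{w, u} K) (W : GrSMod.{w, u'} K) (k : ℤ) where
  map : ∀ {ι L : Type} [Fintype ι] [LinearOrder ι] [Finite L] (T : RTree ι L),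
    MultilinearMap K (fun v : ι => V.ext (T.In v)) (W.ext L)
  map_mem : ∀ {ι L : Type} [Fintype ι] [LinearOrder ι] [Finite L] (T : RTree ι L)
    (x : ∀ v : ι, V.ext (T.In v)) (e : ι → ℤ), (∀ v, x v ∈ V.extGr _ (e v)) →
      map T x ∈ W.extGr L ((∑ v, e v) + k)
  natural : ∀ {ι L ι' L' : Type} [Fintype ι] [LinearOrder ι] [Finite L]
    [Fintype ι'] [LinearOrder ι'] [Finite L'] (T : RTree ι L) (T' : RTree ι' L')
    (φ : ι ≃ ι') (ψ : L ≃ L') (h : T.IsIso T' φ ψ) (e : ι → ℤ)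
    (x : ∀ v : ι, V.ext (T.In v)) (x' : ∀ v : ι', V.ext (T'.In v)),
    (∀ v, x v ∈ V.extGr _ (e v)) → (∀ v, x' (φ v) = V.reindex (h.inEquiv v) (x v)) →
      map T' x' = koszul φ e • W.reindex ψ (map T x)
  map_trivial : ∀ {ι L : Type} [Fintype ι] [LinearOrder ι] [Finite L] [IsEmpty ι] (T : RTree ι L),
    map T = 0

section Compositions

variable {ι L : Type} [Fintype ι] [LinearOrder ι] [Finite L]

/-- `∑_{T' ⊂ T} f(T/T') (Id ⊗ ⋯ ⊗ γ(T') ⊗ ⋯ ⊗ Id)` on homogeneous labels `x` of degrees `e`, for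
`γ` of degree `-1`; that is, the composite of `f` with the coderivation which extends `γ`.
The sum runs over the partitions of `T` with one distinguished subtree `r`; the projection onto
the generators kills the terms in which another subtree has more than one vertex. -/
noncomputable def compCoder {V : GrSMod.{w, u} K} {W : GrSMod.{w, u'} K} {k : ℤ}
    (f : TreeMap V W k) (γ : TreeMap V V (-1)) (T : RTree ι L) (e : ι → ℤ)
    (x : ∀ v : ι, V.ext (T.In v)) : W.ext L :=
  ∑ b : T.Partition, ∑ r : b.Roots,
    (koszul b.low e * (∑ i with b.low i < r.1, e i).negOnePow) •
      f.map b.quot (fun r' =>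
        if r' = r then γ.map (b.sub r') (b.restrict V x r')
        else (b.sub r').proj V (b.restrict V x r'))

/-- `∑_{T = T₁ ⊔ ⋯ ⊔ Tₖ} γ(T/T₁,…,Tₖ) (f(T₁) ⊗ ⋯ ⊗ f(Tₖ))` on homogeneous labels `x` of degrees
`e`, for `f` of degree `0`; that is, the composite of `γ` with the morphism of cofree conilpotent
cooperads which extends `f`. -/
noncomputable def compMor {V : GrSMod.{w, u} K} {W : GrSMod.{w, u'} K} {k : ℤ}
    (γ : TreeMap W W k) (f : TreeMap V W 0) (T : RTree ι L) (e : ι → ℤ)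
    (x : ∀ v : ι, V.ext (T.In v)) : W.ext L :=
  ∑ b : T.Partition,
    koszul b.low e • γ.map b.quot (fun r => f.map (b.sub r) (b.restrict V x r))

end Compositions

/-! ## Homotopy operads -/

/-- A direct sum of two gradings, given by internally graded modules, is a grading. -/
theorem isInternal_prod {M : Type u} {N : Type u'} [AddCommGroup M] [Module K M] [AddCommGroup N]
    [Module K N] {A : ℤ → Submodule K M} {B : ℤ → Submodule K N} (hA : DirectSum.IsInternal A)
    (hB : DirectSum.IsInternal B) : DirectSum.IsInternal fun k => (A k).prod (B k) := by
  rw [DirectSum.isInternal_submodule_iff_iSupIndep_and_iSup_eq_top] at hA hB ⊢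
  constructor
  · rw [iSupIndep_def]
    intro k
    have hle : (⨆ j, ⨆ (_ : j ≠ k), (A j).prod (B j)) ≤
        (⨆ j, ⨆ (_ : j ≠ k), A j).prod (⨆ j, ⨆ (_ : j ≠ k), B j) :=
      iSup₂_le fun j hj => Submodule.prod_mono (le_iSup₂_of_le j hj le_rfl)
        (le_iSup₂_of_le j hj le_rfl)
    refine Disjoint.mono_right hle ?_
    rw [Submodule.disjoint_def]
    rintro ⟨x, y⟩ ⟨hx, hy⟩ ⟨hx', hy'⟩
    exact Prod.ext (Submodule.disjoint_def.1 (iSupIndep_def.1 hA.1 k) x hx hx')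
      (Submodule.disjoint_def.1 (iSupIndep_def.1 hB.1 k) y hy hy')
  · rw [eq_top_iff, ← Submodule.prod_top, ← hA.2, ← hB.2]
    rintro ⟨x, y⟩ ⟨hx, hy⟩
    have h1 : (⨆ k, A k).map (LinearMap.inl K M N) ≤ ⨆ k, (A k).prod (B k) := by
      rw [Submodule.map_iSup]
      refine iSup_mono fun k => ?_
      rintro _ ⟨a, ha, rfl⟩
      exact ⟨ha, (B k).zero_mem⟩
    have h2 : (⨆ k, B k).map (LinearMap.inr K M N) ≤ ⨆ k, (A k).prod (B k) := by
      rw [Submodule.map_iSup]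
      refine iSup_mono fun k => ?_
      rintro _ ⟨a, ha, rfl⟩
      exact ⟨(A k).zero_mem, ha⟩
    have := Submodule.add_mem _ (h1 ⟨x, hx, rfl⟩) (h2 ⟨y, hy, rfl⟩)
    simpa using this

/-- The grading with shifted degrees. -/
theorem isInternal_shift {M : Type u} [AddCommGroup M] [Module K M] {A : ℤ → Submodule K M}
    (hA : DirectSum.IsInternal A) (c : ℤ) : DirectSum.IsInternal fun k => A (k - c) := by
  rw [DirectSum.isInternal_submodule_iff_iSupIndep_and_iSup_eq_top] at hA ⊢
  refine ⟨hA.1.comp (sub_left_injective (b := c)), ?_⟩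
  rw [← hA.2]
  exact (Equiv.subRight c).iSup_comp (g := A)

/-- The grading concentrated in one degree. -/
theorem isInternal_single {M : Type u} [AddCommGroup M] [Module K M] (c : ℤ) :
    DirectSum.IsInternal fun k : ℤ => if k = c then (⊤ : Submodule K M) else ⊥ := by
  rw [DirectSum.isInternal_submodule_iff_iSupIndep_and_iSup_eq_top]
  constructor
  · rw [iSupIndep_def]
    intro k
    by_cases hk : k = c
    · subst hk
      rw [show (⨆ j, ⨆ (_ : j ≠ k), if j = k then (⊤ : Submodule K M) else ⊥) = ⊥ from
        iSup₂_eq_bot.2 fun j hj => if_neg hj]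
      exact disjoint_bot_right
    · rw [if_neg hk]
      exact disjoint_bot_left
  · rw [eq_top_iff]
    exact le_iSup_of_le c (by rw [if_pos rfl])

/-- The graded `𝕊`-module `sP ⊕ K·v`, where `v` has arity `1` and degree `2`. An element is a pair
`(x, c)`, which stands for `sx + c·v`; the coefficient `c` is a scalar in arity `1` and absent in
the other arities. -/
noncomputable abbrev DGSMod.cogen (P : DGSMod.{w, u} K) : GrSMod.{w, max u w} K where
  obj n := P.obj n × (PLift (n = 1) → K)
  gr n k := (P.gr n (k - 1)).prod (if k = 2 then ⊤ else ⊥)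
  internal n := isInternal_prod (isInternal_shift (P.internal n) 1) (isInternal_single 2)
  ρ n := (P.ρ n).prod 1
  ρ_mem n σ _ x hx := ⟨P.ρ_mem n σ _ x.1 hx.1, hx.2⟩

/-- The suspension `x ↦ sx`, from `P` to `sP ⊕ K·v`. -/
noncomputable def DGSMod.susp (P : DGSMod.{w, u} K) : EquivMap P.toGrSMod P.cogen 1 where
  map n := LinearMap.inl K (P.obj n) (PLift (n = 1) → K)
  map_mem n l x hx := by
    refine ⟨?_, Submodule.zero_mem _⟩
    change x ∈ P.gr n (l + 1 - 1)
    rwa [add_sub_cancel_right]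
  map_ρ n σ x := Prod.ext rfl rfl

/-- The desuspended projection `sx + c·v ↦ x`, from `sP ⊕ K·v` to `P`. -/
noncomputable def DGSMod.desusp (P : DGSMod.{w, u} K) : EquivMap P.cogen P.toGrSMod (-1) where
  map n := LinearMap.fst K (P.obj n) (PLift (n = 1) → K)
  map_mem _ _ _ hx := hx.1
  map_ρ _ _ _ := rfl

/-- The curvature `θ` on an element of `(sP ⊕ K·v)(X)`: the coefficient at `v`, if `X` has exactly
one element, and zero otherwise. -/
noncomputable def DGSMod.theta (P : DGSMod.{w, u} K) (X : Type) (φ : P.cogen.ext X) : K :=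
  open scoped Classical in
  if h : Nonempty (X ≃ Fin 1) then (φ.1 1 h.some).2 ⟨rfl⟩ else 0

/-- The map `K·v → sP`, `v ↦ s1`, followed by desuspension. It is zero in arities other than `1`. -/
noncomputable def DGSMod.unitMap (P : DGSMod.{w, u} K) (one : P.obj 1) (n : ℕ) :
    (PLift (n = 1) → K) →ₗ[K] P.obj n :=
  ∑ h : PLift (n = 1), (LinearMap.proj h).smulRight (h.down ▸ one)

/-- The differential `sx ↦ -s(dx)`, `v ↦ s1` of `sP ⊕ K·v`, where `1 ∈ P(1)₀`. -/
noncomputable def DGSMod.barDiff (P : DGSMod.{w, u} K) (one : P.obj 1) (one_mem : one ∈ P.gr 1 0) :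
    EquivMap P.cogen P.cogen (-1) where
  map n := LinearMap.inl K (P.obj n) (PLift (n = 1) → K) ∘ₗ
    (P.unitMap one n ∘ₗ LinearMap.snd K (P.obj n) (PLift (n = 1) → K) -
      P.d.map n ∘ₗ LinearMap.fst K (P.obj n) (PLift (n = 1) → K))
  map_mem n l x hx := by
    obtain ⟨hx1, hx2⟩ := hx
    refine ⟨?_, Submodule.zero_mem _⟩
    have hd : P.d.map n x.1 ∈ P.gr n (l + -1 - 1) := by
      have := P.d.map_mem n (l - 1) x.1 hx1
      rwa [show l + -1 - 1 = l - 1 + -1 by ring]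
    refine Submodule.sub_mem _ ?_ hd
    change P.unitMap one n x.2 ∈ _
    by_cases hl : l = 2
    · subst hl
      rw [unitMap, LinearMap.sum_apply]
      refine Submodule.sum_mem _ fun h _ => ?_
      obtain ⟨rfl⟩ := h
      exact Submodule.smul_mem _ _ one_mem
    · have h0 : x.2 = 0 := by
        rw [if_neg hl] at hx2
        exact hx2
      rw [h0, map_zero]
      exact Submodule.zero_mem _
  map_ρ n σ x := by
    refine Prod.ext ?_ ?_
    · change P.unitMap one n x.2 - P.d.map n (P.ρ n σ x.1) =
        P.ρ n σ (P.unitMap one n x.2 - P.d.map n x.1)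
      have hu : P.ρ n σ (P.unitMap one n x.2) = P.unitMap one n x.2 := by
        by_cases hn : n = 1
        · subst hn
          rw [Subsingleton.elim σ 1, map_one]
          rfl
        · have : IsEmpty (PLift (n = 1)) := ⟨fun h => hn h.down⟩
          rw [Subsingleton.elim x.2 0, map_zero, map_zero]
      rw [map_sub, hu, P.d.map_ρ]
    · rfl

/-- The map `(θ ⊗ π - π ⊗ θ) Δ₂`. It is zero on the trees which do not have exactly two vertices;
on a tree with two vertices, the lower one labelled by `a` and the upper one by `b`, it is
`θ(a) b - a θ(b)`. The sum runs over the ordered pairs of distinct vertices `(u, c)`, where `θ` is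
applied to the label of `u`. -/
noncomputable def DGSMod.curvature (P : DGSMod.{w, u} K) {ι L : Type} [Fintype ι] [LinearOrder ι]
    (T : RTree ι L) (x : ∀ v : ι, P.cogen.ext (T.In v)) : P.cogen.ext L :=
  if Fintype.card ι = 2 then
    ∑ u, ∑ c, if u = c then 0 else
      (if T.target (Sum.inl u) = none then P.theta _ (x u) else -P.theta _ (x u)) •
        T.transfer P.cogen c (x c)
  else 0

/-- A homotopy operad structure on the dg `𝕊`-module `P`: an element `1 ∈ P(1)₀` and the structure
of a curved conilpotent cooperad on the cofree conilpotent cooperad `Tᶜ(sP ⊕ K·v)` with curvature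
`θ`. The coderivation is given by its projection `γ` onto the generators, which takes its values
in `sP` (this is `θ d = 0`) and which on the generators is `sx ↦ -s(dx)`, `v ↦ s1`. The equation
`d² = (θ ⊗ Id - Id ⊗ θ) Δ₂` between coderivations is stated on its projection onto the generators. -/
structure HomotopyOperad (P : DGSMod.{w, u} K) where
  one : P.obj 1
  one_mem : one ∈ P.gr 1 0
  γ : TreeMap P.cogen P.cogen (-1)
  theta_γ : ∀ {ι L : Type} [Fintype ι] [LinearOrder ι] [Finite L] (T : RTree ι L)
    (x : ∀ v : ι, P.cogen.ext (T.In v)), P.theta L (γ.map T x) = 0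
  γ_generators : ∀ {ι L : Type} [Fintype ι] [LinearOrder ι] [Finite L] [Unique ι] (T : RTree ι L)
    (x : ∀ v : ι, P.cogen.ext (T.In v)),
    γ.map T x = T.transfer P.cogen default ((P.barDiff one one_mem).ext _ (x default))
  γ_γ : ∀ {ι L : Type} [Fintype ι] [LinearOrder ι] [Finite L] (T : RTree ι L) (e : ι → ℤ)
    (x : ∀ v : ι, P.cogen.ext (T.In v)), (∀ v, x v ∈ P.cogen.extGr _ (e v)) →
    compCoder γ γ T e x = P.curvature T x

/-- An `∞`-morphism of homotopy operads: a morphism between the bar constructions, given by its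
projection `f` onto the generators. The three conditions are that it commutes with the curvatures
and with the coderivations. -/
structure InfMorphism {P : DGSMod.{w, u} K} {Q : DGSMod.{w, u'} K} (hP : HomotopyOperad P)
    (hQ : HomotopyOperad Q) where
  f : TreeMap P.cogen Q.cogen 0
  theta_f : ∀ {ι L : Type} [Fintype ι] [LinearOrder ι] [Finite L] (T : RTree ι L)
    (x : ∀ v : ι, P.cogen.ext (T.In v)),
    Q.theta L (f.map T x) = P.theta L (T.proj P.cogen x)
  f_γ : ∀ {ι L : Type} [Fintype ι] [LinearOrder ι] [Finite L] (T : RTree ι L) (e : ι → ℤ)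
    (x : ∀ v : ι, P.cogen.ext (T.In v)), (∀ v, x v ∈ P.cogen.extGr _ (e v)) →
    compMor hQ.γ f T e x = compCoder f hP.γ T e x

namespace InfMorphism

variable {P : DGSMod.{w, u} K} {Q : DGSMod.{w, u'} K} {hP : HomotopyOperad P}
  {hQ : HomotopyOperad Q}

/-- The restriction of the `∞`-morphism to `sP` is the map `sx ↦ s(h x)`. -/
def RestrictsTo (F : InfMorphism hP hQ) (h : EquivMap P.toGrSMod Q.toGrSMod 0) : Prop :=
  ∀ (ι L : Type) [Fintype ι] [LinearOrder ι] [Finite L] [Unique ι] (T : RTree ι L)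
    (x : ∀ v : ι, P.ext (T.In v)),
    F.f.map T (fun v => P.susp.ext _ (x v)) =
      T.transfer Q.cogen default (Q.susp.ext _ (h.ext _ (x default)))

/-- Strict morphisms: `f` vanishes on the trees with at least two vertices, and the component of
`f(v)` in `sQ` is zero. -/
def IsStrict (F : InfMorphism hP hQ) : Prop :=
  (∀ (ι L : Type) [Fintype ι] [LinearOrder ι] [Finite L] (T : RTree ι L)
    (x : ∀ v : ι, P.cogen.ext (T.In v)), 2 ≤ Fintype.card ι → F.f.map T x = 0) ∧
  (∀ (ι L : Type) [Fintype ι] [LinearOrder ι] [Finite L] [Unique ι] (T : RTree ι L)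
    (x : ∀ v : ι, P.cogen.ext (T.In v)), (∀ v, P.desusp.ext _ (x v) = 0) →
      Q.desusp.ext _ (F.f.map T x) = 0)

end InfMorphism

/-- `∞`-isotopies: `∞`-morphisms between two structures on the same dg `𝕊`-module `P` whose
restriction to `sP` is the identity. -/
def InfMorphism.IsIsotopy {P : DGSMod.{w, u} K} {hP hP' : HomotopyOperad P}
    (F : InfMorphism hP hP') : Prop :=
  F.RestrictsTo (EquivMap.id P.toGrSMod)

end HtpyOperad

/-!
A homotopy operad structure on `P` is a coderivation of the cofree cooperad on `sP ⊕ K·v`, and the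
structure of `P` descends along `p` exactly when this coderivation, projected to the generators,
sends the labellings of trees with at least one label in the kernel of `p` to the kernel of `p`.
The idea is to replace the structure by an isotopic one with this property. An isotopy costs
nothing: for any map `f` which is the identity on the generators and compatible with `θ`, the
equation `γ' ∘ f = f ∘ γ` can be solved for `γ'` by induction on the number of vertices
(`TreeMap.transport_comp`), and `γ'` is again a homotopy operad structure
(`HomotopyOperad.transportOperad`). So it remains to choose `f`.

The choice is made by induction on the number of vertices. Suppose that `γ'` preserves the kernel
of `p` on the trees with at most `n` vertices. Since the square of `γ'` is given by the curvature,
on the trees with `n + 1` vertices `γ'` is, modulo the kernel of `p` and on labellings with at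
least one label in this kernel, a cycle for the differential of generators
(`TreeMap.PreservesKernel.ext_star_self`). In characteristic zero, `p` has an equivariant section
and its kernel is contractible by an equivariant homotopy (`DGSMod.Hom.exists_section`,
`DGSMod.Hom.exists_contraction`). The homotopy `h` on generators extends to the tensors with at
least one factor in the kernel: the commutator of the differential and of `h` at all the vertices
is `∑_v π_v`, where `π` is a projection onto the kernel applied at the vertex `v`, and this
operator is inverted by dividing by the number of factors in the kernel (`TreeMap.spread`,
`TreeMap.sum_spread_update`). This symmetric form of the homotopy is natural for the automorphisms
of trees. The cycle is therefore a boundary, and subtracting a primitive from `f` makes `γ'`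
preserve the kernel on the trees with `n + 1` vertices (`HomotopyOperad.IsAdapted.exists_next`).
The successive corrections concern larger and larger trees, so that they have a limit
(`HomotopyOperad.exists_isAdapted`). The structure obtained in this way induces one on `Q`, namely
`p ∘ γ' ∘ s` for a section `s` (`HomotopyOperad.pushforwardOperad`).

The formal properties of coderivations and morphisms of cofree cooperads are proved for maps out
of tree modules. If `α ∘ D_β` is the composite of `α` with the coderivation that extends `β`
(`TreeMap.star`) and `g ∘ F_f` is the composite of `g` with the morphism that extends `f`
(`TreeMap.comp`), then these operations are associative whenever this makes sense
(`TreeMap.star_comp`, `TreeMap.comp_star`, `TreeMap.star_star`). The reason is that a partition of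
a tree together with a partition of the quotient amounts to a partition together with a partition
of each subtree (`RTree.Partition.sum_nested`), with the same Koszul sign
(`RTree.Partition.sexp_nested`). Finally, the curvature commutes with the morphisms that are
compatible with `θ`: in both composites, `θ` removes a vertex with one input, and the values on
the remaining tree have the same coefficients (`RTree.Partition.curvature_natural`). Signs and
compositions are first defined on homogeneous labels, and extended to all labels by projecting
them to their parts of even and odd degree (`TreeMap.ofParity`).
-/

namespace HtpyOperad

universe w u u' u'' u'''

variable {K : Type w} [Field K]

set_option linter.unusedSectionVars false

/-! ### Signs -/

/-- The sign `(-1)^a` of a parity `a`, as a scalar. -/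
def sgn (K : Type w) [Field K] (a : ZMod 2) : K := if a = 0 then 1 else -1

@[simp] theorem sgn_zero : sgn K 0 = 1 := if_pos rfl

@[simp] theorem sgn_one : sgn K 1 = -1 := if_neg (by decide)

theorem sgn_add (a b : ZMod 2) : sgn K (a + b) = sgn K a * sgn K b := by
  have h : ∀ c : ZMod 2, c = 0 ∨ c = 1 := by decide
  have h2 : (1 : ZMod 2) + 1 = 0 := by decide
  rcases h a with rfl | rfl <;> rcases h b with rfl | rfl <;> simp [h2]

theorem sgn_sum {α : Type*} (s : Finset α) (f : α → ZMod 2) :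
    sgn K (∑ i ∈ s, f i) = ∏ i ∈ s, sgn K (f i) := by
  classical
  induction s using Finset.induction_on with
  | empty => simp
  | insert a s ha ih => rw [Finset.sum_insert ha, Finset.prod_insert ha, sgn_add, ih]

@[simp] theorem sgn_mul_self (a : ZMod 2) : sgn K a * sgn K a = 1 := by
  rw [← sgn_add, CharTwo.add_self_eq_zero, sgn_zero]

theorem negOnePow_cast (n : ℤ) : (((n.negOnePow : ℤˣ) : ℤ) : K) = sgn K (n : ZMod 2) := by
  rcases Int.even_or_odd n with h | h
  · rw [Int.negOnePow_even n h, (ZMod.intCast_eq_zero_iff_even).2 h]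
    simp
  · rw [Int.negOnePow_odd n h, (ZMod.intCast_eq_one_iff_odd).2 h]
    simp

theorem units_smul_eq {M : Type*} [AddCommGroup M] [Module K M] (s : ℤˣ) (x : M) :
    s • x = ((s : ℤ) : K) • x := by
  rw [Units.smul_def, Int.cast_smul_eq_zsmul]

/-- The exponent of the Koszul sign `koszul φ e`, as a function of the parities of the degrees. -/
def kz {ι κ : Type} [Fintype ι] [LinearOrder ι] [LinearOrder κ] (φ : ι → κ) (p : ι → ZMod 2) :
    ZMod 2 :=
  ∑ i, ∑ j, if i < j ∧ φ j < φ i then p i * p j else 0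

/-- The parities of a family of degrees. -/
def par {ι : Type} (e : ι → ℤ) (i : ι) : ZMod 2 := (e i : ZMod 2)

theorem koszul_cast {ι κ : Type} [Fintype ι] [LinearOrder ι] [LinearOrder κ] (φ : ι → κ)
    (e : ι → ℤ) : (((koszul φ e : ℤˣ) : ℤ) : K) = sgn K (kz φ (par e)) := by
  unfold koszul kz
  rw [sgn_sum, Units.coe_prod, Int.cast_prod]
  refine Finset.prod_congr rfl fun _ _ => ?_
  rw [sgn_sum, Units.coe_prod, Int.cast_prod]
  refine Finset.prod_congr rfl fun _ _ => ?_
  split_ifs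
  · rw [negOnePow_cast, Int.cast_mul]
    rfl
  · simp

theorem koszul_smul {M : Type*} [AddCommGroup M] [Module K M] {ι κ : Type} [Fintype ι]
    [LinearOrder ι] [LinearOrder κ] (φ : ι → κ) (e : ι → ℤ) (x : M) :
    koszul φ e • x = sgn K (kz φ (par e)) • x := by
  rw [units_smul_eq (K := K), koszul_cast]

theorem kz_of_strictMono {ι κ : Type} [Fintype ι] [LinearOrder ι] [LinearOrder κ] {φ : ι → κ}
    (h : StrictMono φ) (p : ι → ZMod 2) : kz φ p = 0 :=
  Finset.sum_eq_zero fun _ _ => Finset.sum_eq_zero fun _ _ =>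
    if_neg fun hij => (h hij.1).asymm hij.2

/-- Double sums agree if their terms agree after symmetrization. -/
theorem sum_pairs_congr {ι A : Type*} [Fintype ι] [LinearOrder ι] [AddCommMonoid A]
    {F G : ι → ι → A} (h : ∀ i j, i < j → F i j + F j i = G i j + G j i)
    (hd : ∀ i, F i i = G i i) : ∑ i, ∑ j, F i j = ∑ i, ∑ j, G i j := by
  have key : ∀ H : ι → ι → A, ∑ i, ∑ j, H i j =
      ∑ i, (∑ j, if i < j then H i j + H j i else 0) + ∑ i, H i i := by
    intro H
    have h1 : ∑ i, ∑ j, (if j < i then H i j else 0) = ∑ i, ∑ j, if i < j then H j i else 0 :=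
      Finset.sum_comm
    have h2 : ∀ i, H i i = ∑ j, if i = j then H i j else 0 := by
      intro i
      rw [Finset.sum_ite_eq]
      simp
    simp only [h2]
    have h3 : ∀ i j, (if i < j then H i j + H j i else 0) =
        (if i < j then H i j else 0) + if i < j then H j i else 0 := by
      intro i j
      split_ifs <;> simp
    simp only [h3, Finset.sum_add_distrib]
    rw [← h1]
    simp only [← Finset.sum_add_distrib]
    refine Finset.sum_congr rfl fun i _ => Finset.sum_congr rfl fun j _ => ?_
    rcases lt_trichotomy i j with hij | hij | hij
    · simp [hij, hij.asymm, hij.ne]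
    · simp [hij]
    · simp [hij, hij.asymm, hij.ne']
  rw [key F, key G]
  congr 1
  · refine Finset.sum_congr rfl fun i _ => Finset.sum_congr rfl fun j _ => ?_
    split_ifs with hij
    · exact h i j hij
    · rfl
  · exact Finset.sum_congr rfl fun i _ => hd i

/-! ### Graded symmetric modules -/

/-- Multilinear maps that agree on spanning sets are equal. -/
theorem multilinear_ext_of_span {ι : Type*} [Finite ι] {M : ι → Type*} {N : Type*}
    [∀ i, AddCommGroup (M i)] [∀ i, Module K (M i)] [AddCommGroup N] [Module K N]
    {f g : MultilinearMap K M N} (S : ∀ i, Set (M i)) (hS : ∀ i, Submodule.span K (S i) = ⊤)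
    (h : ∀ x : ∀ i, M i, (∀ i, x i ∈ S i) → f x = g x) : f = g := by
  classical
  have := Fintype.ofFinite ι
  have key : ∀ s : Finset ι, ∀ x : ∀ i, M i, (∀ i, i ∉ s → x i ∈ S i) → f x = g x := by
    intro s
    induction s using Finset.induction_on with
    | empty => exact fun x hx => h x fun i => hx i (Finset.notMem_empty i)
    | insert a s ha ih =>
      intro x hx
      have main : ∀ y ∈ Submodule.span K (S a),
          f (Function.update x a y) = g (Function.update x a y) := by
        intro y hy
        induction hy using Submodule.span_induction with
        | mem y hy =>
          refine ih _ fun i hi => ?_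
          by_cases hia : i = a
          · subst hia
            simpa using hy
          · rw [Function.update_of_ne hia]
            exact hx i (by simp [hia, hi])
        | zero => simp
        | add y z _ _ hy hz => rw [f.map_update_add, g.map_update_add, hy, hz]
        | smul c y _ hy => rw [f.map_update_smul, g.map_update_smul, hy]
      simpa using main (x a) (by rw [hS a]; trivial)
  ext x
  exact key Finset.univ x fun i hi => (hi (Finset.mem_univ i)).elim

namespace GrSMod

section Assemble

variable {M : Type*} {N : Type*} [AddCommGroup M] [Module K M] [AddCommGroup N] [Module K N]
  {A : ℤ → Submodule K M}

/-- The linear map on a graded module that is given by `F k` in degree `k`. -/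
noncomputable def assemble (hA : DirectSum.IsInternal A) (F : ℤ → M →ₗ[K] N) : M →ₗ[K] N :=
  letI := hA.chooseDecomposition
  DirectSum.toModule K ℤ N (fun k => (F k).comp (A k).subtype) ∘ₗ
    (DirectSum.decomposeLinearEquiv A).toLinearMap

theorem assemble_apply (hA : DirectSum.IsInternal A) (F : ℤ → M →ₗ[K] N) {k : ℤ} {x : M}
    (hx : x ∈ A k) : assemble hA F x = F k x := by
  let _ := hA.chooseDecomposition
  change DirectSum.toModule K ℤ N (fun k => (F k).comp (A k).subtype) (DirectSum.decompose A x) = _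
  rw [DirectSum.decompose_of_mem A hx]
  exact DirectSum.toModule_lof K k (M := fun k => A k) ⟨x, hx⟩

theorem span_homogeneous (hA : DirectSum.IsInternal A) :
    Submodule.span K {x | ∃ k, x ∈ A k} = ⊤ := by
  rw [eq_top_iff, ← hA.submodule_iSup_eq_top, iSup_le_iff]
  exact fun k x hx => Submodule.subset_span ⟨k, hx⟩

theorem linear_ext (hA : DirectSum.IsInternal A) {f g : M →ₗ[K] N}
    (h : ∀ k, ∀ x ∈ A k, f x = g x) : f = g :=
  LinearMap.ext_on (span_homogeneous hA) fun x ⟨k, hx⟩ => h k x hx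

end Assemble

variable (V : GrSMod.{w, u} K)

/-- The endomorphism of a graded `𝕊`-module that multiplies by the scalar `c k` in degree `k`. -/
noncomputable def scal (c : ℤ → K) : EquivMap V V 0 where
  map n := assemble (V.internal n) fun k => c k • LinearMap.id
  map_mem n l x hx := by
    rw [assemble_apply _ _ hx, add_zero]
    exact Submodule.smul_mem _ _ hx
  map_ρ n σ x := by
    have : (assemble (V.internal n) fun k => c k • LinearMap.id) ∘ₗ V.ρ n σ =
        V.ρ n σ ∘ₗ assemble (V.internal n) fun k => c k • LinearMap.id := by
      refine linear_ext (V.internal n) fun k y hy => ?_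
      simp only [LinearMap.comp_apply]
      rw [assemble_apply _ _ hy, assemble_apply _ _ (V.ρ_mem n σ k y hy)]
      simp
    exact LinearMap.congr_fun this x

theorem scal_map {c : ℤ → K} {n : ℕ} {k : ℤ} {x : V.obj n} (hx : x ∈ V.gr n k) :
    (V.scal c).map n x = c k • x := assemble_apply _ _ hx

theorem scal_ext {c : ℤ → K} {X : Type} {k : ℤ} {x : V.ext X} (hx : x ∈ V.extGr X k) :
    (V.scal c).ext X x = c k • x := by
  ext n e
  exact V.scal_map (hx n e)

variable {V}

/-- An element of `V(X)` is determined by its value at one numbering of `X`. -/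
theorem ext_eq {X : Type} {x y : V.ext X} {n : ℕ} (e : X ≃ Fin n) (h : x.1 n e = y.1 n e) :
    x = y := by
  ext m e'
  obtain rfl : m = n := by
    have := Fintype.card_congr (e'.symm.trans e)
    simpa using this
  have : e' = e.trans (e.symm.trans e') := by
    ext
    simp
  rw [this, x.2, y.2, h]

theorem reindex_refl {X : Type} (x : V.ext X) : V.reindex (Equiv.refl X) x = x := rfl

theorem reindex_reindex {X Y Z : Type} (g : X ≃ Y) (h : Y ≃ Z) (x : V.ext X) :
    V.reindex h (V.reindex g x) = V.reindex (g.trans h) x := rfl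

theorem reindex_mem {X Y : Type} (g : X ≃ Y) {k : ℤ} {x : V.ext X} (hx : x ∈ V.extGr X k) :
    V.reindex g x ∈ V.extGr Y k := fun n e => hx n (g.trans e)

theorem reindex_symm_apply {X Y : Type} (g : X ≃ Y) (x : V.ext X) :
    V.reindex g.symm (V.reindex g x) = x := by
  rw [reindex_reindex, Equiv.self_trans_symm, reindex_refl]

theorem reindex_apply_symm {X Y : Type} (g : X ≃ Y) (x : V.ext Y) :
    V.reindex g (V.reindex g.symm x) = x := by
  rw [reindex_reindex, Equiv.symm_trans_self, reindex_refl]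

/-- The homogeneous elements span `V(X)`. -/
theorem span_extGr (X : Type) : Submodule.span K {x : V.ext X | ∃ k, x ∈ V.extGr X k} = ⊤ := by
  classical
  by_cases hX : ∃ n, Nonempty (X ≃ Fin n)
  · obtain ⟨n, ⟨e⟩⟩ := hX
    rw [eq_top_iff]
    rintro x -
    -- the homogeneous components are taken at the numbering `e`; the projections `V.scal (c k)`
    -- extend them to all the numberings
    let _ := (V.internal n).chooseDecomposition
    set c : ℤ → ℤ → K := fun k l => if l = k then 1 else 0 with hc
    have hx : x = ∑ k ∈ DFinsupp.support (DirectSum.decompose (V.gr n) (x.1 n e)),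
        (V.scal (c k)).ext X x := by
      refine ext_eq e ?_
      have h1 : ∀ k, ((V.scal (c k)).ext X x).1 n e =
          (DirectSum.decompose (V.gr n) (x.1 n e) k : V.obj n) := by
        intro k
        change (V.scal (c k)).map n (x.1 n e) = _
        have : (V.scal (c k)).map n = (V.gr n k).subtype ∘ₗ DirectSum.component K ℤ _ k ∘ₗ
            (DirectSum.decomposeLinearEquiv (V.gr n)).toLinearMap := by
          refine linear_ext (V.internal n) fun l y hy => ?_
          rw [V.scal_map hy]
          change _ = (DirectSum.decompose (V.gr n) y k : V.obj n)
          by_cases hlk : l = k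
          · subst hlk
            rw [DirectSum.decompose_of_mem_same _ hy]
            simp [hc]
          · rw [DirectSum.decompose_of_mem_ne _ hy hlk]
            simp [hc, hlk]
        rw [this]
        rfl
      rw [AddSubmonoidClass.coe_finsetSum, Finset.sum_apply, Finset.sum_apply]
      simp only [h1]
      exact (DirectSum.sum_support_decompose (V.gr n) (x.1 n e)).symm
    rw [hx]
    refine Submodule.sum_mem _ fun k _ => Submodule.subset_span ⟨k, fun m e' => ?_⟩
    change (V.scal (c k)).map m (x.1 m e') ∈ _
    have hr : LinearMap.range ((V.scal (c k)).map m) ≤ V.gr m k := by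
      rw [LinearMap.range_eq_map, ← span_homogeneous (V.internal m), Submodule.map_span_le]
      rintro y ⟨l, hy⟩
      rw [V.scal_map hy]
      by_cases hlk : l = k
      · exact Submodule.smul_mem _ _ (hlk ▸ hy)
      · simp [hc, hlk]
    exact hr ⟨_, rfl⟩
  · have : Subsingleton (V.ext X) := ⟨fun x y => by
      ext n e
      exact (hX ⟨n, ⟨e⟩⟩).elim⟩
    exact Subsingleton.elim _ _

end GrSMod

namespace EquivMap

variable {V : GrSMod.{w, u} K} {W : GrSMod.{w, u'} K} {k : ℤ}

theorem ext_reindex (f : EquivMap V W k) {X Y : Type} (g : X ≃ Y) (x : V.ext X) :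
    f.ext Y (V.reindex g x) = W.reindex g (f.ext X x) := rfl

theorem ext_mem (f : EquivMap V W k) {X : Type} {l : ℤ} {x : V.ext X} (hx : x ∈ V.extGr X l) :
    f.ext X x ∈ W.extGr X (l + k) := fun n e => f.map_mem n l _ (hx n e)

theorem id_ext {X : Type} (x : V.ext X) : (EquivMap.id V).ext X x = x := rfl

end EquivMap

/-- Multilinear maps on labels of a tree agree if they agree on homogeneous labels. -/
theorem multilinear_ext_homogeneous {ι : Type} [Finite ι] {X : ι → Type}
    {V : GrSMod.{w, u} K} {N : Type*} [AddCommGroup N] [Module K N]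
    {f g : MultilinearMap K (fun i => V.ext (X i)) N}
    (h : ∀ (e : ι → ℤ) (x : ∀ i, V.ext (X i)), (∀ i, x i ∈ V.extGr _ (e i)) → f x = g x) :
    f = g := by
  refine multilinear_ext_of_span (fun i => {x | ∃ k, x ∈ V.extGr (X i) k})
    (fun i => GrSMod.span_extGr (X i)) fun x hx => ?_
  choose e he using hx
  exact h e x he

/-! ### Maps natural for order-preserving isomorphisms of trees -/

/-- Families of multilinear maps, one for each tree with linearly ordered vertices, natural for the
isomorphisms of trees that preserve the order of the vertices. No sign occurs for these, so that
such maps need neither a degree nor homogeneous labels. -/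
structure OMap (V : GrSMod.{w, u} K) (W : GrSMod.{w, u'} K) where
  map : ∀ {ι L : Type} [Fintype ι] [LinearOrder ι] [Finite L] (T : RTree ι L),
    MultilinearMap K (fun v : ι => V.ext (T.In v)) (W.ext L)
  nat : ∀ {ι L ι' L' : Type} [Fintype ι] [LinearOrder ι] [Finite L]
    [Fintype ι'] [LinearOrder ι'] [Finite L'] (T : RTree ι L) (T' : RTree ι' L')
    (φ : ι ≃ ι') (ψ : L ≃ L') (h : T.IsIso T' φ ψ), StrictMono φ →
    ∀ (x : ∀ v : ι, V.ext (T.In v)) (x' : ∀ v : ι', V.ext (T'.In v)),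
    (∀ v, x' (φ v) = V.reindex (h.inEquiv v) (x v)) → map T' x' = W.reindex ψ (map T x)

/-- Precomposition of a multilinear map with linear maps, along a bijection of the indices. -/
def pullMultilinear {ι ι' : Type*} {M : ι → Type*} {M' : ι' → Type*} {N : Type*}
    [∀ i, AddCommGroup (M i)] [∀ i, Module K (M i)] [∀ i, AddCommGroup (M' i)]
    [∀ i, Module K (M' i)] [AddCommGroup N] [Module K N] (φ : ι ≃ ι')
    (R : ∀ v, M' (φ v) →ₗ[K] M v) (f : MultilinearMap K M N) : MultilinearMap K M' N :=
  have key : ∀ [DecidableEq ι] [DecidableEq ι'] (x : ∀ v, M' v) (a : ι) (y : M' (φ a)),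
      (fun v => R v (Function.update x (φ a) y (φ v))) =
        Function.update (fun v => R v (x (φ v))) a (R a y) := by
    intro _ _ x a y
    funext v
    by_cases hv : v = a
    · subst hv
      simp
    · rw [Function.update_of_ne hv, Function.update_of_ne (φ.injective.ne hv)]
  { toFun := fun x => f fun v => R v (x (φ v))
    map_update_add' := by
      classical
      intro i x a y z
      obtain ⟨a', rfl⟩ := φ.surjective a
      have e : i = fun a b => Classical.propDecidable (a = b) := Subsingleton.elim _ _
      subst e
      rw [key, key, key, map_add, f.map_update_add]
    map_update_smul' := by
      classical
      intro i x a c y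
      obtain ⟨a', rfl⟩ := φ.surjective a
      have e : i = fun a b => Classical.propDecidable (a = b) := Subsingleton.elim _ _
      subst e
      rw [key, key, map_smul, f.map_update_smul] }

theorem pullMultilinear_apply {ι ι' : Type*} {M : ι → Type*} {M' : ι' → Type*} {N : Type*}
    [∀ i, AddCommGroup (M i)] [∀ i, Module K (M i)] [∀ i, AddCommGroup (M' i)]
    [∀ i, Module K (M' i)] [AddCommGroup N] [Module K N] (φ : ι ≃ ι')
    (R : ∀ v, M' (φ v) →ₗ[K] M v) (f : MultilinearMap K M N) (x : ∀ v, M' v) :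
    pullMultilinear φ R f x = f fun v => R v (x (φ v)) := rfl

/-- The underlying family of maps of a map out of the tree module. -/
def TreeMap.toOMap {V : GrSMod.{w, u} K} {W : GrSMod.{w, u'} K} {k : ℤ} (f : TreeMap V W k) :
    OMap V W where
  map T := f.map T
  nat T T' φ ψ h hφ x x' hx := by
    have main : f.map T' = (W.reindex ψ).compMultilinearMap
        (pullMultilinear φ (fun v => V.reindex (h.inEquiv v).symm) (f.map T)) := by
      refine multilinear_ext_homogeneous fun e' y hy => ?_
      rw [LinearMap.compMultilinearMap_apply, pullMultilinear_apply]
      rw [f.natural T T' φ ψ h (fun v => e' (φ v))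
        (fun v => V.reindex (h.inEquiv v).symm (y (φ v))) y
        (fun v => GrSMod.reindex_mem _ (hy (φ v)))
        (fun v => (GrSMod.reindex_apply_symm _ _).symm), koszul_smul (K := K),
        kz_of_strictMono hφ, sgn_zero, one_smul]
    rw [main, LinearMap.compMultilinearMap_apply, pullMultilinear_apply]
    congr 2
    funext v
    rw [hx, GrSMod.reindex_symm_apply]

theorem symm_eq_trans {A B X D : Type} (f : D ≃ X) (a : B ≃ X) (b : A ≃ B) (c : A ≃ D)
    (h : ∀ z, f (c z) = a (b z)) : f.symm = a.symm.trans (b.symm.trans c) := by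
  ext y
  rw [Equiv.symm_apply_eq]
  simp [h]

namespace RTree

variable {ι L ι' L' : Type}

theorem isIso_of_iff {T : RTree ι L} {T' : RTree ι' L'} {φ : ι ≃ ι'} {ψ : L ≃ L'}
    (h : ∀ z v, T.target z = some v ↔ T'.target (Equiv.sumCongr φ ψ z) = some (φ v)) :
    T.IsIso T' φ ψ := by
  intro z
  refine Option.ext fun v' => ?_
  obtain ⟨v, rfl⟩ := φ.surjective v'
  rw [← h z v, Option.map_eq_some_iff]
  simp

theorem IsIso.target_iff {T : RTree ι L} {T' : RTree ι' L'} {φ : ι ≃ ι'} {ψ : L ≃ L'}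
    (h : T.IsIso T' φ ψ) (z : ι ⊕ L) (v : ι) :
    T'.target (Equiv.sumCongr φ ψ z) = some (φ v) ↔ T.target z = some v := by
  rw [h z, Option.map_eq_some_iff]
  simp

namespace Partition

variable {T : RTree ι L} (b : T.Partition)

theorem ext_low {b b' : T.Partition} (h : ∀ v, b.low v = b'.low v) : b = b' := by
  cases b
  cases b'
  congr
  exact funext h

/-- The subtree of a vertex. -/
def root (v : ι) : b.Roots := ⟨b.low v, b.idem v⟩

theorem quot_target_iff {z : b.Roots ⊕ L} {r : b.Roots} :
    b.quot.target z = some r ↔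
      ∃ u, T.target (Sum.map Subtype.val id z) = some u ∧ b.low u = r.1 := by
  refine Option.map_eq_some_iff.trans (exists_congr fun u => and_congr_right fun _ => ?_)
  exact Subtype.ext_iff

theorem sub_target_iff {r : b.Roots} {z : b.Block r ⊕ b.quot.In r} {v : b.Block r} :
    (b.sub r).target z = some v ↔ T.target (b.incl r z) = some v.1 := by
  refine Option.bind_eq_some_iff.trans ?_
  simp only [b.toBlock_eq_some]
  constructor
  · rintro ⟨u, hu, rfl⟩
    exact hu
  · intro h
    exact ⟨_, h, rfl⟩

section Glue

variable [Fintype ι] [LinearOrder ι] [Finite L]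
  {V : GrSMod.{w, u} K} {W : GrSMod.{w, u'} K} {W' : GrSMod.{w, u''} K}

theorem restrict_update (x : ∀ v, V.ext (T.In v)) (a : ι) (y : V.ext (T.In a))
    (h : ι → OMap V W) :
    (fun r : b.Roots => (h r.1).map (b.sub r) (b.restrict V (Function.update x a y) r)) =
      Function.update (fun r : b.Roots => (h r.1).map (b.sub r) (b.restrict V x r)) (b.root a)
        ((h (b.root a).1).map (b.sub (b.root a)) (Function.update
          (b.restrict V x (b.root a)) ⟨a, rfl⟩
            (V.reindex (b.inEquiv (b.root a) ⟨a, rfl⟩).symm y))) := by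
  funext r
  by_cases hr : r = b.root a
  · subst hr
    rw [Function.update_self]
    congr 1
    funext v
    by_cases hv : v = ⟨a, rfl⟩
    · subst hv
      simp [restrict]
    · rw [Function.update_of_ne hv]
      have : v.1 ≠ a := fun h => hv (Subtype.ext h)
      simp [restrict, this]
  · rw [Function.update_of_ne hr]
    congr 1
    funext v
    have : v.1 ≠ a := fun h => hr (Subtype.ext (by rw [← v.2, h]; rfl))
    simp [restrict, this]

/-- The map `g(T/T₁,…,Tₖ) ∘ (h₁(T₁) ⊗ ⋯ ⊗ hₖ(Tₖ))`, without sign. The maps `h` are indexed by the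
lowest vertices of the subtrees. -/
noncomputable def glue (g : OMap W W') (h : ι → OMap V W) :
    MultilinearMap K (fun v => V.ext (T.In v)) (W'.ext L) where
  toFun x := g.map b.quot fun r => (h r.1).map (b.sub r) (b.restrict V x r)
  map_update_add' {inst} x a y z := by
    obtain rfl : inst = LinearOrder.toDecidableEq := Subsingleton.elim _ _
    rw [restrict_update, restrict_update, restrict_update, map_add, MultilinearMap.map_update_add,
      MultilinearMap.map_update_add]
  map_update_smul' {inst} x a c y := by
    obtain rfl : inst = LinearOrder.toDecidableEq := Subsingleton.elim _ _
    rw [restrict_update, restrict_update, map_smul, MultilinearMap.map_update_smul,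
      MultilinearMap.map_update_smul]

theorem glue_apply (g : OMap W W') (h : ι → OMap V W) (x : ∀ v, V.ext (T.In v)) :
    b.glue g h x = g.map b.quot fun r => (h r.1).map (b.sub r) (b.restrict V x r) := rfl

end Glue

/-! ### Nested partitions -/

section Nested

variable (C : T.Partition) (β : ∀ s : C.Roots, (C.sub s).Partition)

theorem low_eq_of_target_none {T : RTree ι L} (b : T.Partition) {v : ι}
    (h : T.target (Sum.inl v) = none) : b.low v = v := by
  rcases b.cond v with hv | ⟨u, hu, -⟩
  · exact hv
  · rw [h] at hu
    cases hu

theorem sub_target_root {r : C.Roots} : (C.sub r).target (Sum.inl ⟨r.1, r.2⟩) = none := by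
  rw [Option.eq_none_iff_forall_ne_some]
  intro v hv
  rw [sub_target_iff] at hv
  exact C.parent_ne hv v.2

theorem root_low {s : C.Roots} (v : C.Block s) :
    ((β (C.root v.1)).low ⟨v.1, rfl⟩).1 = ((β s).low v).1 := by
  obtain ⟨r, hr⟩ := s
  obtain ⟨v, hv⟩ := v
  change C.low v = r at hv
  subst hv
  rfl

/-- The partition obtained from a partition of every subtree of a partition. -/
def refine : T.Partition where
  low v := ((β (C.root v)).low ⟨v, rfl⟩).1
  cond v := by
    rcases (β (C.root v)).cond ⟨v, rfl⟩ with h | ⟨⟨u, hu'⟩, hu, h⟩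
    · exact Or.inl (congrArg Subtype.val h)
    · refine Or.inr ⟨u, (C.sub_target_iff).1 hu, ?_⟩
      rw [h]
      exact (C.root_low β ⟨u, hu'⟩).symm

theorem refine_low {s : C.Roots} (v : C.Block s) : (C.refine β).low v.1 = ((β s).low v).1 :=
  C.root_low β v

theorem low_refine_low (v : ι) : C.low ((C.refine β).low v) = C.low v :=
  ((β (C.root v)).low ⟨v, rfl⟩).2

theorem refine_low_root (s : C.Roots) : (C.refine β).low s.1 = s.1 := by
  have := C.refine_low β (s := s) ⟨s.1, s.2⟩
  rwa [low_eq_of_target_none (β s) C.sub_target_root] at this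

/-- The partition induced by a partition on the quotient by a finer one. -/
def coarse : (C.refine β).quot.Partition where
  low r := ⟨C.low r.1, C.refine_low_root β (C.root r.1)⟩
  cond r := by
    rcases C.cond r.1 with h | ⟨u, hu, h⟩
    · exact Or.inl (Subtype.ext h)
    · refine Or.inr ⟨(C.refine β).root u, ?_, Subtype.ext ?_⟩
      · exact ((C.refine β).quot_target_iff).2 ⟨u, hu, rfl⟩
      · exact h.trans (C.low_refine_low β u).symm

/-- The subtrees of the coarse partition, viewed in the quotient by the finer one. -/
def coarseRoots : C.Roots ≃ (C.coarse β).Roots where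
  toFun s := ⟨⟨s.1, C.refine_low_root β s⟩, Subtype.ext s.2⟩
  invFun s := ⟨s.1.1, congrArg Subtype.val s.2⟩
  left_inv _ := rfl
  right_inv _ := rfl

/-- Contracting first the subtrees of the subtrees and then the subtrees amounts to contracting the
subtrees. -/
theorem coarse_quot_isIso :
    C.quot.IsIso (C.coarse β).quot (C.coarseRoots β) (Equiv.refl L) := by
  refine isIso_of_iff fun z s => ?_
  rw [quot_target_iff, quot_target_iff]
  have hz : ∀ z : C.Roots ⊕ L, Sum.map Subtype.val id (Sum.map Subtype.val id
      (Equiv.sumCongr (C.coarseRoots β) (Equiv.refl L) z)) = Sum.map Subtype.val id z := by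
    rintro (z | z) <;> rfl
  constructor
  · rintro ⟨u, hu, hs⟩
    refine ⟨(C.refine β).root u, (quot_target_iff _).2 ⟨u, ?_, rfl⟩, Subtype.ext ?_⟩
    · rw [hz, hu]
    · exact (C.low_refine_low β u).trans hs
  · rintro ⟨r, hr, hs⟩
    obtain ⟨u, hu, hur⟩ := (quot_target_iff _).1 hr
    rw [hz] at hu
    refine ⟨u, hu, ?_⟩
    have := congrArg Subtype.val hs
    change C.low r.1 = s.1 at this
    rw [← this, ← hur, low_refine_low]

/-- The vertices of the quotient of a subtree, viewed in a subtree of the quotient. -/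
def coarseBlock (s : C.Roots) : (β s).Roots ≃ (C.coarse β).Block (C.coarseRoots β s) where
  toFun r := ⟨⟨r.1.1, (C.refine_low β r.1).trans (congrArg Subtype.val r.2)⟩, Subtype.ext r.1.2⟩
  invFun r := ⟨⟨r.1.1, congrArg Subtype.val r.2⟩,
    Subtype.ext ((C.refine_low β ⟨r.1.1, congrArg Subtype.val r.2⟩).symm.trans r.1.2)⟩
  left_inv _ := rfl
  right_inv _ := rfl

theorem coarse_incl (s : C.Roots) (z : (β s).Roots ⊕ C.quot.In s) :
    Sum.map Subtype.val id ((C.coarse β).incl (C.coarseRoots β s)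
      (Equiv.sumCongr (C.coarseBlock β s) ((C.coarse_quot_isIso β).inEquiv s) z)) =
      C.incl s (Sum.map Subtype.val id z) := by
  rcases z with z | ⟨z | z, hz⟩ <;> rfl

/-- The subtrees of the quotient by the finer partition are the quotients of the subtrees. -/
theorem coarse_sub_isIso (s : C.Roots) :
    (β s).quot.IsIso ((C.coarse β).sub (C.coarseRoots β s)) (C.coarseBlock β s)
      ((C.coarse_quot_isIso β).inEquiv s) := by
  refine isIso_of_iff fun z r => ?_
  rw [quot_target_iff, sub_target_iff, quot_target_iff, coarse_incl]
  constructor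
  · rintro ⟨u, hu, hr⟩
    refine ⟨u.1, (sub_target_iff _).1 hu, ?_⟩
    rw [refine_low, hr]
    rfl
  · rintro ⟨u, hu, hr⟩
    change (C.refine β).low u = r.1.1 at hr
    have hs : C.low u = s.1 := by
      rw [← C.low_refine_low β, hr]
      exact r.1.2
    refine ⟨⟨u, hs⟩, (sub_target_iff _).2 hu, Subtype.ext ?_⟩
    rw [← hr]
    exact (C.refine_low β (s := s) ⟨u, hs⟩).symm

/-- The vertices of a subtree of a subtree. -/
def refineBlock (s : C.Roots) (r : (β s).Roots) :
    (β s).Block r ≃ (C.refine β).Block (C.coarseBlock β s r).1 where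
  toFun v := ⟨v.1.1, (C.refine_low β v.1).trans (congrArg Subtype.val v.2)⟩
  invFun v := ⟨⟨v.1, by
      rw [← C.low_refine_low β, v.2]
      exact r.1.2⟩, Subtype.ext (by
      rw [← refine_low]
      exact v.2)⟩
  left_inv _ := rfl
  right_inv _ := rfl

/-- The inputs of a subtree of a subtree. -/
noncomputable def refineIn (s : C.Roots) (r : (β s).Roots) :
    (β s).quot.In r ≃ (C.refine β).quot.In (C.coarseBlock β s r).1 :=
  ((C.coarse_sub_isIso β s).inEquiv r).trans
    ((C.coarse β).inEquiv (C.coarseRoots β s) (C.coarseBlock β s r))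

theorem refine_incl (s : C.Roots) (r : (β s).Roots) (z : (β s).Block r ⊕ (β s).quot.In r) :
    (C.refine β).incl (C.coarseBlock β s r).1
      (Equiv.sumCongr (C.refineBlock β s r) (C.refineIn β s r) z) =
      C.incl s ((β s).incl r z) := by
  rcases z with z | z
  · rfl
  · exact C.coarse_incl β s z.1

/-- A subtree of a subtree is a subtree. -/
theorem refine_sub_isIso (s : C.Roots) (r : (β s).Roots) :
    ((β s).sub r).IsIso ((C.refine β).sub (C.coarseBlock β s r).1) (C.refineBlock β s r)
      (C.refineIn β s r) := by
  refine isIso_of_iff fun z v => ?_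
  rw [sub_target_iff, sub_target_iff, sub_target_iff, refine_incl]
  rfl

theorem refine_restrict (V : GrSMod.{w, u} K) (x : ∀ v, V.ext (T.In v)) (s : C.Roots)
    (r : (β s).Roots) (v : (β s).Block r) :
    (C.refine β).restrict V x (C.coarseBlock β s r).1 (C.refineBlock β s r v) =
      V.reindex ((C.refine_sub_isIso β s r).inEquiv v)
        ((β s).restrict V (C.restrict V x s) r v) := by
  unfold restrict
  rw [GrSMod.reindex_reindex, GrSMod.reindex_reindex]
  congr 1
  have h : ∀ z, (C.refine β).inEquiv (C.coarseBlock β s r).1 (C.refineBlock β s r v)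
      ((C.refine_sub_isIso β s r).inEquiv v z) = C.inEquiv s v.1 ((β s).inEquiv r v z) :=
    fun z => Subtype.ext (C.refine_incl β s r z.1)
  exact congrArg _ (symm_eq_trans _ _ _ _ h)

theorem refine_injective (C' : T.Partition) (β' : ∀ s : C'.Roots, (C'.sub s).Partition)
    (h : (⟨C.refine β, C.coarse β⟩ : Σ b : T.Partition, b.quot.Partition) =
      ⟨C'.refine β', C'.coarse β'⟩) :
    (⟨C, β⟩ : Σ C : T.Partition, ∀ s : C.Roots, (C.sub s).Partition) = ⟨C', β'⟩ := by
  obtain rfl : C = C' := by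
    refine ext_low fun v => ?_
    have := congrArg (fun p : Σ b : T.Partition, b.quot.Partition =>
      (p.2.low (p.1.root v)).1) h
    change C.low ((C.refine β).low v) = C'.low ((C'.refine β').low v) at this
    rwa [low_refine_low, low_refine_low] at this
  congr 1
  funext s
  refine ext_low fun v => Subtype.ext ?_
  have := congrArg (fun p : Σ b : T.Partition, b.quot.Partition => p.1.low v.1) h
  change (C.refine β).low v.1 = (C.refine β').low v.1 at this
  rwa [refine_low, refine_low] at this

theorem sigma_ext {b b' : T.Partition} {c : b.quot.Partition} {c' : b'.quot.Partition}
    (h : ∀ v, b.low v = b'.low v) (hc : ∀ v, (c.low (b.root v)).1 = (c'.low (b'.root v)).1) :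
    (⟨b, c⟩ : Σ b : T.Partition, b.quot.Partition) = ⟨b', c'⟩ := by
  obtain rfl := ext_low h
  congr 1
  refine ext_low fun r => Subtype.ext ?_
  have hr : b.root r.1 = r := Subtype.ext r.2
  rw [← hr]
  exact hc r.1

/-- A partition `B` and a partition of the quotient by `B` come from a partition `C` coarser than
`B` and from partitions of the subtrees of `C`. -/
theorem refine_surjective (B : T.Partition) (D : B.quot.Partition) :
    ∃ (C : T.Partition) (β : ∀ s : C.Roots, (C.sub s).Partition),
      (⟨C.refine β, C.coarse β⟩ : Σ b : T.Partition, b.quot.Partition) = ⟨B, D⟩ := by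
  have hroot : ∀ r : B.Roots, B.root r.1 = r := fun r => Subtype.ext r.2
  let C : T.Partition :=
    { low := fun v => (D.low (B.root v)).1
      cond := by
        intro v
        rcases B.cond v with hv | ⟨u, hu, h⟩
        · rcases D.cond (B.root v) with h' | ⟨r, hr, h'⟩
          · exact Or.inl (by rw [h']; exact hv)
          · obtain ⟨u, hu, hur⟩ := (quot_target_iff _).1 hr
            change T.target (Sum.inl (B.low v)) = _ at hu
            rw [hv] at hu
            refine Or.inr ⟨u, hu, ?_⟩
            rw [h']
            congr 2
            exact Subtype.ext hur.symm
        · refine Or.inr ⟨u, hu, ?_⟩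
          congr 2
          exact Subtype.ext h }
  have hC : ∀ v, C.low (B.low v) = C.low v := by
    intro v
    change (D.low (B.root (B.low v))).1 = (D.low (B.root v)).1
    exact congrArg (fun r => (D.low r).1) (hroot (B.root v))
  let β : ∀ s : C.Roots, (C.sub s).Partition := fun s =>
    { low := fun v => ⟨B.low v.1, (hC v.1).trans v.2⟩
      cond := by
        intro v
        rcases B.cond v.1 with hv | ⟨u, hu, h⟩
        · exact Or.inl (Subtype.ext hv)
        · refine Or.inr ⟨⟨u, ?_⟩, (sub_target_iff _).2 hu, Subtype.ext h⟩
          rw [← hC u, ← h, hC]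
          exact v.2 }
  refine ⟨C, β, sigma_ext (fun v => rfl) fun v => ?_⟩
  change C.low (B.low v) = (D.low (B.root v)).1
  rw [hC]

/-- Partitions `B` of a tree with a partition of the quotient by `B` correspond to partitions `C` of
the tree with a partition of each subtree of `C`. This is the coassociativity of the decomposition
of trees. -/
theorem sum_nested [Finite ι] {M : Type*} [AddCommMonoid M]
    [∀ C : T.Partition, DecidableEq C.Roots] [∀ C : T.Partition, Fintype C.Roots]
    (F : ∀ B : T.Partition, B.quot.Partition → M) :
    ∑ B, ∑ D, F B D = ∑ C : T.Partition, ∑ β : ∀ s : C.Roots, (C.sub s).Partition,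
      F (C.refine β) (C.coarse β) := by
  rw [← Fintype.sum_sigma (fun p : Σ b : T.Partition, b.quot.Partition => F p.1 p.2),
    ← Fintype.sum_sigma (fun p : Σ C : T.Partition, ∀ s : C.Roots, (C.sub s).Partition =>
      F (p.1.refine p.2) (p.1.coarse p.2))]
  symm
  refine Fintype.sum_bijective (fun p : Σ C : T.Partition, ∀ s : C.Roots, (C.sub s).Partition =>
    (⟨p.1.refine p.2, p.1.coarse p.2⟩ : Σ b : T.Partition, b.quot.Partition)) ⟨?_, ?_⟩ _ _
    fun _ => rfl
  · rintro ⟨C, β⟩ ⟨C', β'⟩ h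
    exact refine_injective C β C' β' h
  · rintro ⟨B, D⟩
    obtain ⟨C, β, h⟩ := refine_surjective B D
    exact ⟨⟨C, β⟩, h⟩

/-- Associativity of the composition along nested partitions, without signs. -/
theorem glue_nested [Fintype ι] [LinearOrder ι] [Finite L] {V : GrSMod.{w, u} K}
    {W : GrSMod.{w, u'} K} {W' : GrSMod.{w, u''} K} {V' : GrSMod.{w, u'''} K} (g : OMap W W')
    (h : ι → OMap V W) (k : ι → OMap V' V) (x : ∀ v, V'.ext (T.In v)) :
    (C.coarse β).glue g (fun r => h r.1)
        (fun r => (k r.1).map ((C.refine β).sub r) ((C.refine β).restrict V' x r)) =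
      g.map C.quot fun s => (β s).glue (h s.1) (fun v => k v.1) (C.restrict V' x s) := by
  rw [glue_apply]
  refine (g.nat _ _ _ _ (C.coarse_quot_isIso β) (fun _ _ h => h) _ _ fun s => ?_).trans
    (GrSMod.reindex_refl _)
  rw [glue_apply]
  refine (h s.1).nat _ _ _ _ (C.coarse_sub_isIso β s) (fun _ _ h => h) _ _ fun r => ?_
  change V.reindex _ ((k r.1.1).map ((C.refine β).sub (C.coarseBlock β s r).1)
    ((C.refine β).restrict V' x (C.coarseBlock β s r).1)) = _
  rw [(k r.1.1).nat _ _ _ _ (C.refine_sub_isIso β s r) (fun _ _ h => h) _ _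
    (C.refine_restrict β V' x s r)]
  unfold refineIn
  rw [GrSMod.reindex_reindex, Equiv.trans_assoc, Equiv.self_trans_symm, Equiv.trans_refl]
  rfl

end Nested

end Partition

end RTree

/-! ### Koszul signs of compositions -/

/-- The version of `Fintype.sum_equiv` in which the `Fintype` instances are found by unification. -/
theorem sum_equiv_of {α β M : Type*} [AddCommMonoid M] {_ : Fintype α} {_ : Fintype β}
    (e : α ≃ β) {f : α → M} {g : β → M} (h : ∀ a, f a = g (e a)) : ∑ a, f a = ∑ b, g b :=
  Fintype.sum_equiv e f g h

namespace RTree.Partition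

variable {ι L ι' L' : Type} [Fintype ι] [LinearOrder ι] {T : RTree ι L} (b : T.Partition)

theorem sum_blocks {M : Type*} [AddCommMonoid M] (F : ∀ r : b.Roots, b.Block r → M) :
    ∑ r, ∑ i, F r i = ∑ i, F (b.root i) ⟨i, rfl⟩ := by
  rw [← Fintype.sum_sigma (fun p : Σ r : b.Roots, b.Block r => F p.1 p.2)]
  symm
  refine Fintype.sum_bijective (fun i => (⟨b.root i, ⟨i, rfl⟩⟩ : Σ r : b.Roots, b.Block r))
    ⟨fun i j h => ?_, ?_⟩ _ _ fun _ => rfl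
  · exact congrArg (fun p : Σ r : b.Roots, b.Block r => p.2.1) h
  · rintro ⟨⟨r, hr⟩, ⟨i, hi⟩⟩
    change b.low i = r at hi
    subst hi
    exact ⟨i, rfl⟩

/-- The exponent of the sign of moving maps of parities `κ r`, one for each subtree of a partition,
past the labels of the subtrees that come before. -/
def pexp (κ p : ι → ZMod 2) : ZMod 2 :=
  ∑ i, ∑ r : b.Roots, if b.low i < r.1 then κ r.1 * p i else 0

/-- The exponent of the Koszul sign of the composition of a map on `T/T₁,…,Tₖ` with maps of
parities `κ r` on the subtrees `T₁,…,Tₖ`. -/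
def sexp (κ p : ι → ZMod 2) : ZMod 2 := kz b.low p + b.pexp κ p

/-- The parities of the outputs of maps of parities `κ r` on the subtrees. -/
def outp (κ p : ι → ZMod 2) (r : b.Roots) : ZMod 2 := ∑ i : b.Block r, p i.1 + κ r.1

/-- At most one of the parities is odd. -/
def AtMostOne {ι : Type} (κ : ι → ZMod 2) : Prop := ∀ i j, i ≠ j → κ i * κ j = 0

theorem sum_outp (G : b.Roots → ZMod 2) (κ p : ι → ZMod 2) :
    ∑ r, G r * b.outp κ p r = ∑ i, G (b.root i) * p i + ∑ r, G r * κ r.1 := by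
  rw [← b.sum_blocks fun r i => G r * p i.1]
  simp only [outp, mul_add, Finset.sum_add_distrib, Finset.mul_sum]

theorem ite_one_mul {c c' : Prop} [Decidable c] [Decidable c'] (h : c ↔ c') {x y z : ZMod 2}
    (hz : x * y = z) : (if c then 1 else 0) * x * y = if c' then z else 0 := by
  by_cases hc : c
  · rw [if_pos hc, if_pos (h.1 hc), one_mul, hz]
  · rw [if_neg hc, if_neg (fun h' => hc (h.2 h')), zero_mul, zero_mul]

/-- The Koszul sign of a permutation of the subtrees, in terms of the parities of the labels and of
the maps on the subtrees. There are no terms with two maps, since at most one is odd. -/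
theorem kz_outp {X : Type} [LinearOrder X] (φ : b.Roots → X) {κ : ι → ZMod 2}
    (hκ : AtMostOne κ) (p : ι → ZMod 2) :
    kz φ (b.outp κ p) =
      ∑ i, ∑ j, (if b.low i < b.low j ∧ φ (b.root j) < φ (b.root i) then p i * p j else 0) +
      ∑ i, ∑ r : b.Roots, ((if b.low i < r.1 ∧ φ r < φ (b.root i) then κ r.1 * p i else 0) +
        if r.1 < b.low i ∧ φ (b.root i) < φ r then κ r.1 * p i else 0) := by
  have h1 : ∀ r, (∑ s, if r < s ∧ φ s < φ r then b.outp κ p r * b.outp κ p s else 0) =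
      (∑ s, (if r < s ∧ φ s < φ r then 1 else 0) * b.outp κ p s) * b.outp κ p r := by
    intro r
    rw [Finset.sum_mul]
    refine Finset.sum_congr rfl fun s _ => ?_
    split_ifs
    · ring
    · ring
  unfold kz
  simp only [h1]
  rw [sum_outp]
  simp only [sum_outp]
  simp only [add_mul, Finset.sum_add_distrib]
  have h0 : ∑ r : b.Roots, (∑ s : b.Roots, (if r < s ∧ φ s < φ r then 1 else 0) * κ s.1) * κ r.1
      = 0 := by
    refine Finset.sum_eq_zero fun r _ => ?_
    rw [Finset.sum_mul]
    refine Finset.sum_eq_zero fun s _ => ?_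
    split_ifs with h
    · rw [one_mul]
      exact hκ _ _ fun e => h.1.ne' (Subtype.ext e)
    · ring
  rw [h0, add_zero, add_assoc]
  congr 1
  · refine Finset.sum_congr rfl fun i _ => ?_
    rw [Finset.sum_mul]
    refine Finset.sum_congr rfl fun j _ => ?_
    exact ite_one_mul Iff.rfl (mul_comm _ _)
  · congr 1
    · refine Finset.sum_congr rfl fun i _ => ?_
      rw [Finset.sum_mul]
      refine Finset.sum_congr rfl fun j _ => ?_
      exact ite_one_mul Iff.rfl rfl
    · rw [Finset.sum_comm]
      refine Finset.sum_congr rfl fun i _ => ?_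
      rw [Finset.sum_mul]
      refine Finset.sum_congr rfl fun j _ => ?_
      exact ite_one_mul Iff.rfl (mul_comm _ _)

/-- The Koszul signs of permutations inside the subtrees, as one sum over the pairs of vertices. -/
theorem sum_kz_blocks {X : b.Roots → Type} [∀ r, LinearOrder (X r)] (φ : ∀ r, b.Block r → X r)
    (c : ι → ι → Prop) [∀ i j, Decidable (c i j)] (hc : ∀ r i j, φ r i < φ r j ↔ c i.1 j.1)
    (p : ι → ZMod 2) :
    ∑ r, kz (φ r) (fun i => p i.1) =
      ∑ i, ∑ j, if b.low i = b.low j ∧ i < j ∧ c j i then p i * p j else 0 := by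
  unfold kz
  simp only [hc]
  rw [b.sum_blocks fun r i => ∑ j : b.Block r, if i < j ∧ c j.1 i.1 then p i.1 * p j.1 else 0]
  refine Finset.sum_congr rfl fun i _ => ?_
  have h := Finset.sum_subtype (Finset.univ.filter fun j => b.low j = b.low i)
    (p := fun j => b.low j = b.low i)
    (F := (inferInstance : Fintype {j // b.low j = b.low i})) (fun j => by simp)
    fun j => if i < j ∧ c j i then p i * p j else 0
  rw [Finset.sum_filter] at h
  refine h.symm.trans (Finset.sum_congr rfl fun j _ => ?_)
  by_cases hb : b.low i = b.low j
  · simp [hb]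
  · simp [hb, Ne.symm hb]

/-- The Koszul sign of a relabelling `φ` of the vertices, compared with the signs of the
relabellings of the quotient and of the subtrees: the difference is the change of the sign of the
composition. -/
theorem sexp_natural [Fintype ι'] [LinearOrder ι'] {T' : RTree ι' L'} (b' : T'.Partition)
    (φ : ι ≃ ι') (hb : ∀ v, b'.low (φ v) = φ (b.low v)) {κ p : ι → ZMod 2} {κ' p' : ι' → ZMod 2}
    (hκ : AtMostOne κ) (hκ' : ∀ v, κ' (φ v) = κ v) (hp' : ∀ v, p' (φ v) = p v) :
    b'.sexp κ' p' + kz (fun r : b.Roots => φ r.1) (b.outp κ p) +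
      ∑ r, kz (fun v : b.Block r => φ v.1) (fun v => p v.1) = kz φ p + b.sexp κ p := by
  rw [kz_outp _ _ hκ, sum_kz_blocks b _ (fun i j => φ i < φ j) (fun _ _ _ => Iff.rfl)]
  have h1 : kz b'.low p' =
      ∑ i, ∑ j, if φ i < φ j ∧ φ (b.low j) < φ (b.low i) then p i * p j else 0 := by
    unfold kz
    rw [← φ.sum_comp]
    refine Finset.sum_congr rfl fun i _ => ?_
    rw [← φ.sum_comp]
    simp only [hb, hp']
  have h2 : b'.pexp κ' p' = ∑ i, ∑ r : b.Roots, if φ (b.low i) < φ r.1 then κ r.1 * p i else 0 := by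
    unfold pexp
    rw [← φ.sum_comp]
    refine Finset.sum_congr rfl fun i _ => ?_
    rw [← (φ.subtypeEquiv (p := fun v => b.low v = v) (q := fun v => b'.low v = v)
      fun v => by rw [hb, φ.apply_eq_iff_eq]).sum_comp]
    refine Finset.sum_congr rfl fun r _ => ?_
    simp only [Equiv.subtypeEquiv_apply, hb, hκ', hp']
  unfold sexp
  rw [h1, h2]
  unfold kz pexp
  -- the signs of the exchanges of two labels, compared for each pair of vertices
  have h3 : (∑ i, ∑ j, if φ i < φ j ∧ φ (b.low j) < φ (b.low i) then p i * p j else 0) +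
      ∑ i, ∑ j, (if b.low i < b.low j ∧ φ (b.low j) < φ (b.low i) then p i * p j else 0) +
      (∑ i, ∑ j, if b.low i = b.low j ∧ i < j ∧ φ j < φ i then p i * p j else 0) =
      (∑ i, ∑ j, if i < j ∧ φ j < φ i then p i * p j else 0) +
      ∑ i, ∑ j, if i < j ∧ b.low j < b.low i then p i * p j else 0 := by
    simp only [← Finset.sum_add_distrib]
    refine sum_pairs_congr (fun i j hij => ?_) fun i => by simp
    rw [mul_comm (p j) (p i)]
    have hφ : φ i ≠ φ j := φ.injective.ne hij.ne
    rcases lt_trichotomy (b.low i) (b.low j) with h | h | h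
    · have hφ' : φ (b.low i) ≠ φ (b.low j) := φ.injective.ne h.ne
      rcases hφ.lt_or_gt with h' | h' <;> rcases hφ'.lt_or_gt with h'' | h'' <;>
        simp [hij, hij.asymm, h, h.asymm, h.ne, h.ne', h', h'.asymm, h'', h''.asymm,
          CharTwo.add_self_eq_zero]
    · rcases hφ.lt_or_gt with h' | h' <;>
        simp [hij, hij.asymm, h, h', h'.asymm, CharTwo.add_self_eq_zero]
    · have hφ' : φ (b.low i) ≠ φ (b.low j) := φ.injective.ne h.ne'
      rcases hφ.lt_or_gt with h' | h' <;> rcases hφ'.lt_or_gt with h'' | h'' <;>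
        simp [hij, hij.asymm, h, h.asymm, h.ne, h.ne', h', h'.asymm, h'', h''.asymm,
          CharTwo.add_self_eq_zero]
  -- the signs of the exchanges of a label and a map
  have h4 : (∑ i, ∑ r : b.Roots, if φ (b.low i) < φ r.1 then κ r.1 * p i else 0) +
      (∑ i, ∑ r : b.Roots, ((if b.low i < r.1 ∧ φ r.1 < φ (b.low i) then κ r.1 * p i else 0) +
        if r.1 < b.low i ∧ φ (b.low i) < φ r.1 then κ r.1 * p i else 0)) =
      ∑ i, ∑ r : b.Roots, if b.low i < r.1 then κ r.1 * p i else 0 := by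
    simp only [← Finset.sum_add_distrib]
    refine Finset.sum_congr rfl fun i _ => Finset.sum_congr rfl fun r _ => ?_
    rcases lt_trichotomy (b.low i) r.1 with h | h | h
    · have hφ' : φ (b.low i) ≠ φ r.1 := φ.injective.ne h.ne
      rcases hφ'.lt_or_gt with h'' | h'' <;>
        simp [h, h.asymm, h'', h''.asymm]
    · simp [h]
    · have hφ' : φ (b.low i) ≠ φ r.1 := φ.injective.ne h.ne'
      rcases hφ'.lt_or_gt with h'' | h'' <;>
        simp [h, h.asymm, h'', h''.asymm, CharTwo.add_self_eq_zero]
  rw [← h4]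
  have h5 : ∀ i, (b.root i).1 = b.low i := fun _ => rfl
  simp only [h5]
  linear_combination h3

section Nested

variable (C : T.Partition) (β : ∀ s : C.Roots, (C.sub s).Partition)

theorem sum_refine_roots {M : Type*} [AddCommMonoid M] (F : (C.refine β).Roots → M) :
    ∑ r, F r = ∑ s, ∑ r, F (C.coarseBlock β s r).1 := by
  rw [← (C.coarse β).sum_blocks fun _ i => F i.1]
  symm
  exact sum_equiv_of (C.coarseRoots β) fun s => sum_equiv_of (C.coarseBlock β s) fun _ => rfl

/-- The signs of the two ways of composing along nested partitions. The last sum is the sign of the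
exchange of the maps with parities `lam` and `κ`, on the subtrees of `C` and on the smaller
subtrees. -/
theorem sexp_nested {κ lam μ p : ι → ZMod 2} (hκ : AtMostOne κ)
    (hμ : ∀ s : C.Roots, μ s.1 = lam s.1 + ∑ r : (β s).Roots, κ r.1.1) :
    (C.refine β).sexp κ p + (C.coarse β).sexp (fun r => lam r.1) ((C.refine β).outp κ p) =
      C.sexp μ p + ∑ s, (β s).sexp (fun v => κ v.1) (fun v => p v.1) +
      ∑ s : C.Roots, ∑ r : (C.refine β).Roots, if C.low r.1 < s.1 then lam s.1 * κ r.1 else 0 := by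
  unfold sexp
  rw [kz_outp _ _ hκ]
  rw [Finset.sum_add_distrib, sum_kz_blocks C _ (fun i j => (C.refine β).low i < (C.refine β).low j)
    (fun s i j => by rw [refine_low, refine_low]; rfl)]
  have hr : ∀ i, ((C.coarse β).low ((C.refine β).root i)).1 = C.low i := C.low_refine_low β
  have hr' : ∀ r : (C.refine β).Roots, ((C.coarse β).low r).1 = C.low r.1 := fun _ => rfl
  simp only [← Subtype.coe_lt_coe, hr, hr']
  have h1 : (C.coarse β).pexp (fun r => lam r.1) ((C.refine β).outp κ p) =
      (∑ i, ∑ s : C.Roots, if C.low i < s.1 then lam s.1 * p i else 0) +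
      ∑ s : C.Roots, ∑ r : (C.refine β).Roots, if C.low r.1 < s.1 then lam s.1 * κ r.1 else 0 := by
    have h := (C.refine β).sum_outp
      (fun r => ∑ s : C.Roots, if C.low r.1 < s.1 then lam s.1 else 0) κ p
    have e1 : ∀ (c : Prop) [Decidable c] (x y : ZMod 2),
        (if c then x * y else 0) = (if c then x else 0) * y := by
      intro c _ x y
      split_ifs <;> ring
    unfold pexp
    simp only [e1] at h ⊢
    simp only [← Finset.sum_mul] at h ⊢
    rw [Finset.sum_comm (s := (Finset.univ : Finset C.Roots))]
    simp only [← Finset.sum_mul]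
    convert h using 4 with r hr0 i hi
    · exact (sum_equiv_of (C.coarseRoots β) fun _ => rfl).symm
    · exact Finset.sum_congr rfl fun s _ => by
        change _ = if C.low ((C.refine β).low i) < s.1 then _ else _
        rw [low_refine_low]
  have h2 : C.pexp μ p = (∑ i, ∑ s : C.Roots, if C.low i < s.1 then lam s.1 * p i else 0) +
      ∑ i, ∑ r : (C.refine β).Roots, if C.low i < C.low r.1 then κ r.1 * p i else 0 := by
    unfold pexp
    rw [← Finset.sum_add_distrib]
    refine Finset.sum_congr rfl fun i _ => ?_
    rw [sum_refine_roots, ← Finset.sum_add_distrib]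
    refine Finset.sum_congr rfl fun s _ => ?_
    have : ∀ r : (β s).Roots, C.low (C.coarseBlock β s r).1.1 = s.1 := fun r => r.1.2
    simp only [this, hμ]
    split_ifs
    · rw [add_mul, Finset.sum_mul]
      rfl
    · simp
  have h3 : ∑ s, (β s).pexp (fun v => κ v.1) (fun v => p v.1) = ∑ i, ∑ r : (C.refine β).Roots,
      if C.low i = C.low r.1 ∧ (C.refine β).low i < r.1 then κ r.1 * p i else 0 := by
    unfold pexp
    refine (C.sum_blocks fun s i => ∑ r : (β s).Roots,
      if (β s).low i < r.1 then κ r.1.1 * p i.1 else 0).trans ?_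
    refine Finset.sum_congr rfl fun i _ => ?_
    rw [sum_refine_roots, Finset.sum_eq_single (C.root i)]
    · refine Finset.sum_congr rfl fun r _ => ?_
      have : C.low (C.coarseBlock β (C.root i) r).1.1 = C.low i := r.1.2
      simp only [this, true_and]
      rfl
    · intro s _ hs
      refine Finset.sum_eq_zero fun r _ => if_neg fun h => hs (Subtype.ext ?_)
      exact r.1.2.symm.trans h.1.symm
    · simp
  rw [h1, h2, h3]
  have h4 : (∑ i, ∑ j, if i < j ∧ (C.refine β).low j < (C.refine β).low i then p i * p j else 0) +
      (∑ i, ∑ j, if (C.refine β).low i < (C.refine β).low j ∧ C.low j < C.low i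
        then p i * p j else 0) =
      (∑ i, ∑ j, if i < j ∧ C.low j < C.low i then p i * p j else 0) +
      ∑ i, ∑ j, if C.low i = C.low j ∧ i < j ∧ (C.refine β).low j < (C.refine β).low i
        then p i * p j else 0 := by
    simp only [← Finset.sum_add_distrib]
    refine sum_pairs_congr (fun i j hij => ?_) fun i => by simp
    rw [mul_comm (p j) (p i)]
    have hB : C.low i ≠ C.low j → (C.refine β).low i ≠ (C.refine β).low j := by
      intro h h'
      apply h
      rw [← C.low_refine_low β, h', C.low_refine_low β]
    rcases lt_trichotomy (C.low i) (C.low j) with h | h | h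
    · rcases (hB h.ne).lt_or_gt with h' | h' <;>
        simp [hij, hij.asymm, h, h.asymm, h.ne, h.ne', h', h'.asymm, CharTwo.add_self_eq_zero]
    · simp [hij, hij.asymm, h]
    · rcases (hB h.ne').lt_or_gt with h' | h' <;>
        simp [hij, hij.asymm, h, h.asymm, h.ne, h.ne', h', h'.asymm, CharTwo.add_self_eq_zero]
  have h5 : (C.refine β).pexp κ p + (∑ i, ∑ r : (C.refine β).Roots,
      ((if (C.refine β).low i < r.1 ∧ C.low r.1 < C.low i then κ r.1 * p i else 0) +
        if r.1 < (C.refine β).low i ∧ C.low i < C.low r.1 then κ r.1 * p i else 0)) =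
      (∑ i, ∑ r : (C.refine β).Roots, if C.low i < C.low r.1 then κ r.1 * p i else 0) +
      ∑ i, ∑ r : (C.refine β).Roots,
      if C.low i = C.low r.1 ∧ (C.refine β).low i < r.1 then κ r.1 * p i else 0 := by
    unfold pexp
    simp only [← Finset.sum_add_distrib]
    refine Finset.sum_congr rfl fun i _ => Finset.sum_congr rfl fun r _ => ?_
    have hB : C.low i ≠ C.low r.1 → (C.refine β).low i ≠ r.1 := by
      intro h h'
      apply h
      rw [← h', C.low_refine_low β]
    rcases lt_trichotomy (C.low i) (C.low r.1) with h | h | h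
    · rcases (hB h.ne).lt_or_gt with h' | h' <;>
        simp [h, h.asymm, h.ne, h', h'.asymm]
    · simp [h]
    · rcases (hB h.ne').lt_or_gt with h' | h' <;>
        simp [h, h.asymm, h.ne', h', h'.asymm, CharTwo.add_self_eq_zero]
  unfold kz
  linear_combination h4 + h5

end Nested

end RTree.Partition

/-! ### Maps defined on homogeneous labels -/

namespace GrSMod

/-- The projection of a graded `𝕊`-module onto its part of parity `q`. -/
noncomputable def parProj (V : GrSMod.{w, u} K) (q : ZMod 2) : EquivMap V V 0 :=
  V.scal fun k => if (k : ZMod 2) = q then 1 else 0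

end GrSMod

/-- The family of multilinear maps `f` is homogeneous of degree `k`, and natural with Koszul signs
for all the isomorphisms of trees. -/
structure OMap.IsGr {V : GrSMod.{w, u} K} {W : GrSMod.{w, u'} K} (f : OMap V W) (k : ℤ) : Prop where
  mem : ∀ {ι L : Type} [Fintype ι] [LinearOrder ι] [Finite L] (T : RTree ι L)
    (x : ∀ v : ι, V.ext (T.In v)) (e : ι → ℤ), (∀ v, x v ∈ V.extGr _ (e v)) →
      f.map T x ∈ W.extGr L ((∑ v, e v) + k)
  natural : ∀ {ι L ι' L' : Type} [Fintype ι] [LinearOrder ι] [Finite L]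
    [Fintype ι'] [LinearOrder ι'] [Finite L'] (T : RTree ι L) (T' : RTree ι' L')
    (φ : ι ≃ ι') (ψ : L ≃ L') (h : T.IsIso T' φ ψ) (e : ι → ℤ)
    (x : ∀ v : ι, V.ext (T.In v)) (x' : ∀ v : ι', V.ext (T'.In v)),
    (∀ v, x v ∈ V.extGr _ (e v)) → (∀ v, x' (φ v) = V.reindex (h.inEquiv v) (x v)) →
      f.map T' x' = sgn K (kz φ (par e)) • W.reindex ψ (f.map T x)

theorem TreeMap.isGr {V : GrSMod.{w, u} K} {W : GrSMod.{w, u'} K} {k : ℤ} (f : TreeMap V W k) :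
    f.toOMap.IsGr k where
  mem := f.map_mem
  natural T T' φ ψ h e x x' hx hx' := by
    have := f.natural T T' φ ψ h e x x' hx hx'
    rwa [koszul_smul (K := K)] at this

theorem TreeMap.ext_homogeneous {V : GrSMod.{w, u} K} {W : GrSMod.{w, u'} K} {k k' : ℤ}
    {f : TreeMap V W k} {g : TreeMap V W k'} {ι L : Type} [Fintype ι] [LinearOrder ι] [Finite L]
    {T : RTree ι L} (h : ∀ (e : ι → ℤ) (x : ∀ v, V.ext (T.In v)), (∀ v, x v ∈ V.extGr _ (e v)) →
      f.map T x = g.map T x) : f.map T = g.map T :=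
  multilinear_ext_homogeneous h

/-- On homogeneous labels, the sum over all the parities has only one nonzero term. -/
theorem sum_parity {V : GrSMod.{w, u} K} {N : Type*} [AddCommGroup N] [Module K N]
    {ι : Type} [Fintype ι] [DecidableEq ι] {X : ι → Type}
    (R : (ι → ZMod 2) → MultilinearMap K (fun v => V.ext (X v)) N) {e : ι → ℤ}
    {x : ∀ v, V.ext (X v)} (hx : ∀ v, x v ∈ V.extGr _ (e v)) :
    (∑ p, (R p).compLinearMap fun v => (V.parProj (p v)).ext _) x = R (par e) x := by
  have h1 : ∀ (p : ι → ZMod 2) v,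
      (V.parProj (p v)).ext _ (x v) = (if par e v = p v then (1 : K) else 0) • x v :=
    fun p v => V.scal_ext (hx v)
  rw [_root_.sum_apply, Finset.sum_eq_single (par e)]
  · rw [MultilinearMap.compLinearMap_apply]
    congr 1
    funext v
    rw [h1, if_pos rfl, one_smul]
  · intro p _ hp
    obtain ⟨v, hv⟩ := Function.ne_iff.1 hp.symm
    rw [MultilinearMap.compLinearMap_apply]
    refine MultilinearMap.map_coord_zero _ v ?_
    rw [h1, if_neg hv, zero_smul]
  · intro h
    exact (h (Finset.mem_univ _)).elim

/-- The map out of the tree module given by a family of multilinear maps which depends on the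
parities of the labels. On arbitrary labels, it is the sum over all the ways of
projecting the labels onto their parts of even and of odd degree. -/
noncomputable def TreeMap.ofParity {V : GrSMod.{w, u} K} {W : GrSMod.{w, u'} K} {k : ℤ}
    (R : ∀ {ι L : Type} [Fintype ι] [LinearOrder ι] [Finite L] (T : RTree ι L) (_ : ι → ZMod 2),
      MultilinearMap K (fun v : ι => V.ext (T.In v)) (W.ext L))
    (mem : ∀ {ι L : Type} [Fintype ι] [LinearOrder ι] [Finite L] (T : RTree ι L)
      (x : ∀ v : ι, V.ext (T.In v)) (e : ι → ℤ), (∀ v, x v ∈ V.extGr _ (e v)) →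
      R T (par e) x ∈ W.extGr L ((∑ v, e v) + k))
    (natural : ∀ {ι L ι' L' : Type} [Fintype ι] [LinearOrder ι] [Finite L]
      [Fintype ι'] [LinearOrder ι'] [Finite L'] (T : RTree ι L) (T' : RTree ι' L')
      (φ : ι ≃ ι') (ψ : L ≃ L') (h : T.IsIso T' φ ψ) (e : ι → ℤ) (e' : ι' → ℤ)
      (x : ∀ v : ι, V.ext (T.In v)) (x' : ∀ v : ι', V.ext (T'.In v)),
      (∀ v, x v ∈ V.extGr _ (e v)) → (∀ v, x' (φ v) = V.reindex (h.inEquiv v) (x v)) →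
      (∀ v, e' (φ v) = e v) →
      R T' (par e') x' = sgn K (kz φ (par e)) • W.reindex ψ (R T (par e) x))
    (map_trivial : ∀ {ι L : Type} [Fintype ι] [LinearOrder ι] [Finite L] [IsEmpty ι]
      (T : RTree ι L) (p : ι → ZMod 2), R T p = 0) : TreeMap V W k :=
  { map := fun T => ∑ p, (R T p).compLinearMap fun v => (V.parProj (p v)).ext _
    map_mem := fun T x e hx => by
      rw [sum_parity (R T) hx]
      exact mem T x e hx
    natural := fun T T' φ ψ h e x x' hx hx' => by
      have hx'' : ∀ v, x' v ∈ V.extGr _ (e (φ.symm v)) := by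
        intro v
        obtain ⟨v, rfl⟩ := φ.surjective v
        rw [hx', φ.symm_apply_apply]
        exact GrSMod.reindex_mem _ (hx v)
      rw [sum_parity (R T) hx, sum_parity (R T') hx'', koszul_smul (K := K)]
      exact natural T T' φ ψ h e _ x x' hx hx' fun v => by rw [φ.symm_apply_apply]
    map_trivial := fun T => by
      refine Finset.sum_eq_zero fun p _ => ?_
      rw [map_trivial]
      rfl }

theorem TreeMap.ofParity_apply {V : GrSMod.{w, u} K} {W : GrSMod.{w, u'} K} {k : ℤ}
    (R : ∀ {ι L : Type} [Fintype ι] [LinearOrder ι] [Finite L] (T : RTree ι L) (_ : ι → ZMod 2),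
      MultilinearMap K (fun v : ι => V.ext (T.In v)) (W.ext L)) (mem natural map_trivial)
    {ι L : Type} [Fintype ι] [LinearOrder ι] [Finite L] (T : RTree ι L)
    {e : ι → ℤ} {x : ∀ v : ι, V.ext (T.In v)} (hx : ∀ v, x v ∈ V.extGr _ (e v)) :
    (TreeMap.ofParity (k := k) R mem natural map_trivial).map T x = R T (par e) x := by
  exact sum_parity (R T) hx

theorem trans_symm_eq {A B X D : Type} (f : D ≃ X) (a : B ≃ X) (b : A ≃ B) (c : A ≃ D)
    (h : ∀ z, f (c z) = a (b z)) : a.trans f.symm = b.symm.trans c := by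
  ext1 y
  rw [Equiv.trans_apply, Equiv.trans_apply, Equiv.symm_apply_eq, h, Equiv.apply_symm_apply]

/-! ### Transport of partitions along isomorphisms -/

namespace RTree

variable {ι L ι' L' : Type} {T : RTree ι L} {T' : RTree ι' L'} {φ : ι ≃ ι'} {ψ : L ≃ L'}

theorem IsIso.symm (h : T.IsIso T' φ ψ) : T'.IsIso T φ.symm ψ.symm := by
  refine isIso_of_iff fun z v => ?_
  rw [← h.target_iff]
  have : Equiv.sumCongr φ ψ (Equiv.sumCongr φ.symm ψ.symm z) = z := by
    rcases z with z | z <;> simp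
  rw [this, φ.apply_symm_apply]

namespace Partition

/-- The partition corresponding to `b` under an isomorphism of trees. -/
def mapIso (b : T.Partition) (h : T.IsIso T' φ ψ) : T'.Partition where
  low v := φ (b.low (φ.symm v))
  cond v := by
    obtain ⟨v, rfl⟩ := φ.surjective v
    rw [φ.symm_apply_apply]
    rcases b.cond v with hv | ⟨u, hu, huv⟩
    · exact Or.inl (congrArg φ hv)
    · refine Or.inr ⟨φ u, (h.target_iff (Sum.inl v) u).2 hu, ?_⟩
      rw [φ.symm_apply_apply, huv]

theorem mapIso_low (b : T.Partition) (h : T.IsIso T' φ ψ) (v : ι) :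
    (b.mapIso h).low (φ v) = φ (b.low v) :=
  congrArg (fun w => φ (b.low w)) (φ.symm_apply_apply v)

theorem mapIso_bijective (h : T.IsIso T' φ ψ) :
    Function.Bijective fun b : T.Partition => b.mapIso h := by
  constructor
  · intro b b' hb
    refine ext_low fun v => φ.injective ?_
    rw [← mapIso_low b h, ← mapIso_low b' h]
    exact congrArg (fun b : T'.Partition => b.low (φ v)) hb
  · intro b
    refine ⟨b.mapIso h.symm, ext_low fun v => ?_⟩
    change φ (φ.symm (b.low (φ (φ.symm v)))) = _
    simp

variable (b : T.Partition) (h : T.IsIso T' φ ψ)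

/-- Corresponding subtrees. -/
def mapRoots : b.Roots ≃ (b.mapIso h).Roots :=
  φ.subtypeEquiv fun v => by rw [mapIso_low, φ.apply_eq_iff_eq]

/-- Corresponding vertices of a subtree. -/
def mapBlock (r : b.Roots) : b.Block r ≃ (b.mapIso h).Block (b.mapRoots h r) :=
  φ.subtypeEquiv fun v => by
    rw [mapIso_low]
    exact φ.apply_eq_iff_eq.symm

theorem mapIso_quot_isIso : b.quot.IsIso (b.mapIso h).quot (b.mapRoots h) ψ := by
  refine isIso_of_iff fun z r => ?_
  rw [quot_target_iff, quot_target_iff]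
  have hz : Sum.map Subtype.val id (Equiv.sumCongr (b.mapRoots h) ψ z) =
      Equiv.sumCongr φ ψ (Sum.map Subtype.val id z) := by
    rcases z with z | z <;> rfl
  rw [hz]
  constructor
  · rintro ⟨u, hu, hr⟩
    refine ⟨φ u, (h.target_iff _ _).2 hu, ?_⟩
    rw [mapIso_low, hr]
    rfl
  · rintro ⟨u, hu, hr⟩
    obtain ⟨u, rfl⟩ := φ.surjective u
    refine ⟨u, (h.target_iff _ _).1 hu, φ.injective ?_⟩
    rw [mapIso_low] at hr
    exact hr

theorem mapIso_incl (r : b.Roots) (z : b.Block r ⊕ b.quot.In r) :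
    (b.mapIso h).incl (b.mapRoots h r)
      (Equiv.sumCongr (b.mapBlock h r) ((b.mapIso_quot_isIso h).inEquiv r) z) =
      Equiv.sumCongr φ ψ (b.incl r z) := by
  rcases z with z | ⟨z | z, hz⟩ <;> rfl

theorem mapIso_sub_isIso (r : b.Roots) :
    (b.sub r).IsIso ((b.mapIso h).sub (b.mapRoots h r)) (b.mapBlock h r)
      ((b.mapIso_quot_isIso h).inEquiv r) := by
  refine isIso_of_iff fun z v => ?_
  rw [sub_target_iff, sub_target_iff, mapIso_incl]
  exact (h.target_iff _ _).symm

theorem mapIso_restrict (V : GrSMod.{w, u} K) {x : ∀ v, V.ext (T.In v)}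
    {x' : ∀ v, V.ext (T'.In v)} (hx' : ∀ v, x' (φ v) = V.reindex (h.inEquiv v) (x v))
    (r : b.Roots) (v : b.Block r) :
    (b.mapIso h).restrict V x' (b.mapRoots h r) (b.mapBlock h r v) =
      V.reindex ((b.mapIso_sub_isIso h r).inEquiv v) (b.restrict V x r v) := by
  have e1 : x' (b.mapBlock h r v).1 = V.reindex (h.inEquiv v.1) (x v.1) := hx' v.1
  have h1 : ∀ z, (b.mapIso h).inEquiv (b.mapRoots h r) (b.mapBlock h r v)
      ((b.mapIso_sub_isIso h r).inEquiv v z) = h.inEquiv v.1 (b.inEquiv r v z) :=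
    fun z => Subtype.ext (b.mapIso_incl h r z.1)
  have h2 : (h.inEquiv v.1).trans
      ((b.mapIso h).inEquiv (b.mapRoots h r) (b.mapBlock h r v)).symm =
      (b.inEquiv r v).symm.trans ((b.mapIso_sub_isIso h r).inEquiv v) :=
    trans_symm_eq _ _ _ _ h1
  exact (congrArg (V.reindex _) e1).trans (congrArg (fun g => V.reindex g (x v.1)) h2)

section Glue

variable [Fintype ι] [LinearOrder ι] [Finite L] [Fintype ι'] [LinearOrder ι'] [Finite L']
  {V : GrSMod.{w, u} K} {W : GrSMod.{w, u'} K} {W' : GrSMod.{w, u''} K}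

theorem restrict_mem {x : ∀ v, V.ext (T.In v)} {e : ι → ℤ} (hx : ∀ v, x v ∈ V.extGr _ (e v))
    (r : b.Roots) (v : b.Block r) : b.restrict V x r v ∈ V.extGr _ (e v.1) :=
  GrSMod.reindex_mem _ (hx v.1)

theorem glue_label_mem {h : ι → OMap V W} {d : ι → ℤ} (hh : ∀ v, (h v).IsGr (d v))
    {x : ∀ v, V.ext (T.In v)} {e : ι → ℤ} (hx : ∀ v, x v ∈ V.extGr _ (e v)) (r : b.Roots) :
    (h r.1).map (b.sub r) (b.restrict V x r) ∈ W.extGr _ ((∑ v : b.Block r, e v.1) + d r.1) :=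
  (hh r.1).mem _ _ _ (b.restrict_mem hx r)

theorem par_outp (e d : ι → ℤ) :
    par (fun r : b.Roots => (∑ v : b.Block r, e v.1) + d r.1) = b.outp (par d) (par e) := by
  funext r
  simp [par, outp]

theorem glue_mem {g : OMap W W'} {k : ℤ} (hg : g.IsGr k) {h : ι → OMap V W} {d : ι → ℤ}
    (hh : ∀ v, (h v).IsGr (d v)) {x : ∀ v, V.ext (T.In v)} {e : ι → ℤ}
    (hx : ∀ v, x v ∈ V.extGr _ (e v)) :
    b.glue g h x ∈ W'.extGr L ((∑ v, e v) + (∑ r : b.Roots, d r.1) + k) := by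
  have := hg.mem b.quot _ _ (b.glue_label_mem hh hx)
  rwa [Finset.sum_add_distrib, b.sum_blocks fun _ v => e v.1] at this

/-- The composition along a partition, with its Koszul sign, is natural. -/
theorem glue_natural {g : OMap W W'} {k : ℤ} (hg : g.IsGr k) {f : ι → OMap V W}
    {f' : ι' → OMap V W} (hf : ∀ v, f' (φ v) = f v) {d : ι → ℤ}
    (hd : ∀ v, (f v).IsGr (d v)) (hd1 : AtMostOne (par d)) {d' : ι' → ℤ}
    (hd' : ∀ v, d' (φ v) = d v) {x : ∀ v, V.ext (T.In v)}
    {x' : ∀ v, V.ext (T'.In v)} {e : ι → ℤ} {e' : ι' → ℤ} (hx : ∀ v, x v ∈ V.extGr _ (e v))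
    (hx' : ∀ v, x' (φ v) = V.reindex (h.inEquiv v) (x v)) (he : ∀ v, e' (φ v) = e v) :
    sgn K ((b.mapIso h).sexp (par d') (par e')) • (b.mapIso h).glue g f' x' =
      sgn K (kz φ (par e)) • W'.reindex ψ (sgn K (b.sexp (par d) (par e)) • b.glue g f x) := by
  have h1 : ∀ r : b.Roots, (f' (b.mapRoots h r).1).map ((b.mapIso h).sub (b.mapRoots h r))
      ((b.mapIso h).restrict V x' (b.mapRoots h r)) =
      W.reindex ((b.mapIso_quot_isIso h).inEquiv r)
        (sgn K (kz (b.mapBlock h r) (par fun v => e v.1)) •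
          (f r.1).map (b.sub r) (b.restrict V x r)) := by
    intro r
    rw [map_smul, show f' (b.mapRoots h r).1 = f r.1 from hf r.1]
    exact (hd r.1).natural _ _ _ _ (b.mapIso_sub_isIso h r) _ _ _ (b.restrict_mem hx r)
      (b.mapIso_restrict h V hx' r)
  have h2 := hg.natural _ _ _ _ (b.mapIso_quot_isIso h) _ _
    (fun r => (f' r.1).map ((b.mapIso h).sub r) ((b.mapIso h).restrict V x' r))
    (fun r => Submodule.smul_mem _ (sgn K (kz (b.mapBlock h r) (par fun v => e v.1)))
      (b.glue_label_mem hd hx r)) h1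
  rw [par_outp, MultilinearMap.map_smul_univ, ← sgn_sum] at h2
  rw [glue_apply]
  refine (congrArg _ h2).trans ?_
  rw [map_smul, map_smul, smul_smul, smul_smul, smul_smul, ← sgn_add, ← sgn_add, ← sgn_add]
  congr 2
  have h3 := b.sexp_natural (b.mapIso h) φ (b.mapIso_low h) (p := par e) (κ' := par d')
    (p' := par e') hd1
    (fun v => congrArg (Int.cast : ℤ → ZMod 2) (hd' v))
    (fun v => congrArg (Int.cast : ℤ → ZMod 2) (he v))
  rw [← h3]
  rfl

end Glue

end Partition

end RTree

namespace RTree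

variable {ι L ι' L' : Type}

/-! ### Maps supported on the trees with one vertex -/

theorem target_leaf_of_unique {T : RTree ι L} {v : ι} (hv : ∀ w, w = v) (l : L) :
    T.target (Sum.inr l) = some v := by
  have h0 : T.target (Sum.inl v) = none := by
    rw [Option.eq_none_iff_forall_ne_some]
    intro w hw
    rw [hv w] at hw
    exact T.target_ne v hw
  rcases h : T.target (Sum.inr l) with _ | w
  · exact (Sum.inl_ne_inr (T.root.unique h0 h)).elim
  · rw [hv w]

/-- The map `T.transfer V v` is given by any bijection as in its definition, provided that at most
one input of `v` is not a leaf. -/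
theorem transfer_eq {T : RTree ι L} (V : GrSMod.{w, u} K) {v : ι}
    (hu : ∀ z z' : T.In v, z.1.isLeft → z'.1.isLeft → z = z') (g : T.In v ≃ L)
    (hg : ∀ z l, z.1 = Sum.inr l → g z = l) : T.transfer V v = V.reindex g := by
  unfold transfer
  have h : ∃ g : T.In v ≃ L, ∀ z l, z.1 = Sum.inr l → g z = l := ⟨g, hg⟩
  rw [dif_pos h]
  congr 1
  have hc := h.choose_spec
  set g' := h.choose with hg'
  have key : ∀ z : T.In v, z.1.isRight → g' z = g z := by
    rintro ⟨z | l, hz⟩ h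
    · simp at h
    · rw [hc _ l rfl, hg _ l rfl]
  ext1 z
  by_cases hz : z.1.isRight
  · exact key z hz
  · obtain ⟨z', hz'⟩ := g.surjective (g' z)
    by_cases hzz : z'.1.isRight
    · rw [← key z' hzz] at hz'
      rw [← g'.injective hz', key z' hzz]
    · rw [← hz', hu z' z (by simpa using hzz) (by simpa using hz)]

theorem transfer_natural {T : RTree ι L} {T' : RTree ι' L'} {φ : ι ≃ ι'} {ψ : L ≃ L'}
    (h : T.IsIso T' φ ψ) (V : GrSMod.{w, u} K) {v : ι}
    (hu : ∀ z z' : T.In v, z.1.isLeft → z'.1.isLeft → z = z') (y : V.ext (T.In v)) :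
    T'.transfer V (φ v) (V.reindex (h.inEquiv v) y) = V.reindex ψ (T.transfer V v y) := by
  have hval : ∀ z : T.In v, (h.inEquiv v z).1 = Equiv.sumCongr φ ψ z.1 := fun _ => rfl
  have hu' : ∀ z z' : T'.In (φ v), z.1.isLeft → z'.1.isLeft → z = z' := by
    intro z z' hz hz'
    obtain ⟨z, rfl⟩ := (h.inEquiv v).surjective z
    obtain ⟨z', rfl⟩ := (h.inEquiv v).surjective z'
    rw [hval] at hz hz'
    rw [hu z z']
    · revert hz
      rcases z.1 with a | a <;> simp
    · revert hz'
      rcases z'.1 with a | a <;> simp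
  by_cases hg : ∃ g : T.In v ≃ L, ∀ z l, z.1 = Sum.inr l → g z = l
  · obtain ⟨g, hg⟩ := hg
    rw [transfer_eq V hu g hg, transfer_eq V hu' ((h.inEquiv v).symm.trans (g.trans ψ)) _,
      GrSMod.reindex_reindex, GrSMod.reindex_reindex]
    · rw [← Equiv.trans_assoc, Equiv.self_trans_symm, Equiv.refl_trans]
    · intro z l' hz
      obtain ⟨z, rfl⟩ := (h.inEquiv v).surjective z
      rw [hval] at hz
      rw [Equiv.trans_apply, Equiv.symm_apply_apply, Equiv.trans_apply]
      rcases hz1 : z.1 with a | a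
      · rw [hz1] at hz
        simp at hz
      · rw [hz1] at hz
        rw [hg z a hz1]
        simpa using hz
  · have hg' : ¬ ∃ g : T'.In (φ v) ≃ L', ∀ z l, z.1 = Sum.inr l → g z = l := by
      rintro ⟨g, hg'⟩
      refine hg ⟨(h.inEquiv v).trans (g.trans ψ.symm), fun z l hz => ?_⟩
      rw [Equiv.trans_apply, Equiv.trans_apply, Equiv.symm_apply_eq]
      refine hg' _ _ ?_
      rw [hval, hz]
      rfl
    unfold transfer
    rw [dif_neg hg, dif_neg hg']
    simp

theorem transfer_mem (T : RTree ι L) (V : GrSMod.{w, u} K) (v : ι) {k : ℤ} {x : V.ext (T.In v)}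
    (hx : x ∈ V.extGr _ k) : T.transfer V v x ∈ V.extGr L k := by
  unfold transfer
  split_ifs
  · exact GrSMod.reindex_mem _ hx
  · exact Submodule.zero_mem _

theorem transfer_ext (T : RTree ι L) {V : GrSMod.{w, u} K} {W : GrSMod.{w, u'} K} {k : ℤ}
    (f : EquivMap V W k) (v : ι) (x : V.ext (T.In v)) :
    T.transfer W v (f.ext _ x) = f.ext _ (T.transfer V v x) := by
  unfold transfer
  split_ifs
  · rfl
  · simp

theorem no_left_input {T : RTree ι L} {v : ι} (hv : ∀ w, w = v) (z z' : T.In v)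
    (hz : z.1.isLeft) (_ : z'.1.isLeft) : z = z' := by
  obtain ⟨z | z, hz1⟩ := z
  · rw [hv z] at hz1
    exact (T.target_ne v hz1).elim
  · simp at hz

end RTree

/-- The map out of the tree module that is `φ` on the generators and that vanishes on the trees
that do not have exactly one vertex. -/
noncomputable def TreeMap.ofEquiv {V : GrSMod.{w, u} K} {W : GrSMod.{w, u'} K} {k : ℤ}
    (φ : EquivMap V W k) : TreeMap V W k where
  map {ι L} _ _ _ T :=
    { toFun := fun x => if Fintype.card ι = 1 then ∑ v, T.transfer W v (φ.ext _ (x v)) else 0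
      map_update_add' := by
        intro inst x a y z
        split_ifs with h
        · obtain ⟨v, hv⟩ := Fintype.card_eq_one_iff.1 h
          obtain rfl := hv a
          have : (Finset.univ : Finset ι) = {a} := by
            ext i
            simp [hv i]
          simp [this]
        · simp
      map_update_smul' := by
        intro inst x a c y
        split_ifs with h
        · obtain ⟨v, hv⟩ := Fintype.card_eq_one_iff.1 h
          obtain rfl := hv a
          have : (Finset.univ : Finset ι) = {a} := by
            ext i
            simp [hv i]
          simp [this]
        · simp }
  map_mem {ι L} _ _ _ T x e hx := by
    change (if Fintype.card ι = 1 then ∑ v, T.transfer W v (φ.ext _ (x v)) else 0) ∈ _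
    split_ifs with h
    · obtain ⟨a, hv⟩ := Fintype.card_eq_one_iff.1 h
      have : (Finset.univ : Finset ι) = {a} := by
        ext i
        simp [hv i]
      rw [this, Finset.sum_singleton, Finset.sum_singleton]
      exact T.transfer_mem W a (φ.ext_mem (hx a))
    · exact Submodule.zero_mem _
  natural {ι L ι' L'} _ _ _ _ _ _ T T' φ' ψ h e x x' hx hx' := by
    change (if Fintype.card ι' = 1 then ∑ v, T'.transfer W v (φ.ext _ (x' v)) else 0) =
      koszul φ' e • W.reindex ψ
        (if Fintype.card ι = 1 then ∑ v, T.transfer W v (φ.ext _ (x v)) else 0)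
    rw [← Fintype.card_congr φ']
    split_ifs with hc
    · obtain ⟨a, hv⟩ := Fintype.card_eq_one_iff.1 hc
      have h1 : (Finset.univ : Finset ι) = {a} := by
        ext i
        simp [hv i]
      rw [← φ'.sum_comp, h1, Finset.sum_singleton, Finset.sum_singleton, hx', EquivMap.ext_reindex,
        RTree.transfer_natural h W (RTree.no_left_input hv), koszul_smul (K := K),
        kz_of_strictMono, sgn_zero, one_smul]
      intro i j hij
      rw [hv i, hv j] at hij
      exact hij.false.elim
    · simp
  map_trivial {ι L} _ _ _ _ T := by
    ext1 x
    change (if Fintype.card ι = 1 then ∑ v, T.transfer W v (φ.ext _ (x v)) else 0) = 0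
    simp

theorem TreeMap.ofEquiv_apply {V : GrSMod.{w, u} K} {W : GrSMod.{w, u'} K} {k : ℤ}
    (φ : EquivMap V W k) {ι L : Type} [Fintype ι] [LinearOrder ι] [Finite L] (T : RTree ι L)
    (x : ∀ v, V.ext (T.In v)) : (TreeMap.ofEquiv φ).map T x =
      if Fintype.card ι = 1 then ∑ v, T.transfer W v (φ.ext _ (x v)) else 0 := rfl

theorem TreeMap.ofEquiv_of_unique {V : GrSMod.{w, u} K} {W : GrSMod.{w, u'} K} {k : ℤ}
    (φ : EquivMap V W k) {ι L : Type} [Fintype ι] [LinearOrder ι] [Finite L] (T : RTree ι L)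
    (x : ∀ v, V.ext (T.In v)) {v : ι} (hv : ∀ w, w = v) : (TreeMap.ofEquiv φ).map T x =
      T.transfer W v (φ.ext _ (x v)) := by
  have h1 : (Finset.univ : Finset ι) = {v} := by
    ext i
    simp [hv i]
  rw [ofEquiv_apply, if_pos (Fintype.card_eq_one_iff.2 ⟨v, hv⟩), h1, Finset.sum_singleton]

theorem TreeMap.ofEquiv_of_card_ne {V : GrSMod.{w, u} K} {W : GrSMod.{w, u'} K} {k : ℤ}
    (φ : EquivMap V W k) {ι L : Type} [Fintype ι] [LinearOrder ι] [Finite L] (T : RTree ι L)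
    (h : Fintype.card ι ≠ 1) : (TreeMap.ofEquiv φ).map T = 0 := by
  ext1 x
  rw [ofEquiv_apply, if_neg h]
  rfl

theorem TreeMap.proj_eq {V : GrSMod.{w, u} K} {ι L : Type} [Fintype ι] [LinearOrder ι] [Finite L]
    (T : RTree ι L) (x : ∀ v, V.ext (T.In v)) :
    T.proj V x = (TreeMap.ofEquiv (EquivMap.id V)).map T x := rfl

/-! ### Compositions of maps out of tree modules -/

section Raw

variable {V : GrSMod.{w, u} K} {W : GrSMod.{w, u'} K} {W' : GrSMod.{w, u''} K}
  {ι L ι' L' : Type} [Fintype ι] [LinearOrder ι] [Finite L]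
  [Fintype ι'] [LinearOrder ι'] [Finite L']

theorem atMostOne_single (r : ι) (l : ℤ) : RTree.Partition.AtMostOne (par (Pi.single r l)) := by
  intro i j hij
  by_cases hi : i = r
  · have hj : j ≠ r := fun hj => hij (hi.trans hj.symm)
    simp [par, hj]
  · simp [par, hi]

theorem atMostOne_zero : RTree.Partition.AtMostOne (par (fun _ : ι => (0 : ℤ))) := by
  intro i j _
  simp [par]

/-- The composite of `g` with the maps `f`, one of which is replaced by the map `α` of
degree `l`, on labels of parities `p`. -/
noncomputable def mixRaw (g : OMap W W') (f α : OMap V W) (l : ℤ) (T : RTree ι L)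
    (p : ι → ZMod 2) : MultilinearMap K (fun v => V.ext (T.In v)) (W'.ext L) :=
  ∑ b : T.Partition, ∑ r : b.Roots, sgn K (b.sexp (par (Pi.single r.1 l)) p) •
    b.glue g fun v => if v = r.1 then α else f

/-- The composite of `g` with the maps `f` of degree `0`, on labels of parities `p`. -/
noncomputable def compRaw (g : OMap W W') (f : OMap V W) (T : RTree ι L) (p : ι → ZMod 2) :
    MultilinearMap K (fun v => V.ext (T.In v)) (W'.ext L) :=
  ∑ b : T.Partition, sgn K (b.sexp (par fun _ => 0) p) • b.glue g fun _ => f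

theorem mixRaw_apply (g : OMap W W') (f α : OMap V W) (l : ℤ) (T : RTree ι L)
    (p : ι → ZMod 2) (x : ∀ v, V.ext (T.In v)) : mixRaw g f α l T p x =
      ∑ b : T.Partition, ∑ r : b.Roots, sgn K (b.sexp (par (Pi.single r.1 l)) p) •
        b.glue g (fun v => if v = r.1 then α else f) x := by
  unfold mixRaw
  rw [_root_.sum_apply]
  refine Finset.sum_congr rfl fun b _ => ?_
  rw [_root_.sum_apply]
  rfl

theorem compRaw_apply (g : OMap W W') (f : OMap V W) (T : RTree ι L)
    (p : ι → ZMod 2) (x : ∀ v, V.ext (T.In v)) : compRaw g f T p x =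
      ∑ b : T.Partition, sgn K (b.sexp (par fun _ => 0) p) • b.glue g (fun _ => f) x := by
  unfold compRaw
  rw [_root_.sum_apply]
  rfl

theorem isGr_single {f α : OMap V W} {l : ℤ} (hf : f.IsGr 0) (hα : α.IsGr l) (r : ι) (v : ι) :
    (if v = r then α else f).IsGr ((Pi.single r l : ι → ℤ) v) := by
  by_cases hv : v = r
  · subst hv
    simpa using hα
  · simpa [hv] using hf

theorem mixRaw_mem {g : OMap W W'} {f α : OMap V W} {k l : ℤ} (hg : g.IsGr k) (hf : f.IsGr 0)
    (hα : α.IsGr l) (T : RTree ι L) {x : ∀ v, V.ext (T.In v)} {e : ι → ℤ}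
    (hx : ∀ v, x v ∈ V.extGr _ (e v)) :
    mixRaw g f α l T (par e) x ∈ W'.extGr L ((∑ v, e v) + (k + l)) := by
  rw [mixRaw_apply]
  refine Submodule.sum_mem _ fun b _ => Submodule.sum_mem _ fun r _ => Submodule.smul_mem _ _ ?_
  have := b.glue_mem hg (isGr_single hf hα r.1) hx
  have h1 : ∑ r' : b.Roots, (Pi.single r.1 l : ι → ℤ) r'.1 = l := by
    rw [Finset.sum_eq_single r]
    · simp
    · intro r' _ hr'
      exact Pi.single_eq_of_ne (fun h => hr' (Subtype.ext h)) _
    · simp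
  rwa [h1, add_assoc, add_comm l k] at this

theorem mixRaw_natural {g : OMap W W'} {f α : OMap V W} {k l : ℤ} (hg : g.IsGr k) (hf : f.IsGr 0)
    (hα : α.IsGr l) {T : RTree ι L} {T' : RTree ι' L'} {φ : ι ≃ ι'} {ψ : L ≃ L'}
    (h : T.IsIso T' φ ψ) {x : ∀ v, V.ext (T.In v)}
    {x' : ∀ v, V.ext (T'.In v)} {e : ι → ℤ} {e' : ι' → ℤ} (hx : ∀ v, x v ∈ V.extGr _ (e v))
    (hx' : ∀ v, x' (φ v) = V.reindex (h.inEquiv v) (x v)) (he : ∀ v, e' (φ v) = e v) :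
    mixRaw g f α l T' (par e') x' =
      sgn K (kz φ (par e)) • W'.reindex ψ (mixRaw g f α l T (par e) x) := by
  rw [mixRaw_apply, mixRaw_apply, map_sum, Finset.smul_sum]
  symm
  refine Fintype.sum_bijective _ (RTree.Partition.mapIso_bijective h) _ _ fun b => ?_
  rw [map_sum, Finset.smul_sum]
  refine sum_equiv_of (b.mapRoots h) fun r => ?_
  symm
  refine b.glue_natural h hg (fun v => ?_) (isGr_single hf hα r.1) (atMostOne_single r.1 l)
    (fun v => ?_) hx hx' he
  · exact if_congr φ.apply_eq_iff_eq rfl rfl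
  · change (Pi.single (φ r.1) l : ι' → ℤ) (φ v) = _
    by_cases hv : v = r.1
    · rw [hv, Pi.single_eq_same, Pi.single_eq_same]
    · rw [Pi.single_eq_of_ne hv, Pi.single_eq_of_ne (φ.injective.ne hv)]

theorem compRaw_mem {g : OMap W W'} {f : OMap V W} {k : ℤ} (hg : g.IsGr k) (hf : f.IsGr 0)
    (T : RTree ι L) {x : ∀ v, V.ext (T.In v)} {e : ι → ℤ}
    (hx : ∀ v, x v ∈ V.extGr _ (e v)) :
    compRaw g f T (par e) x ∈ W'.extGr L ((∑ v, e v) + k) := by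
  rw [compRaw_apply]
  refine Submodule.sum_mem _ fun b _ => Submodule.smul_mem _ _ ?_
  have := b.glue_mem hg (d := fun _ => 0) (fun _ => hf) hx
  simpa using this

theorem compRaw_natural {g : OMap W W'} {f : OMap V W} {k : ℤ} (hg : g.IsGr k) (hf : f.IsGr 0)
    {T : RTree ι L} {T' : RTree ι' L'} {φ : ι ≃ ι'} {ψ : L ≃ L'}
    (h : T.IsIso T' φ ψ) {x : ∀ v, V.ext (T.In v)}
    {x' : ∀ v, V.ext (T'.In v)} {e : ι → ℤ} {e' : ι' → ℤ} (hx : ∀ v, x v ∈ V.extGr _ (e v))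
    (hx' : ∀ v, x' (φ v) = V.reindex (h.inEquiv v) (x v)) (he : ∀ v, e' (φ v) = e v) :
    compRaw g f T' (par e') x' =
      sgn K (kz φ (par e)) • W'.reindex ψ (compRaw g f T (par e) x) := by
  rw [compRaw_apply, compRaw_apply, map_sum, Finset.smul_sum]
  symm
  refine Fintype.sum_bijective _ (RTree.Partition.mapIso_bijective h) _ _ fun b => ?_
  symm
  exact b.glue_natural h hg (fun v => rfl) (fun _ => hf) atMostOne_zero (fun v => rfl) hx hx' he

end Raw

namespace TreeMap

variable {V : GrSMod.{w, u} K} {W : GrSMod.{w, u'} K} {W' : GrSMod.{w, u''} K} {k l m : ℤ}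

/-- The composite of `g` with the map of cofree cooperads that extends `f` as a coderivation `α`
along `f`; that is, one of the maps `f` is replaced by `α`. -/
noncomputable def mix (g : TreeMap W W' k) (f : TreeMap V W 0) (α : TreeMap V W l)
    (hm : k + l = m) : TreeMap V W' m :=
  ofParity (fun T p => mixRaw g.toOMap f.toOMap α.toOMap l T p)
    (fun T x e hx => hm ▸ mixRaw_mem g.isGr f.isGr α.isGr T hx)
    (fun T T' φ ψ h e e' x x' hx hx' he => mixRaw_natural g.isGr f.isGr α.isGr h hx hx' he)
    (fun T p => by
      ext1 x
      rw [mixRaw_apply]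
      simp)

/-- The composite of `g` with the coderivation of the cofree cooperad that extends `α`. -/
noncomputable def star (g : TreeMap V W k) (α : TreeMap V V l) (hm : k + l = m) : TreeMap V W m :=
  g.mix (ofEquiv (EquivMap.id V)) α hm

/-- The composite of `g` with the morphism of cofree cooperads that extends `f`. -/
noncomputable def comp (g : TreeMap W W' k) (f : TreeMap V W 0) : TreeMap V W' k :=
  ofParity (fun T p => compRaw g.toOMap f.toOMap T p)
    (fun T x e hx => compRaw_mem g.isGr f.isGr T hx)
    (fun T T' φ ψ h e e' x x' hx hx' he => compRaw_natural g.isGr f.isGr h hx hx' he)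
    (fun {ι L} _ _ _ _ T p => by
      ext1 x
      rw [compRaw_apply]
      refine Finset.sum_eq_zero fun b _ => ?_
      have : b.glue g.toOMap (fun _ => f.toOMap) x = 0 := by
        rw [RTree.Partition.glue_apply]
        change g.map b.quot _ = 0
        rw [g.map_trivial]
        rfl
      rw [this, smul_zero])

variable {ι L : Type} [Fintype ι] [LinearOrder ι] [Finite L] {T : RTree ι L} {e : ι → ℤ}
  {x : ∀ v, V.ext (T.In v)}

theorem mix_apply (g : TreeMap W W' k) (f : TreeMap V W 0) (α : TreeMap V W l)
    (hm : k + l = m) (hx : ∀ v, x v ∈ V.extGr _ (e v)) : (g.mix f α hm).map T x =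
      ∑ b : T.Partition, ∑ r : b.Roots, sgn K (b.sexp (par (Pi.single r.1 l)) (par e)) •
        b.glue g.toOMap (fun v => if v = r.1 then α.toOMap else f.toOMap) x := by
  unfold mix
  rw [ofParity_apply _ _ _ _ T hx, mixRaw_apply]

theorem star_apply (g : TreeMap V W k) (α : TreeMap V V l)
    (hm : k + l = m) (hx : ∀ v, x v ∈ V.extGr _ (e v)) : (g.star α hm).map T x =
      ∑ b : T.Partition, ∑ r : b.Roots, sgn K (b.sexp (par (Pi.single r.1 l)) (par e)) •
        b.glue g.toOMap (fun v => if v = r.1 then α.toOMap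
          else (ofEquiv (EquivMap.id V)).toOMap) x :=
  mix_apply g _ α hm hx

theorem comp_apply (g : TreeMap W W' k) (f : TreeMap V W 0)
    (hx : ∀ v, x v ∈ V.extGr _ (e v)) : (g.comp f).map T x =
      ∑ b : T.Partition, sgn K (b.sexp (par fun _ => 0) (par e)) •
        b.glue g.toOMap (fun _ => f.toOMap) x := by
  unfold comp
  rw [ofParity_apply _ _ _ _ T hx, compRaw_apply]

theorem _root_.HtpyOperad.RTree.Partition.sexp_single (b : T.Partition) (r : b.Roots) (l : ℤ)
    (p : ι → ZMod 2) : b.sexp (par (Pi.single r.1 l)) p =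
      kz b.low p + ∑ i with b.low i < r.1, (l : ZMod 2) * p i := by
  unfold RTree.Partition.sexp RTree.Partition.pexp
  congr 1
  rw [Finset.sum_filter]
  refine Finset.sum_congr rfl fun i _ => ?_
  rw [Finset.sum_eq_single r]
  · simp [par]
  · intro r' _ hr'
    have : (Pi.single r.1 l : ι → ℤ) r'.1 = 0 :=
      Pi.single_eq_of_ne (fun h => hr' (Subtype.ext h)) _
    simp [par, this]
  · simp

theorem _root_.HtpyOperad.RTree.Partition.sexp_zero (b : T.Partition)
    (p : ι → ZMod 2) : b.sexp (par fun _ => 0) p = kz b.low p := by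
  unfold RTree.Partition.sexp RTree.Partition.pexp
  simp [par]

theorem star_eq_compCoder (g : TreeMap V W k) (α : TreeMap V V (-1))
    (hm : k + -1 = m) (hx : ∀ v, x v ∈ V.extGr _ (e v)) :
    (g.star α hm).map T x = compCoder g α T e x := by
  rw [star_apply g α hm hx]
  refine Finset.sum_congr rfl fun b _ => Finset.sum_congr rfl fun r _ => ?_
  rw [units_smul_eq (K := K), Units.val_mul, Int.cast_mul, koszul_cast, negOnePow_cast, ← sgn_add,
    b.sexp_single]
  congr 1
  · congr 2
    rw [Int.cast_sum]
    refine Finset.sum_congr rfl fun i _ => ?_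
    rw [show ((-1 : ℤ) : ZMod 2) = 1 from rfl, one_mul]
    rfl
  · rw [RTree.Partition.glue_apply]
    change g.map b.quot _ = g.map b.quot _
    congr 1
    funext r'
    by_cases hr : r' = r
    · subst hr
      simp only [if_pos]
      rfl
    · rw [if_neg hr, if_neg fun h => hr (Subtype.ext h)]
      rfl

theorem comp_eq_compMor (g : TreeMap W W k) (f : TreeMap V W 0)
    (hx : ∀ v, x v ∈ V.extGr _ (e v)) :
    (g.comp f).map T x = compMor g f T e x := by
  rw [comp_apply g f hx]
  refine Finset.sum_congr rfl fun b _ => ?_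
  rw [koszul_smul (K := K), b.sexp_zero]
  rfl

end TreeMap

/-! ### Unit laws -/

namespace RTree

variable {ι L : Type} {T : RTree ι L}

/-- The inputs of the only vertex of a tree are the leaves. -/
noncomputable def uniqueIn {v : ι} (hv : ∀ w, w = v) : T.In v ≃ L :=
  (Equiv.ofBijective (fun l : L => (⟨Sum.inr l, target_leaf_of_unique hv l⟩ : T.In v)) (by
    constructor
    · intro l l' h
      exact Sum.inr_injective (congrArg Subtype.val h)
    · rintro ⟨z | z, hz⟩
      · rw [hv z] at hz
        exact (T.target_ne v hz).elim
      · exact ⟨z, rfl⟩)).symm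

theorem uniqueIn_eq {v : ι} (hv : ∀ w, w = v) (z : T.In v) (l : L) (hz : z.1 = Sum.inr l) :
    uniqueIn hv z = l := by
  rw [uniqueIn, Equiv.symm_apply_eq]
  exact Subtype.ext hz

theorem inr_uniqueIn {v : ι} (hv : ∀ w, w = v) (z : T.In v) :
    Sum.inr (uniqueIn hv z) = z.1 := by
  obtain ⟨l, rfl⟩ := (uniqueIn (T := T) hv).symm.surjective z
  rw [Equiv.apply_symm_apply]
  rfl

theorem transfer_of_unique {v : ι} (hv : ∀ w, w = v) (V : GrSMod.{w, u} K) :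
    T.transfer V v = V.reindex (uniqueIn hv) :=
  transfer_eq V (no_left_input hv) _ (uniqueIn_eq hv)

theorem exists_root_vertex [Nonempty ι] (T : RTree ι L) : ∃ v, T.target (Sum.inl v) = none := by
  obtain ⟨v, -, hv⟩ := T.wf.has_min Set.univ Set.univ_nonempty
  refine ⟨v, Option.eq_none_iff_forall_ne_some.2 fun u hu => hv u (Set.mem_univ u) hu⟩

namespace Partition

variable (b : T.Partition)

/-- The subtree of the partition with only one subtree is the whole tree. -/
theorem sub_isIso_of_one {r : b.Roots} (hb : ∀ v, b.low v = r.1) :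
    (b.sub r).IsIso T (Equiv.subtypeUnivEquiv hb)
      (uniqueIn (T := b.quot) (v := r) fun s => Subtype.ext (s.2.symm.trans (hb s.1))) := by
  refine isIso_of_iff fun z v => ?_
  rw [sub_target_iff]
  have hz : Equiv.sumCongr (Equiv.subtypeUnivEquiv hb) (uniqueIn (T := b.quot) (v := r)
      fun s => Subtype.ext (s.2.symm.trans (hb s.1))) z = b.incl r z := by
    rcases z with z | z
    · rfl
    · have h := inr_uniqueIn (T := b.quot) (v := r)
        (fun s => Subtype.ext (s.2.symm.trans (hb s.1))) z
      change Sum.inr _ = Sum.map Subtype.val id z.1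
      rw [← h]
      rfl
  rw [hz]
  rfl

/-- The composition along the partition with one subtree, with a map supported on the generators. -/
theorem map_of_one [Fintype ι] [LinearOrder ι] [Finite L] {V : GrSMod.{w, u} K}
    {W : GrSMod.{w, u'} K} (f : OMap V W) {r : b.Roots} (hb : ∀ v, b.low v = r.1)
    (x : ∀ v, V.ext (T.In v)) :
    b.quot.transfer W r (f.map (b.sub r) (b.restrict V x r)) = f.map T x := by
  rw [transfer_of_unique (T := b.quot) (v := r)
    fun s => Subtype.ext (s.2.symm.trans (hb s.1))]
  refine (f.nat _ _ _ _ (b.sub_isIso_of_one hb) (fun _ _ h => h) _ _ fun v => ?_).symm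
  unfold restrict
  rw [GrSMod.reindex_reindex]
  have h : ∀ z, Equiv.refl _ ((b.sub_isIso_of_one hb).inEquiv v z) = b.inEquiv r v z := by
    rintro ⟨z | z, hz⟩
    · rfl
    · refine Subtype.ext ?_
      have h := inr_uniqueIn (T := b.quot) (v := r)
        (fun s => Subtype.ext (s.2.symm.trans (hb s.1))) z
      change Sum.inr _ = Sum.map Subtype.val id z.1
      rw [← h]
      rfl
  exact congrArg (fun g => V.reindex g (x v.1))
    ((Equiv.trans_refl _).symm.trans (trans_symm_eq (Equiv.refl _) (Equiv.refl _) _ _ h))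

/-- The quotient by the partition into single vertices is the whole tree. -/
theorem quot_isIso_of_discrete (hb : ∀ v, b.low v = v) :
    b.quot.IsIso T (Equiv.subtypeUnivEquiv hb) (Equiv.refl L) := by
  refine isIso_of_iff fun z v => ?_
  rw [quot_target_iff]
  have hz : Equiv.sumCongr (Equiv.subtypeUnivEquiv hb) (Equiv.refl L) z =
      Sum.map Subtype.val id z := by
    rcases z with z | z <;> rfl
  rw [hz]
  simp only [hb]
  constructor
  · rintro ⟨u, hu, rfl⟩
    exact hu
  · intro h
    exact ⟨_, h, rfl⟩

theorem block_unique_of_discrete (hb : ∀ v, b.low v = v) (r : b.Roots) (v : b.Block r) :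
    v = ⟨r.1, r.2⟩ :=
  Subtype.ext ((hb v.1).symm.trans v.2)

variable [Fintype ι] [LinearOrder ι] [Finite L] {V : GrSMod.{w, u} K} {W : GrSMod.{w, u'} K}
  {W' : GrSMod.{w, u''} K}

theorem reindex_of_discrete (hb : ∀ v, b.low v = v) {d : ℤ} (φ : EquivMap V W d)
    (x : ∀ v, V.ext (T.In v)) (r : b.Roots) : φ.ext _ (x r.1) =
      W.reindex ((b.quot_isIso_of_discrete hb).inEquiv r)
        ((TreeMap.ofEquiv φ).map (b.sub r) (b.restrict V x r)) := by
  rw [TreeMap.ofEquiv_of_unique _ _ _ (b.block_unique_of_discrete hb r),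
    transfer_of_unique (b.block_unique_of_discrete hb r)]
  unfold restrict
  rw [EquivMap.ext_reindex, GrSMod.reindex_reindex, GrSMod.reindex_reindex]
  have h : ∀ z : (b.sub r).In ⟨r.1, r.2⟩, (((uniqueIn
      (b.block_unique_of_discrete hb r)).trans ((b.quot_isIso_of_discrete hb).inEquiv r)) z :
      T.In r.1) = b.inEquiv r ⟨r.1, r.2⟩ z := by
    intro z
    refine Subtype.ext ?_
    change Sum.map _ _ _ = b.incl r z.1
    rw [← inr_uniqueIn (b.block_unique_of_discrete hb r) z]
    rfl
  have h2 : (b.inEquiv r ⟨r.1, r.2⟩).symm.trans ((uniqueIn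
      (b.block_unique_of_discrete hb r)).trans ((b.quot_isIso_of_discrete hb).inEquiv r)) =
      Equiv.refl (T.In r.1) :=
    Equiv.ext fun z => (h _).trans (Equiv.apply_symm_apply _ _)
  exact congrArg (fun g => W.reindex g (φ.ext _ (x r.1))) h2.symm

/-- The composition along the partition into single vertices applies a map to each label. -/
theorem glue_of_discrete (hb : ∀ v, b.low v = v) (g : OMap W W') (h : ι → OMap V W)
    {d : ι → ℤ} (φ : ∀ v, EquivMap V W (d v))
    (hh : ∀ r : b.Roots, (h r.1).map (b.sub r) = (TreeMap.ofEquiv (φ r.1)).map (b.sub r))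
    (x : ∀ v, V.ext (T.In v)) : b.glue g h x = g.map T fun v => (φ v).ext _ (x v) := by
  rw [glue_apply]
  refine Eq.trans ?_ (g.nat _ _ _ _ (b.quot_isIso_of_discrete hb) (fun _ _ h => h)
    (fun r : b.Roots => (h r.1).map (b.sub r) (b.restrict V x r)) _ fun r => ?_).symm
  · exact (GrSMod.reindex_refl _).symm
  · rw [hh]
    exact b.reindex_of_discrete hb (φ r.1) x r

theorem glue_eq_zero (g : OMap W W') (h : ι → OMap V W) (r : b.Roots)
    (hr : (h r.1).map (b.sub r) = 0) : b.glue g h = 0 := by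
  ext1 x
  rw [glue_apply]
  refine MultilinearMap.map_coord_zero _ r ?_
  rw [hr]
  rfl

/-- The partition of a tree into its vertices. -/
def discrete (T : RTree ι L) : T.Partition := ⟨id, fun _ => Or.inl rfl⟩

/-- The partition of a tree with only one subtree, whose lowest vertex `v` is the root. -/
def whole (T : RTree ι L) (v : ι) (hv : T.target (Sum.inl v) = none) : T.Partition where
  low _ := v
  cond w := by
    rcases h : T.target (Sum.inl w) with _ | u
    · exact Or.inl (Sum.inl_injective (T.root.unique hv h))
    · exact Or.inr ⟨u, rfl, rfl⟩

theorem eq_discrete {b : T.Partition} (h : ∀ r : b.Roots, Fintype.card (b.Block r) = 1) :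
    b = discrete T := by
  refine ext_low fun v => ?_
  obtain ⟨y, hy⟩ := Fintype.card_eq_one_iff.1 (h (b.root v))
  have h1 := hy ⟨v, rfl⟩
  have h2 := hy ⟨b.low v, b.idem v⟩
  exact congrArg Subtype.val (h2.trans h1.symm)

theorem eq_whole {b : T.Partition} (h : Fintype.card b.Roots = 1) {v : ι}
    (hv : T.target (Sum.inl v) = none) : b = whole T v hv := by
  refine ext_low fun w => ?_
  obtain ⟨y, hy⟩ := Fintype.card_eq_one_iff.1 h
  have h1 := (hy (b.root w)).trans (hy (b.root v)).symm
  exact (congrArg Subtype.val h1).trans (b.low_eq_of_target_none hv)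

theorem glue_ofEquiv_left {l : ℤ} (φ : EquivMap W W' l) (h : ι → OMap V W)
    (hb : Fintype.card b.Roots ≠ 1) : b.glue (TreeMap.ofEquiv φ).toOMap h = 0 := by
  ext1 x
  rw [glue_apply]
  change (TreeMap.ofEquiv φ).map b.quot _ = 0
  rw [TreeMap.ofEquiv_of_card_ne φ _ hb]
  rfl

theorem glue_whole {l : ℤ} (φ : EquivMap W W' l) (h : ι → OMap V W) {v : ι}
    (hv : T.target (Sum.inl v) = none) (x : ∀ v, V.ext (T.In v)) :
    (whole T v hv).glue (TreeMap.ofEquiv φ).toOMap h x = φ.ext _ ((h v).map T x) := by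
  rw [glue_apply]
  change (TreeMap.ofEquiv φ).map (whole T v hv).quot _ = _
  refine (TreeMap.ofEquiv_of_unique φ (whole T v hv).quot _ (v := ⟨v, rfl⟩)
    fun s => Subtype.ext s.2.symm).trans ?_
  rw [transfer_ext]
  exact congrArg _ (map_of_one (whole T v hv) (h v) (r := ⟨v, rfl⟩) (fun _ => rfl) x)

theorem sexp_whole {v : ι} (hv : T.target (Sum.inl v) = none) (κ p : ι → ZMod 2) :
    (whole T v hv).sexp κ p = 0 := by
  unfold sexp pexp kz
  rw [Finset.sum_eq_zero, Finset.sum_eq_zero, add_zero]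
  · exact fun i _ => Finset.sum_eq_zero fun r _ => if_neg fun h => h.ne r.2
  · exact fun i _ => Finset.sum_eq_zero fun j _ => if_neg fun h => h.2.ne rfl

end Partition

end RTree

section Units

open RTree RTree.Partition

variable {ι L : Type} [Fintype ι] [LinearOrder ι] [Finite L] {V : GrSMod.{w, u} K}
  {W : GrSMod.{w, u'} K} {W' : GrSMod.{w, u''} K} {l m : ℤ}

theorem compRaw_ofEquiv_left (φ : EquivMap W W' l) (f : OMap V W) [Nonempty ι] (T : RTree ι L)
    (p : ι → ZMod 2) (x : ∀ v, V.ext (T.In v)) :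
    compRaw (TreeMap.ofEquiv φ).toOMap f T p x = φ.ext _ (f.map T x) := by
  obtain ⟨v, hv⟩ := T.exists_root_vertex
  rw [compRaw_apply, Finset.sum_eq_single (whole T v hv), sexp_whole, sgn_zero, one_smul,
    glue_whole]
  · intro b _ hb
    rw [glue_ofEquiv_left _ _ _ fun h => hb (eq_whole h hv)]
    simp
  · simp

theorem mixRaw_ofEquiv_left (φ : EquivMap W W' l) (f α : OMap V W) [Nonempty ι] (T : RTree ι L)
    (p : ι → ZMod 2) (x : ∀ v, V.ext (T.In v)) :
    mixRaw (TreeMap.ofEquiv φ).toOMap f α m T p x = φ.ext _ (α.map T x) := by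
  obtain ⟨v, hv⟩ := T.exists_root_vertex
  rw [mixRaw_apply, Finset.sum_eq_single (whole T v hv), Finset.sum_eq_single ⟨v, rfl⟩,
    sexp_whole, sgn_zero, one_smul, glue_whole, if_pos rfl]
  · intro r _ hr
    exact (hr (Subtype.ext r.2.symm)).elim
  · simp
  · intro b _ hb
    refine Finset.sum_eq_zero fun r _ => ?_
    rw [glue_ofEquiv_left _ _ _ fun h => hb (eq_whole h hv)]
    simp
  · simp

theorem sexp_discrete_zero {T : RTree ι L} (p : ι → ZMod 2) :
    (discrete T).sexp (par fun _ => 0) p = 0 := by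
  rw [sexp_zero]
  exact kz_of_strictMono (fun _ _ h => h) p

theorem compRaw_ofEquiv_right (g : OMap W W') (φ : EquivMap V W l) (T : RTree ι L)
    (p : ι → ZMod 2) (x : ∀ v, V.ext (T.In v)) :
    compRaw g (TreeMap.ofEquiv φ).toOMap T p x = g.map T fun v => φ.ext _ (x v) := by
  rw [compRaw_apply, Finset.sum_eq_single (discrete T), sexp_discrete_zero, sgn_zero, one_smul,
    glue_of_discrete _ (fun _ => rfl) _ _ (fun _ => φ) (fun _ => rfl)]
  · intro b _ hb
    have : ∃ r : b.Roots, Fintype.card (b.Block r) ≠ 1 := by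
      by_contra! h
      exact hb (eq_discrete h)
    obtain ⟨r, hr⟩ := this
    rw [glue_eq_zero _ _ _ r (TreeMap.ofEquiv_of_card_ne φ _ hr)]
    simp
  · simp

end Units

/-! ### Associativity of the compositions -/

namespace RTree.Partition

variable {ι L : Type} [Fintype ι] [LinearOrder ι] [Finite L] {T : RTree ι L}
  {V : GrSMod.{w, u} K} {W : GrSMod.{w, u'} K} {W' : GrSMod.{w, u''} K} {V' : GrSMod.{w, u'''} K}

/-- One term of a composition along nested partitions. -/
theorem sgn_smul_glue_nested (C : T.Partition) (β : ∀ s : C.Roots, (C.sub s).Partition)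
    (g : OMap W W') (h : ι → OMap V W) (k : ι → OMap V' V) {κ lam μ p : ι → ZMod 2}
    (hκ : AtMostOne κ) (hμ : ∀ s : C.Roots, μ s.1 = lam s.1 + ∑ r : (β s).Roots, κ r.1.1)
    {c : ZMod 2} (hc : ∑ s : C.Roots, ∑ r : (C.refine β).Roots,
      (if C.low r.1 < s.1 then lam s.1 * κ r.1 else 0) = c) (x : ∀ v, V'.ext (T.In v)) :
    sgn K ((C.refine β).sexp κ p) •
      sgn K ((C.coarse β).sexp (fun r => lam r.1) ((C.refine β).outp κ p)) •
        (C.coarse β).glue g (fun r => h r.1)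
          (fun r => (k r.1).map ((C.refine β).sub r) ((C.refine β).restrict V' x r)) =
    sgn K (C.sexp μ p + c) • g.map C.quot fun s =>
      sgn K ((β s).sexp (fun v => κ v.1) (fun v => p v.1)) •
        (β s).glue (h s.1) (fun v => k v.1) (C.restrict V' x s) := by
  rw [smul_smul, ← sgn_add, C.sexp_nested β hκ hμ, hc, C.glue_nested,
    MultilinearMap.map_smul_univ, smul_smul, ← sgn_sum, ← sgn_add]
  congr 2
  ring

/-- Summation over the partitions of the subtrees: each subtree contributes a composition. -/
theorem sum_map_glue (C : T.Partition) (g : OMap W W') (h : ι → OMap V W) (k : OMap V' V)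
    (p : ι → ZMod 2) (x : ∀ v, V'.ext (T.In v)) :
    ∑ β : ∀ s : C.Roots, (C.sub s).Partition, g.map C.quot (fun s =>
      sgn K ((β s).sexp (par fun _ => 0) (fun v => p v.1)) •
        (β s).glue (h s.1) (fun _ => k) (C.restrict V' x s)) =
    g.map C.quot fun s => compRaw (h s.1) k (C.sub s) (fun v => p v.1) (C.restrict V' x s) := by
  refine ((g.map C.quot).map_sum fun s (b : (C.sub s).Partition) =>
    sgn K (b.sexp (par fun _ => 0) (fun v => p v.1)) •
      b.glue (h s.1) (fun _ => k) (C.restrict V' x s)).symm.trans ?_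
  simp only [compRaw_apply]

/-- Summation over the partitions of the subtrees, with a distinguished subtree of one of these
partitions: one of the subtrees contributes a composition with a coderivation. -/
theorem sum_map_glue_single (C : T.Partition) (g : OMap W W') (h : ι → OMap V W) (k α : OMap V' V)
    (l : ℤ) (p : ι → ZMod 2) (x : ∀ v, V'.ext (T.In v)) (s₁ : C.Roots) :
    ∑ β : ∀ s : C.Roots, (C.sub s).Partition, ∑ t : (β s₁).Roots, g.map C.quot (fun s =>
      sgn K ((β s).sexp (fun v => par (Pi.single t.1.1 l) v.1) (fun v => p v.1)) •
        (β s).glue (h s.1) (fun v => if v.1 = t.1.1 then α else k) (C.restrict V' x s)) =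
    g.map C.quot fun s =>
      if s = s₁ then mixRaw (h s.1) k α l (C.sub s) (fun v => p v.1) (C.restrict V' x s)
      else compRaw (h s.1) k (C.sub s) (fun v => p v.1) (C.restrict V' x s) := by
  let Z : ∀ s : C.Roots, (C.sub s).Partition → W.ext (C.quot.In s) := fun s b =>
    if s = s₁ then ∑ t : b.Roots, sgn K (b.sexp (par (Pi.single t.1 l)) (fun v => p v.1)) •
        b.glue (h s.1) (fun v => if v = t.1 then α else k) (C.restrict V' x s)
    else sgn K (b.sexp (par fun _ => 0) (fun v => p v.1)) •
        b.glue (h s.1) (fun _ => k) (C.restrict V' x s)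
  have h1 : ∀ β : ∀ s : C.Roots, (C.sub s).Partition, ∑ t : (β s₁).Roots, g.map C.quot (fun s =>
      sgn K ((β s).sexp (fun v => par (Pi.single t.1.1 l) v.1) (fun v => p v.1)) •
        (β s).glue (h s.1) (fun v => if v.1 = t.1.1 then α else k) (C.restrict V' x s)) =
      g.map C.quot fun s => Z s (β s) := by
    intro β
    have e1 : (fun s => Z s (β s)) = Function.update (fun s => Z s (β s)) s₁
        (∑ t : (β s₁).Roots, sgn K ((β s₁).sexp (par (Pi.single t.1 l)) (fun v => p v.1)) •
          (β s₁).glue (h s₁.1) (fun v => if v = t.1 then α else k) (C.restrict V' x s₁)) := by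
      refine (Function.update_eq_self_iff.2 ?_).symm
      exact (if_pos rfl).symm
    rw [e1, MultilinearMap.map_update_sum]
    refine Finset.sum_congr rfl fun t _ => congrArg _ (funext fun s => ?_)
    by_cases hs : s = s₁
    · subst hs
      rw [Function.update_self]
      congr 2
      · congr 1
        funext v
        by_cases hv : v = t.1
        · simp [par, hv]
        · have hv' : v.1 ≠ t.1.1 := fun h => hv (Subtype.ext h)
          simp [par, hv, hv']
      · congr 1
        funext v
        exact if_congr Subtype.ext_iff.symm rfl rfl
    · rw [Function.update_of_ne hs]
      have hne : ∀ v : C.Block s, v.1 ≠ t.1.1 := fun v hv =>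
        hs (Subtype.ext (v.2.symm.trans ((congrArg C.low hv).trans t.1.2)))
      refine Eq.trans ?_ (if_neg hs).symm
      congr 2
      · congr 1
        funext v
        simp [par, hne v]
      · congr 1
        funext v
        exact if_neg (hne v)
  rw [Finset.sum_congr rfl fun β _ => h1 β, ← MultilinearMap.map_sum]
  congr 1
  funext s
  by_cases hs : s = s₁
  · rw [if_pos hs, mixRaw_apply]
    exact Finset.sum_congr rfl fun b _ => if_pos hs
  · rw [if_neg hs, compRaw_apply]
    exact Finset.sum_congr rfl fun b _ => if_neg hs

theorem par_single_val (b : T.Partition) {_ : DecidableEq b.Roots} (r : b.Roots) (l : ℤ) :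
    par (Pi.single r l) = fun r' : b.Roots => par (Pi.single r.1 l : ι → ℤ) r'.1 := by
  funext r'
  by_cases hr : r' = r
  · simp [par, hr]
  · have : r'.1 ≠ r.1 := fun h => hr (Subtype.ext h)
    simp [par, hr, this]

theorem sum_par_single_block (C : T.Partition) (β : ∀ s : C.Roots, (C.sub s).Partition)
    {s₁ : C.Roots} (t : (β s₁).Roots) (l : ℤ) (s : C.Roots) :
    ∑ r : (β s).Roots, par (Pi.single t.1.1 l) r.1.1 = par (Pi.single s₁.1 l) s.1 := by
  by_cases hs : s = s₁
  · subst hs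
    rw [Finset.sum_eq_single t]
    · simp [par]
    · intro r _ hr
      have : r.1.1 ≠ t.1.1 := fun h => hr (Subtype.ext (Subtype.ext h))
      simp [par, this]
    · simp
  · have : s.1 ≠ s₁.1 := fun h => hs (Subtype.ext h)
    rw [Finset.sum_eq_zero]
    · simp [par, this]
    · intro r _
      have : r.1.1 ≠ t.1.1 := fun h => this (r.1.2.symm.trans ((congrArg C.low h).trans t.1.2))
      simp [par, this]

end RTree.Partition

namespace TreeMap

open RTree.Partition

variable {V : GrSMod.{w, u} K} {W : GrSMod.{w, u'} K} {W' : GrSMod.{w, u''} K}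
  {V' : GrSMod.{w, u'''} K} {k l m : ℤ}

variable {ι L : Type} [Fintype ι] [LinearOrder ι] [Finite L]

/-- A morphism of cofree cooperads composes with a coderivation on its target. -/
theorem star_comp (g : TreeMap W W' k) (α : TreeMap W W l) (hm : k + l = m) (f : TreeMap V W 0)
    (T : RTree ι L) : ((g.star α hm).comp f).map T = (g.mix f (α.comp f) hm).map T := by
  refine ext_homogeneous fun e x hx => ?_
  rw [comp_apply _ _ hx, mix_apply _ _ _ _ hx]
  have h1 : ∀ B : T.Partition, sgn K (B.sexp (par fun _ => 0) (par e)) •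
      B.glue (g.star α hm).toOMap (fun _ => f.toOMap) x = ∑ D : B.quot.Partition, ∑ t : D.Roots,
        sgn K (B.sexp (par fun _ => 0) (par e)) •
        sgn K (D.sexp (fun r => par (Pi.single t.1.1 l : ι → ℤ) r.1)
          (B.outp (par fun _ => 0) (par e))) •
        D.glue g.toOMap (fun r => if r.1 = t.1.1 then α.toOMap
          else (ofEquiv (EquivMap.id W)).toOMap)
          (fun r => f.toOMap.map (B.sub r) (B.restrict V x r)) := by
    intro B
    have h := B.glue_label_mem (h := fun _ => f.toOMap) (fun _ => f.isGr) hx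
    rw [glue_apply]
    change _ • (g.star α hm).map B.quot _ = _
    have h0 : par (fun r : B.Roots => (∑ v : B.Block r, e v.1) + 0) = _ :=
      B.par_outp e fun _ => 0
    rw [star_apply g α hm h, h0, Finset.smul_sum]
    refine Finset.sum_congr rfl fun D _ => ?_
    rw [Finset.smul_sum]
    refine Finset.sum_congr rfl fun t _ => ?_
    rw [par_single_val B t.1]
    simp only [Subtype.ext_iff]
  rw [Finset.sum_congr rfl fun B _ => h1 B, sum_nested]
  refine Finset.sum_congr rfl fun C _ => ?_
  have h2 : ∀ (β : ∀ s : C.Roots, (C.sub s).Partition),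
      ∑ t : (C.coarse β).Roots, sgn K ((C.refine β).sexp (par fun _ => 0) (par e)) •
        sgn K ((C.coarse β).sexp (fun r => par (Pi.single t.1.1 l : ι → ℤ) r.1)
          ((C.refine β).outp (par fun _ => 0) (par e))) •
        (C.coarse β).glue g.toOMap (fun r => if r.1 = t.1.1 then α.toOMap
          else (ofEquiv (EquivMap.id W)).toOMap)
          (fun r => f.toOMap.map ((C.refine β).sub r) ((C.refine β).restrict V x r)) =
      ∑ s : C.Roots, sgn K (C.sexp (par (Pi.single s.1 l)) (par e)) •
        g.toOMap.map C.quot fun s' =>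
          sgn K ((β s').sexp (par fun _ => 0) (fun v => par e v.1)) •
          (β s').glue (if s'.1 = s.1 then α.toOMap else (ofEquiv (EquivMap.id W)).toOMap)
            (fun _ => f.toOMap) (C.restrict V x s') := by
    intro β
    symm
    refine sum_equiv_of (C.coarseRoots β) fun s => ?_
    have := C.sgn_smul_glue_nested β g.toOMap
      (fun v => if v = s.1 then α.toOMap else (ofEquiv (EquivMap.id W)).toOMap)
      (fun _ => f.toOMap) (κ := par fun _ => 0) (lam := par (Pi.single s.1 l))
      (μ := par (Pi.single s.1 l)) (p := par e) atMostOne_zero (by simp [par]) (c := 0)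
      (by simp [par]) x
    rw [add_zero] at this
    exact this.symm
  rw [Finset.sum_congr rfl fun β _ => h2 β, Finset.sum_comm]
  refine Finset.sum_congr rfl fun s _ => ?_
  rw [← Finset.smul_sum, sum_map_glue C g.toOMap
    (fun v => if v = s.1 then α.toOMap else (ofEquiv (EquivMap.id W)).toOMap), glue_apply]
  congr 2
  funext s'
  by_cases hs : s'.1 = s.1
  · rw [if_pos hs, if_pos hs]
    change _ = (α.comp f).map _ _
    unfold comp
    rw [ofParity_apply _ _ _ _ _ (C.restrict_mem hx s')]
    rfl
  · rw [if_neg hs, if_neg hs]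
    have : Nonempty (C.Block s') := ⟨⟨s'.1, s'.2⟩⟩
    rw [compRaw_ofEquiv_left, EquivMap.id_ext]

/-- The composite of a morphism of cofree cooperads with a coderivation on its source. -/
theorem comp_star (g : TreeMap W W' k) (f : TreeMap V W 0) (α : TreeMap V V l)
    (hm : k + l = m) (hl : 0 + l = l) (T : RTree ι L) :
    ((g.comp f).star α hm).map T = (g.mix f (f.star α hl) hm).map T := by
  refine ext_homogeneous fun e x hx => ?_
  rw [star_apply _ _ _ hx, mix_apply _ _ _ _ hx]
  set I := (ofEquiv (EquivMap.id V)).toOMap with hI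
  have hIg : I.IsGr 0 := (ofEquiv (EquivMap.id V)).isGr
  have h1 : ∀ B : T.Partition, ∑ r : B.Roots, sgn K (B.sexp (par (Pi.single r.1 l)) (par e)) •
      B.glue (g.comp f).toOMap (fun v => if v = r.1 then α.toOMap else I) x =
      ∑ D : B.quot.Partition, ∑ r : B.Roots, sgn K (B.sexp (par (Pi.single r.1 l)) (par e)) •
        sgn K (D.sexp (fun _ => par (fun _ : ι => 0) r.1)
          (B.outp (par (Pi.single r.1 l)) (par e))) •
        D.glue g.toOMap (fun _ => f.toOMap) (fun r' => (if r'.1 = r.1 then α.toOMap else I).map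
          (B.sub r') (B.restrict V x r')) := by
    intro B
    rw [Finset.sum_comm]
    refine Finset.sum_congr rfl fun r _ => ?_
    have h := B.glue_label_mem (h := fun v => if v = r.1 then α.toOMap else I)
      (isGr_single hIg α.isGr r.1) hx
    rw [glue_apply]
    change _ • (g.comp f).map B.quot _ = _
    rw [comp_apply g f h, par_outp, Finset.smul_sum]
    rfl
  rw [Finset.sum_congr rfl fun B _ => h1 B, sum_nested]
  refine Finset.sum_congr rfl fun C _ => ?_
  have h2 : ∀ (β : ∀ s : C.Roots, (C.sub s).Partition), ∑ r : (C.refine β).Roots,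
      sgn K ((C.refine β).sexp (par (Pi.single r.1 l)) (par e)) •
        sgn K ((C.coarse β).sexp (fun _ => par (fun _ : ι => 0) r.1)
          ((C.refine β).outp (par (Pi.single r.1 l)) (par e))) •
        (C.coarse β).glue g.toOMap (fun _ => f.toOMap) (fun r' =>
          (if r'.1 = r.1 then α.toOMap else I).map
            ((C.refine β).sub r') ((C.refine β).restrict V x r')) =
      ∑ s : C.Roots, ∑ t : (β s).Roots, sgn K (C.sexp (par (Pi.single s.1 l)) (par e)) •
        g.toOMap.map C.quot fun s' =>
          sgn K ((β s').sexp (fun v => par (Pi.single t.1.1 l) v.1) (fun v => par e v.1)) •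
          (β s').glue f.toOMap (fun v => if v.1 = t.1.1 then α.toOMap else I)
            (C.restrict V x s') := by
    intro β
    rw [sum_refine_roots]
    refine Finset.sum_congr rfl fun s _ => Finset.sum_congr rfl fun t _ => ?_
    have := C.sgn_smul_glue_nested β g.toOMap (fun _ => f.toOMap)
      (fun v => if v = t.1.1 then α.toOMap else I) (κ := par (Pi.single t.1.1 l))
      (lam := par fun _ => 0) (μ := par (Pi.single s.1 l)) (p := par e) (atMostOne_single _ _)
      (fun s' => by rw [sum_par_single_block]; simp [par]) (c := 0) (by simp [par]) x
    rw [add_zero] at this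
    exact this
  rw [Finset.sum_congr rfl fun β _ => h2 β, Finset.sum_comm]
  refine Finset.sum_congr rfl fun s _ => ?_
  simp only [← Finset.smul_sum]
  rw [sum_map_glue_single C g.toOMap (fun _ => f.toOMap), glue_apply]
  congr 2
  funext s'
  by_cases hs : s' = s
  · rw [if_pos hs, if_pos (congrArg Subtype.val hs)]
    change _ = (f.star α hl).map _ _
    unfold star mix
    rw [ofParity_apply _ _ _ _ _ (C.restrict_mem hx s')]
    rfl
  · rw [if_neg hs, if_neg fun h => hs (Subtype.ext h)]
    rw [compRaw_ofEquiv_right]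
    rfl

/-- The square of a coderivation of odd degree is a coderivation. -/
theorem star_star (g : TreeMap V W k) (α : TreeMap V V l) (hl : Odd l) {m' n : ℤ} (hm : k + l = m)
    (hm' : m + l = m') (hn : l + l = n) (hn' : k + n = m') (T : RTree ι L) :
    ((g.star α hm).star α hm').map T = (g.star (α.star α hn) hn').map T := by
  refine ext_homogeneous fun e x hx => ?_
  rw [star_apply _ _ _ hx, star_apply _ _ _ hx]
  set I := (ofEquiv (EquivMap.id V)).toOMap with hI
  have hIg : I.IsGr 0 := (ofEquiv (EquivMap.id V)).isGr
  have h1 : ∀ B : T.Partition, ∑ r : B.Roots, sgn K (B.sexp (par (Pi.single r.1 l)) (par e)) •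
      B.glue (g.star α hm).toOMap (fun v => if v = r.1 then α.toOMap else I) x =
      ∑ D : B.quot.Partition, ∑ r : B.Roots, ∑ t : D.Roots,
        sgn K (B.sexp (par (Pi.single r.1 l)) (par e)) •
        sgn K (D.sexp (fun r => par (Pi.single t.1.1 l : ι → ℤ) r.1)
          (B.outp (par (Pi.single r.1 l)) (par e))) •
        D.glue g.toOMap (fun r' => if r'.1 = t.1.1 then α.toOMap else I)
          (fun r' => (if r'.1 = r.1 then α.toOMap else I).map
            (B.sub r') (B.restrict V x r')) := by
    intro B
    rw [Finset.sum_comm]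
    refine Finset.sum_congr rfl fun r _ => ?_
    have h := B.glue_label_mem (h := fun v => if v = r.1 then α.toOMap else I)
      (isGr_single hIg α.isGr r.1) hx
    rw [glue_apply]
    change _ • (g.star α hm).map B.quot _ = _
    rw [star_apply g α hm h, par_outp, Finset.smul_sum]
    refine Finset.sum_congr rfl fun D _ => ?_
    rw [Finset.smul_sum]
    refine Finset.sum_congr rfl fun t _ => ?_
    rw [par_single_val B t.1]
    simp only [Subtype.ext_iff]
    rfl
  rw [Finset.sum_congr rfl fun B _ => h1 B, sum_nested]
  refine Finset.sum_congr rfl fun C _ => ?_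
  have hll : ((l : ZMod 2) : ZMod 2) = 1 := ZMod.intCast_eq_one_iff_odd.2 hl
  have h2 : ∀ (β : ∀ s : C.Roots, (C.sub s).Partition), ∑ r : (C.refine β).Roots,
      ∑ t : (C.coarse β).Roots, sgn K ((C.refine β).sexp (par (Pi.single r.1 l)) (par e)) •
        sgn K ((C.coarse β).sexp (fun r => par (Pi.single t.1.1 l : ι → ℤ) r.1)
          ((C.refine β).outp (par (Pi.single r.1 l)) (par e))) •
        (C.coarse β).glue g.toOMap (fun r' => if r'.1 = t.1.1 then α.toOMap else I) (fun r' =>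
          (if r'.1 = r.1 then α.toOMap else I).map
            ((C.refine β).sub r') ((C.refine β).restrict V x r')) =
      ∑ s₁ : C.Roots, ∑ t : (β s₁).Roots, ∑ s : C.Roots,
        sgn K (C.sexp (par (Pi.single s.1 l + Pi.single s₁.1 l)) (par e) +
          if s₁ < s then 1 else 0) •
        g.toOMap.map C.quot fun s' =>
          sgn K ((β s').sexp (fun v => par (Pi.single t.1.1 l) v.1) (fun v => par e v.1)) •
          (β s').glue (if s'.1 = s.1 then α.toOMap else I)
            (fun v => if v.1 = t.1.1 then α.toOMap else I) (C.restrict V x s') := by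
    intro β
    rw [sum_refine_roots]
    refine Finset.sum_congr rfl fun s₁ _ => Finset.sum_congr rfl fun t _ => ?_
    symm
    refine sum_equiv_of (C.coarseRoots β) fun s => ?_
    have := C.sgn_smul_glue_nested β g.toOMap (fun v => if v = s.1 then α.toOMap else I)
      (fun v => if v = t.1.1 then α.toOMap else I) (κ := par (Pi.single t.1.1 l))
      (lam := par (Pi.single s.1 l)) (μ := par (Pi.single s.1 l + Pi.single s₁.1 l)) (p := par e)
      (atMostOne_single _ _)
      (fun s' => by rw [sum_par_single_block]; simp [par]) (c := if s₁ < s then 1 else 0) (by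
        rw [Finset.sum_eq_single s, Finset.sum_eq_single (C.coarseBlock β s₁ t).1]
        · have hlow : C.low (C.coarseBlock β s₁ t).1.1 = s₁.1 := t.1.2
          rw [hlow]
          refine if_congr Iff.rfl ?_ rfl
          have : (C.coarseBlock β s₁ t).1.1 = t.1.1 := rfl
          rw [this]
          simp [par, hll]
        · intro r _ hr
          have : r.1 ≠ t.1.1 := fun h => hr (Subtype.ext h)
          simp [par, this]
        · simp
        · intro s' _ hs'
          have : s'.1 ≠ s.1 := fun h => hs' (Subtype.ext h)
          simp [par, this]
        · simp) x
    exact this.symm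
  have h3 : ∑ β : ∀ s : C.Roots, (C.sub s).Partition, ∑ s₁ : C.Roots, ∑ t : (β s₁).Roots,
      ∑ s : C.Roots, sgn K (C.sexp (par (Pi.single s.1 l + Pi.single s₁.1 l)) (par e) +
          if s₁ < s then 1 else 0) •
        g.toOMap.map C.quot (fun s' =>
          sgn K ((β s').sexp (fun v => par (Pi.single t.1.1 l) v.1) (fun v => par e v.1)) •
          (β s').glue (if s'.1 = s.1 then α.toOMap else I)
            (fun v => if v.1 = t.1.1 then α.toOMap else I) (C.restrict V x s')) =
      ∑ s₁ : C.Roots, ∑ s : C.Roots,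
        sgn K (C.sexp (par (Pi.single s.1 l + Pi.single s₁.1 l)) (par e) +
          if s₁ < s then 1 else 0) • g.toOMap.map C.quot fun s' =>
          if s' = s₁ then mixRaw (if s'.1 = s.1 then α.toOMap else I) I α.toOMap l (C.sub s')
            (fun v => par e v.1) (C.restrict V x s')
          else (if s'.1 = s.1 then α.toOMap else I).map (C.sub s') (C.restrict V x s') := by
    rw [Finset.sum_comm]
    refine Finset.sum_congr rfl fun s₁ _ => ?_
    have h4 : ∀ (β : ∀ s : C.Roots, (C.sub s).Partition), ∑ t : (β s₁).Roots,
      ∑ s : C.Roots, sgn K (C.sexp (par (Pi.single s.1 l + Pi.single s₁.1 l)) (par e) +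
          if s₁ < s then 1 else 0) •
        g.toOMap.map C.quot (fun s' =>
          sgn K ((β s').sexp (fun v => par (Pi.single t.1.1 l) v.1) (fun v => par e v.1)) •
          (β s').glue (if s'.1 = s.1 then α.toOMap else I)
            (fun v => if v.1 = t.1.1 then α.toOMap else I) (C.restrict V x s')) =
      ∑ s : C.Roots, sgn K (C.sexp (par (Pi.single s.1 l + Pi.single s₁.1 l)) (par e) +
          if s₁ < s then 1 else 0) • ∑ t : (β s₁).Roots,
        g.toOMap.map C.quot (fun s' =>
          sgn K ((β s').sexp (fun v => par (Pi.single t.1.1 l) v.1) (fun v => par e v.1)) •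
          (β s').glue (if s'.1 = s.1 then α.toOMap else I)
            (fun v => if v.1 = t.1.1 then α.toOMap else I) (C.restrict V x s')) := by
      intro β
      rw [Finset.sum_comm]
      refine Finset.sum_congr rfl fun s _ => Finset.smul_sum.symm
    rw [Finset.sum_congr rfl fun β _ => h4 β, Finset.sum_comm]
    refine Finset.sum_congr rfl fun s _ => ?_
    rw [← Finset.smul_sum, sum_map_glue_single C g.toOMap
      (fun v => if v = s.1 then α.toOMap else I)]
    congr 2
    funext s'
    by_cases hs : s' = s₁
    · rw [if_pos hs, if_pos hs]
    · rw [if_neg hs, if_neg hs, compRaw_ofEquiv_right]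
      rfl
  rw [Finset.sum_congr rfl fun β _ => h2 β, h3]
  have h5 : ∀ s₁ : C.Roots, sgn K (C.sexp (par (Pi.single s₁.1 n)) (par e)) •
      C.glue g.toOMap (fun v => if v = s₁.1 then (α.star α hn).toOMap else I) x =
      ∑ s : C.Roots, if s = s₁ then sgn K (C.sexp (par (Pi.single s₁.1 n)) (par e)) •
      C.glue g.toOMap (fun v => if v = s₁.1 then (α.star α hn).toOMap else I) x else 0 := by
    intro s₁
    rw [Finset.sum_ite_eq' Finset.univ s₁, if_pos (Finset.mem_univ _)]
  rw [Finset.sum_congr rfl fun s₁ _ => h5 s₁]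
  have hI1 : ∀ s' : C.Roots, mixRaw I I α.toOMap l (C.sub s')
            (fun v => par e v.1) (C.restrict V x s') = α.toOMap.map (C.sub s')
            (C.restrict V x s') := by
    intro s'
    have : Nonempty (C.Block s') := ⟨⟨s'.1, s'.2⟩⟩
    rw [hI, mixRaw_ofEquiv_left, EquivMap.id_ext]
  -- the terms with `α` on two different subtrees of `C` cancel in pairs, since `l` is odd; the
  -- terms with `α` twice on the same subtree give the composite `α.star α`
  refine sum_pairs_congr (fun s₁ s hlt => ?_) fun s₁ => ?_
  · rw [if_neg hlt.ne', if_neg hlt.ne, add_zero, if_pos hlt, if_neg hlt.asymm, add_zero, sgn_add,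
      sgn_one, add_comm (Pi.single s₁.1 l : ι → ℤ) (Pi.single s.1 l), mul_neg, mul_one]
    have hneg : ∀ (c : K) (y z : W.ext L), y = z → -c • y + c • z = 0 := by
      intro c y z h
      rw [h, ← add_smul, neg_add_cancel, zero_smul]
    refine hneg _ _ _ (congrArg _ ?_)
    funext s'
    by_cases h6 : s' = s₁
    · subst h6
      rw [if_pos rfl, if_neg fun h => hlt.ne (Subtype.ext h), if_neg hlt.ne, if_pos rfl, hI1]
    · rw [if_neg h6]
      by_cases h7 : s' = s
      · subst h7
        rw [if_pos rfl, if_pos rfl, if_neg fun h => h6 (Subtype.ext h), hI1]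
      · rw [if_neg h7, if_neg fun h => h7 (Subtype.ext h), if_neg fun h => h6 (Subtype.ext h)]
  · rw [if_neg (lt_irrefl _), add_zero, if_pos rfl, glue_apply]
    have h8 : par (Pi.single s₁.1 l + Pi.single s₁.1 l) = par (Pi.single s₁.1 n : ι → ℤ) := by
      rw [← Pi.single_add, hn]
    rw [h8]
    congr 2
    funext s'
    by_cases h6 : s' = s₁
    · subst h6
      rw [if_pos rfl, if_pos rfl, if_pos rfl]
      change _ = (α.star α hn).map _ _
      unfold star mix
      rw [ofParity_apply _ _ _ _ _ (C.restrict_mem hx s')]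
      rfl
    · have h7 : ¬ s'.1 = s₁.1 := fun h => h6 (Subtype.ext h)
      rw [if_neg h6, if_neg h7, if_neg h7]

end TreeMap

/-! ### The curvature and morphisms of cofree cooperads -/

namespace RTree

variable {ι L : Type} (T : RTree ι L) (u : ι)

/-- The vertex `u` has exactly one input. -/
def Unary : Prop := ∃ z₀, ∀ z, T.target z = some u ↔ z = z₀

variable {T u}

theorem Unary.eq (h : T.Unary u) {z z' : ι ⊕ L} (hz : T.target z = some u)
    (hz' : T.target z' = some u) : z = z' := by
  obtain ⟨z₀, h0⟩ := h
  rw [(h0 z).1 hz, (h0 z').1 hz']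

open scoped Classical in
/-- The tree obtained by removing a vertex `u` with exactly one input: this input becomes an input
of the parent of `u`. -/
noncomputable def del (h : T.Unary u) : RTree {i // i ≠ u} L where
  target z := (if T.target (Sum.map Subtype.val id z) = some u then T.target (Sum.inl u)
    else T.target (Sum.map Subtype.val id z)).bind
      fun w => if hw : w ≠ u then some ⟨w, hw⟩ else none
  root := by
    have hinj : Function.Injective (Sum.map (Subtype.val : {i // i ≠ u} → ι) (id : L → L)) :=
      Sum.map_injective.2 ⟨Subtype.val_injective, Function.injective_id⟩
    have hsurj : ∀ z : ι ⊕ L, z ≠ Sum.inl u →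
        ∃ y : {i // i ≠ u} ⊕ L, Sum.map Subtype.val id y = z := by
      rintro (i | l) hz
      · exact ⟨Sum.inl ⟨i, fun h => hz (congrArg _ h)⟩, rfl⟩
      · exact ⟨Sum.inr l, rfl⟩
    have key : ∀ y : {i // i ≠ u} ⊕ L,
        ((if T.target (Sum.map Subtype.val id y) = some u then T.target (Sum.inl u)
          else T.target (Sum.map Subtype.val id y)).bind
            fun w => if hw : w ≠ u then some (⟨w, hw⟩ : {i // i ≠ u}) else none) = none ↔
        (if T.target (Sum.map Subtype.val id y) = some u then T.target (Sum.inl u)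
          else T.target (Sum.map Subtype.val id y)) = none := by
      intro y
      rw [Option.bind_eq_none_iff, Option.eq_none_iff_forall_ne_some]
      refine forall_congr' fun w => ?_
      have hwu : (if T.target (Sum.map Subtype.val id y) = some u then T.target (Sum.inl u)
          else T.target (Sum.map Subtype.val id y)) = some w → w ≠ u := by
        rintro hw rfl
        split_ifs at hw with h1
        · exact T.target_ne w hw
        · exact h1 hw
      constructor
      · intro h1 h2
        have := h1 h2
        rw [dif_pos (hwu h2)] at this
        cases this
      · intro h1 h2
        exact (h1 h2).elim
    simp only [key]
    by_cases hu : T.target (Sum.inl u) = none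
    · obtain ⟨z₀, hz₀⟩ := h
      obtain ⟨y, hy⟩ := hsurj z₀ fun h => T.target_ne u ((hz₀ _).2 h.symm)
      refine ⟨y, ?_, fun y' hy' => ?_⟩
      · simp only [hy]
        rw [if_pos ((hz₀ _).2 rfl), hu]
      · simp only at hy'
        by_cases h1 : T.target (Sum.map Subtype.val id y') = some u
        · exact hinj (((hz₀ _).1 h1).trans hy.symm)
        · rw [if_neg h1] at hy'
          have := T.root.unique hu hy'
          rcases y' with y' | y'
          · exact (y'.2 (Sum.inl_injective this).symm).elim
          · exact (Sum.inl_ne_inr this).elim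
    · obtain ⟨z, hz, hz'⟩ := T.root
      obtain ⟨y, hy⟩ := hsurj z fun h => hu (h ▸ hz)
      refine ⟨y, ?_, fun y' hy' => ?_⟩
      · simp only [hy]
        rw [hz, if_neg (by simp)]
      · simp only at hy'
        by_cases h1 : T.target (Sum.map Subtype.val id y') = some u
        · rw [if_pos h1] at hy'
          exact (hu hy').elim
        · rw [if_neg h1] at hy'
          exact hinj ((hz' _ hy').trans hy.symm)
  wf := by
    refine Subrelation.wf ?_ (InvImage.wf (Subtype.val : {i // i ≠ u} → ι) T.wf.transGen)
    intro v v' hv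
    obtain ⟨w, hw, hwv⟩ := Option.bind_eq_some_iff.1 hv
    split_ifs at hw hwv with h1 h2 h2
    · have h3 : w = v.1 := congrArg Subtype.val (Option.some_inj.1 hwv)
      subst h3
      exact Relation.TransGen.tail (Relation.TransGen.single hw) h1
    · have h3 : w = v.1 := congrArg Subtype.val (Option.some_inj.1 hwv)
      subst h3
      exact Relation.TransGen.single hw

open scoped Classical in
theorem del_target_iff (h : T.Unary u) {z : {i // i ≠ u} ⊕ L} {w : {i // i ≠ u}} :
    (del h).target z = some w ↔ T.target (Sum.map Subtype.val id z) = some w.1 ∨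
      (T.target (Sum.map Subtype.val id z) = some u ∧ T.target (Sum.inl u) = some w.1) := by
  have h1 : ∀ w' : ι, (if hw : w' ≠ u then some (⟨w', hw⟩ : {i // i ≠ u}) else none) = some w ↔
      w' = w.1 := by
    intro w'
    split_ifs with h2
    · rw [Option.some_inj]
      exact Subtype.ext_iff
    · refine ⟨fun h => (by cases h), ?_⟩
      rintro rfl
      exact (w.2 (not_not.1 h2)).elim
  refine Option.bind_eq_some_iff.trans ?_
  simp only [h1]
  constructor
  · rintro ⟨w', hw, rfl⟩
    split_ifs at hw with h2
    · exact Or.inr ⟨h2, hw⟩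
    · exact Or.inl hw
  · rintro (h2 | ⟨h2, h3⟩)
    · refine ⟨_, ?_, rfl⟩
      rw [h2, if_neg fun h3 => w.2 (Option.some_inj.1 h3)]
    · refine ⟨_, ?_, rfl⟩
      rw [if_pos h2, h3]

open scoped Classical in
/-- A vertex has the same inputs after the removal of `u`, except that `u` is replaced by its
input. -/
noncomputable def delIn (h : T.Unary u) (w : {i // i ≠ u}) : (del h).In w ≃ T.In w.1 :=
  Equiv.ofBijective (fun z => if hz : T.target (Sum.map Subtype.val id z.1) = some w.1
      then ⟨_, hz⟩
      else ⟨Sum.inl u, (((del_target_iff h).1 z.2).resolve_left hz).2⟩) (by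
    have hinj : Function.Injective (Sum.map (Subtype.val : {i // i ≠ u} → ι) (id : L → L)) :=
      Sum.map_injective.2 ⟨Subtype.val_injective, Function.injective_id⟩
    have hne : ∀ y : {i // i ≠ u} ⊕ L, Sum.map Subtype.val id y ≠ (Sum.inl u : ι ⊕ L) := by
      rintro (y | y) hy
      · exact y.2 (Sum.inl_injective hy)
      · exact Sum.inr_ne_inl hy
    constructor
    · rintro ⟨z, hz⟩ ⟨z', hz'⟩ hzz
      refine Subtype.ext (hinj ?_)
      simp only at hzz
      split_ifs at hzz with h1 h2 h2
      · exact congrArg Subtype.val hzz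
      · exact (hne _ (congrArg Subtype.val hzz)).elim
      · exact (hne _ (congrArg Subtype.val hzz).symm).elim
      · exact h.eq (((del_target_iff h).1 hz).resolve_left h1).1
          (((del_target_iff h).1 hz').resolve_left h2).1
    · rintro ⟨z, hz⟩
      by_cases hzu : z = Sum.inl u
      · subst hzu
        obtain ⟨z₀, hz₀⟩ := id h
        have h0 := (hz₀ _).2 rfl
        have : ∃ y : {i // i ≠ u} ⊕ L, Sum.map Subtype.val id y = z₀ := by
          rcases z₀ with i | l
          · refine ⟨Sum.inl ⟨i, ?_⟩, rfl⟩
            rintro rfl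
            exact T.target_ne _ h0
          · exact ⟨Sum.inr l, rfl⟩
        obtain ⟨y, rfl⟩ := this
        refine ⟨⟨y, (del_target_iff h).2 (Or.inr ⟨h0, hz⟩)⟩, dif_neg fun h1 => ?_⟩
        simp only at h1
        rw [h0] at h1
        exact w.2 (Option.some_inj.1 h1).symm
      · have : ∃ y : {i // i ≠ u} ⊕ L, Sum.map Subtype.val id y = z := by
          rcases z with i | l
          · exact ⟨Sum.inl ⟨i, fun h => hzu (congrArg _ h)⟩, rfl⟩
          · exact ⟨Sum.inr l, rfl⟩
        obtain ⟨y, rfl⟩ := this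
        exact ⟨⟨y, (del_target_iff h).2 (Or.inl hz)⟩, dif_pos hz⟩)

theorem delIn_of_target (h : T.Unary u) {w : {i // i ≠ u}} (z : (del h).In w)
    (hz : T.target (Sum.map Subtype.val id z.1) = some w.1) :
    (delIn h w z).1 = Sum.map Subtype.val id z.1 :=
  congrArg Subtype.val (dif_pos hz)

theorem delIn_of_not_target (h : T.Unary u) {w : {i // i ≠ u}} (z : (del h).In w)
    (hz : T.target (Sum.map Subtype.val id z.1) ≠ some w.1) : (delIn h w z).1 = Sum.inl u :=
  congrArg Subtype.val (dif_neg hz)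

/-- The labels of the remaining vertices after the removal of `u`. -/
noncomputable def delLabel (h : T.Unary u) (V : GrSMod.{w, u} K) (x : ∀ v, V.ext (T.In v))
    (w : {i // i ≠ u}) : V.ext ((del h).In w) :=
  V.reindex (delIn h w).symm (x w.1)

theorem delLabel_mem (h : T.Unary u) {V : GrSMod.{w, u} K} {x : ∀ v, V.ext (T.In v)} {e : ι → ℤ}
    (hx : ∀ v, x v ∈ V.extGr _ (e v)) (w : {i // i ≠ u}) :
    delLabel h V x w ∈ V.extGr _ (e w.1) := GrSMod.reindex_mem _ (hx w.1)

namespace Partition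

section Isolate

variable {B : T.Partition} {r : B.Roots} (hB : ∀ i, B.low i = r.1 ↔ i ≠ u)
include hB

theorem low_of_isolate : B.low u = u := by
  by_contra h
  have h1 := (hB (B.low u)).2 h
  rw [B.idem] at h1
  exact (hB u).1 h1 rfl

/-- If the complement of `u` is a subtree, then `u` does not have both a child and a parent. -/
theorem parent_of_isolate {i w : ι} (hi : T.target (Sum.inl i) = some u)
    (hu : T.target (Sum.inl u) = some w) : False := by
  have hiu : i ≠ u := by
    rintro rfl
    exact T.target_ne _ hi
  have hwu : w ≠ u := by
    rintro rfl
    exact T.target_ne _ hu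
  have hir : i = r.1 := by
    rcases B.cond i with h | ⟨w', hw', h⟩
    · rw [← h, (hB i).2 hiu]
    · rw [hi] at hw'
      cases hw'
      rw [(hB i).2 hiu] at h
      exact ((hB u).1 h.symm rfl).elim
  have h1 : B.quot.target (Sum.inl r) = some ⟨u, low_of_isolate hB⟩ :=
    B.quot_target_iff.2 ⟨u, (congrArg (fun i => T.target (Sum.inl i)) hir.symm).trans hi,
      low_of_isolate hB⟩
  have h2 : B.quot.target (Sum.inl ⟨u, low_of_isolate hB⟩) = some r :=
    B.quot_target_iff.2 ⟨w, hu, (hB w).2 hwu⟩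
  exact B.quot.wf.asymmetric _ _ h1 h2

theorem exists_target_of_isolate {l : L} (h : T.Unary u) (hl : T.target (Sum.inr l) = some u) :
    ∃ w, T.target (Sum.inl u) = some w := by
  by_contra! hu
  replace hu := Option.eq_none_iff_forall_ne_some.2 hu
  obtain ⟨i, hi, hmin⟩ := T.wf.has_min {i | i ≠ u} ⟨r.1, (hB r.1).1 r.2⟩
  rcases hit : T.target (Sum.inl i) with _ | w
  · exact hi (Sum.inl_injective (T.root.unique hit hu))
  · by_cases hw : w = u
    · subst hw
      exact Sum.inl_ne_inr (h.eq hit hl)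
    · exact hmin w hw hit

open scoped Classical in
/-- The leaves of the tree without `u` are the inputs of the subtree that consists of the other
vertices. -/
noncomputable def isolateIn (h : T.Unary u) : L ≃ B.quot.In r :=
  Equiv.ofBijective (fun l => if hl : T.target (Sum.inr l) = some u
      then ⟨Sum.inl ⟨u, low_of_isolate hB⟩, by
        obtain ⟨w, hw⟩ := exists_target_of_isolate hB h hl
        refine B.quot_target_iff.2 ⟨w, hw, (hB w).2 ?_⟩
        rintro rfl
        exact T.target_ne _ hw⟩
      else ⟨Sum.inr l, by
        have : ∃ w, T.target (Sum.inr l) = some w := by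
          by_contra! hw
          replace hw := Option.eq_none_iff_forall_ne_some.2 hw
          obtain ⟨v, hv⟩ := @exists_root_vertex _ _ ⟨u⟩ T
          exact Sum.inr_ne_inl (T.root.unique hw hv)
        obtain ⟨w, hw⟩ := this
        refine B.quot_target_iff.2 ⟨w, hw, (hB w).2 ?_⟩
        rintro rfl
        exact hl hw⟩) (by
    constructor
    · intro l l' hll
      simp only at hll
      split_ifs at hll with h1 h2 h2
      · exact Sum.inr_injective (h.eq h1 h2)
      · exact (Sum.inl_ne_inr (congrArg Subtype.val hll)).elim
      · exact (Sum.inr_ne_inl (congrArg Subtype.val hll)).elim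
      · exact Sum.inr_injective (congrArg Subtype.val hll)
    · rintro ⟨s | l, hz⟩
      · have hs : s.1 = u := by
          by_contra hsu
          have : s = r := Subtype.ext (s.2.symm.trans ((hB s.1).2 hsu))
          subst this
          exact B.quot.target_ne _ hz
        obtain ⟨w, hw, -⟩ := B.quot_target_iff.1 hz
        have hw : T.target (Sum.inl s.1) = some w := hw
        rw [hs] at hw
        obtain ⟨i | l, hz₀⟩ := id h
        · exact (parent_of_isolate hB ((hz₀ _).2 rfl) hw).elim
        · refine ⟨l, (dif_pos ((hz₀ _).2 rfl)).trans ?_⟩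
          exact Subtype.ext (congrArg Sum.inl (Subtype.ext hs.symm))
      · refine ⟨l, dif_neg fun hl => ?_⟩
        obtain ⟨w, hw, hwr⟩ := B.quot_target_iff.1 hz
        rw [show T.target (Sum.map Subtype.val id (Sum.inr l)) = some u from hl] at hw
        cases hw
        exact (hB u).1 hwr rfl)

theorem isolateIn_of_target (h : T.Unary u) {l : L} (hl : T.target (Sum.inr l) = some u) :
    (isolateIn hB h l).1 = Sum.inl ⟨u, low_of_isolate hB⟩ :=
  congrArg Subtype.val (dif_pos hl)

theorem isolateIn_of_not_target (h : T.Unary u) {l : L} (hl : T.target (Sum.inr l) ≠ some u) :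
    (isolateIn hB h l).1 = Sum.inr l :=
  congrArg Subtype.val (dif_neg hl)

theorem isolate_isIso (h : T.Unary u) :
    (B.sub r).IsIso (del h) (Equiv.subtypeEquivRight hB) (isolateIn hB h).symm := by
  refine isIso_of_iff fun z v => ?_
  rw [sub_target_iff, del_target_iff]
  change _ ↔ _ = some v.1 ∨ _ ∧ _ = some v.1
  have hv : v.1 ≠ u := (hB v.1).1 v.2
  rcases z with i | z
  · change T.target (Sum.inl i.1) = _ ↔ T.target (Sum.inl i.1) = _ ∨ _ ∧ _
    refine (or_iff_left ?_).symm
    rintro ⟨h1, h2⟩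
    exact parent_of_isolate hB h1 h2
  · obtain ⟨l, rfl⟩ := (isolateIn hB h).surjective z
    change T.target (Sum.map Subtype.val id (isolateIn hB h l).1) = _ ↔
      T.target (Sum.inr ((isolateIn hB h).symm _)) = _ ∨
        T.target (Sum.inr ((isolateIn hB h).symm _)) = _ ∧ _
    rw [Equiv.symm_apply_apply]
    by_cases hl : T.target (Sum.inr l) = some u
    · rw [isolateIn_of_target hB h hl, hl]
      change T.target (Sum.inl u) = _ ↔ _
      constructor
      · exact fun h => Or.inr ⟨rfl, h⟩
      · rintro (h | h)
        · exact (hv (Option.some_inj.1 h).symm).elim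
        · exact h.2
    · rw [isolateIn_of_not_target hB h hl]
      exact (or_iff_left fun h => hl h.1).symm

theorem isolate_in (h : T.Unary u) (v : B.Block r) (z : (B.sub r).In v) :
    delIn h (Equiv.subtypeEquivRight hB v) ((isolate_isIso hB h).inEquiv v z) =
      B.inEquiv r v z := by
  refine Subtype.ext ?_
  have hv : v.1 ≠ u := (hB v.1).1 v.2
  have hz := sub_target_iff _ |>.1 z.2
  have e1 : (B.inEquiv r v z).1 = B.incl r z.1 := rfl
  have e2 : ((isolate_isIso hB h).inEquiv v z).1 =
    Equiv.sumCongr (Equiv.subtypeEquivRight hB) (isolateIn hB h).symm z.1 := rfl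
  rw [e1]
  obtain ⟨i | z, hz1⟩ := z
  · exact delIn_of_target h _ hz
  · obtain ⟨l, rfl⟩ := (isolateIn hB h).surjective z
    have e3 : ((isolate_isIso hB h).inEquiv v ⟨Sum.inr (isolateIn hB h l), hz1⟩).1 =
        Sum.inr l := congrArg Sum.inr (Equiv.symm_apply_apply _ _)
    by_cases hl : T.target (Sum.inr l) = some u
    · rw [delIn_of_not_target]
      · exact (congrArg (Sum.map Subtype.val id) (isolateIn_of_target hB h hl)).symm
      · rw [e3]
        change T.target (Sum.inr l) ≠ _
        rw [hl]
        exact fun h => hv (Option.some_inj.1 h).symm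
    · have e4 : B.incl r (Sum.inr (isolateIn hB h l)) = Sum.inr l :=
        congrArg (Sum.map Subtype.val id) (isolateIn_of_not_target hB h hl)
      rw [delIn_of_target]
      · rw [e3, e4]
        rfl
      · rw [e3]
        change T.target (B.incl r (Sum.inr (isolateIn hB h l))) = _ at hz
        rw [e4] at hz
        exact hz

/-- If the complement of the vertex `u` with one input is a subtree, then the value of `f` on it is
the value on the tree without `u`. -/
theorem map_isolate [Fintype ι] [LinearOrder ι] [Finite L] {V : GrSMod.{w, u} K}
    {W : GrSMod.{w, u'} K} (f : OMap V W) (h : T.Unary u) (x : ∀ v, V.ext (T.In v)) :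
    B.quot.transfer W r (f.map (B.sub r) (B.restrict V x r)) =
      f.map (del h) (delLabel h V x) := by
  rw [transfer_eq W (g := (isolateIn hB h).symm)]
  · refine (f.nat _ _ _ _ (isolate_isIso hB h) (fun _ _ h => h) _ _ fun v => ?_).symm
    unfold restrict delLabel
    rw [GrSMod.reindex_reindex]
    exact congrArg (fun g => V.reindex g (x v.1))
      (trans_symm_eq (delIn h (Equiv.subtypeEquivRight hB v)) (Equiv.refl _) _ _
        fun z => isolate_in hB h v z)
  · rintro ⟨s | l, hz⟩ ⟨s' | l', hz'⟩ h1 h2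
    · have aux : ∀ s : B.Roots, B.quot.target (Sum.inl s) = some r → s.1 = u := by
        intro s hz
        by_contra hsu
        have : s = r := Subtype.ext (s.2.symm.trans ((hB s.1).2 hsu))
        subst this
        exact B.quot.target_ne _ hz
      exact Subtype.ext (congrArg Sum.inl (Subtype.ext ((aux s hz).trans (aux s' hz').symm)))
    · simp at h2
    · simp at h1
    · simp at h1
  · rintro z l hz
    rw [Equiv.symm_apply_eq]
    refine Subtype.ext ?_
    rw [isolateIn_of_not_target, hz]
    intro hl
    obtain ⟨w, hw, hwr⟩ := B.quot_target_iff.1 z.2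
    rw [hz, show T.target (Sum.map Subtype.val id (Sum.inr l)) = some u from hl] at hw
    cases hw
    exact (hB u).1 hwr rfl

end Isolate

end Partition

end RTree

namespace RTree.Partition

variable {ι L : Type} {T : RTree ι L}

/-! ### Partitions that join a vertex to its parent -/

/-- The only subtree with more than one vertex consists of the vertex `v` and its parent `p`. -/
structure IsJoin (C : T.Partition) (v p : ι) : Prop where
  target : T.target (Sum.inl v) = some p
  low_self : C.low v = p
  low_of_ne : ∀ i, i ≠ v → C.low i = i

open scoped Classical in
/-- The partition that joins the vertex `v` to its parent. -/
noncomputable def join {v p : ι} (h : T.target (Sum.inl v) = some p) : T.Partition where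
  low i := if i = v then p else i
  cond i := by
    by_cases hi : i = v
    · subst hi
      refine Or.inr ⟨p, h, ?_⟩
      rw [if_pos rfl, if_neg]
      rintro rfl
      exact T.target_ne _ h
    · exact Or.inl (if_neg hi)

theorem isJoin_join {v p : ι} (h : T.target (Sum.inl v) = some p) : (join h).IsJoin v p :=
  ⟨h, if_pos rfl, fun _ hi => if_neg hi⟩

theorem IsJoin.unique {C C' : T.Partition} {v p : ι} (h : C.IsJoin v p) (h' : C'.IsJoin v p) :
    C = C' := by
  refine ext_low fun i => ?_
  by_cases hi : i = v
  · rw [hi, h.low_self, h'.low_self]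
  · rw [h.low_of_ne i hi, h'.low_of_ne i hi]

theorem IsJoin.ne {C : T.Partition} {v p : ι} (h : C.IsJoin v p) : p ≠ v := by
  rintro rfl
  exact T.target_ne _ h.target

variable {C : T.Partition} {u c : ι}

/-- The vertices other than `u` are the vertices of the quotient by a partition that joins `u` to
a neighbour. -/
noncomputable def joinEquiv (hC : C.IsJoin u c ∨ C.IsJoin c u) : {i // i ≠ u} ≃ C.Roots :=
  Equiv.ofBijective (fun i => C.root i.1) (by
    rcases hC with hC | hC
    · constructor
      · intro i j hij
        have := congrArg Subtype.val hij
        change C.low i.1 = C.low j.1 at this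
        rw [hC.low_of_ne _ i.2, hC.low_of_ne _ j.2] at this
        exact Subtype.ext this
      · intro s
        refine ⟨⟨s.1, ?_⟩, Subtype.ext s.2⟩
        intro hs
        have := s.2
        rw [hs, hC.low_self] at this
        exact hC.ne this
    · constructor
      · intro i j hij
        have hij := congrArg Subtype.val hij
        change C.low i.1 = C.low j.1 at hij
        by_cases hi : i.1 = c <;> by_cases hj : j.1 = c
        · exact Subtype.ext (hi.trans hj.symm)
        · rw [hi, hC.low_self, hC.low_of_ne _ hj] at hij
          exact (j.2 hij.symm).elim
        · rw [hj, hC.low_self, hC.low_of_ne _ hi] at hij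
          exact (i.2 hij).elim
        · rw [hC.low_of_ne _ hi, hC.low_of_ne _ hj] at hij
          exact Subtype.ext hij
      · intro s
        by_cases hs : s.1 = u
        · exact ⟨⟨c, hC.ne.symm⟩, Subtype.ext (hC.low_self.trans hs.symm)⟩
        · exact ⟨⟨s.1, hs⟩, Subtype.ext s.2⟩)

theorem joinEquiv_val (hC : C.IsJoin u c ∨ C.IsJoin c u) (i : {i // i ≠ u}) :
    (joinEquiv hC i).1 = C.low i.1 := rfl

/-- Joining `u` to a neighbour amounts to removing it. -/
theorem join_isIso (hC : C.IsJoin u c ∨ C.IsJoin c u) (h : T.Unary u) :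
    (del h).IsIso C.quot (joinEquiv hC) (Equiv.refl L) := by
  refine isIso_of_iff fun z w => ?_
  rw [quot_target_iff, del_target_iff, joinEquiv_val]
  rcases hC with hC | hC
  · have hz : Sum.map Subtype.val id
        (Equiv.sumCongr (joinEquiv (Or.inl hC)) (Equiv.refl L) z) = Sum.map Subtype.val id z := by
      rcases z with i | l
      · exact congrArg Sum.inl (hC.low_of_ne _ i.2)
      · rfl
    rw [hz, hC.low_of_ne _ w.2]
    constructor
    · rintro (h1 | ⟨h1, h2⟩)
      · exact ⟨_, h1, hC.low_of_ne _ w.2⟩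
      · rw [hC.target] at h2
        exact ⟨_, h1, hC.low_self.trans (Option.some_inj.1 h2)⟩
    · rintro ⟨j, h1, h2⟩
      by_cases hj : j = u
      · subst hj
        refine Or.inr ⟨h1, ?_⟩
        rw [hC.target, ← h2, hC.low_self]
      · rw [hC.low_of_ne _ hj] at h2
        exact Or.inl (h2 ▸ h1)
  · have hlow : ∀ j, C.low j = C.low w.1 → j ≠ u → j = w.1 := by
      intro j hj hju
      have : joinEquiv (Or.inr hC) ⟨j, hju⟩ = joinEquiv (Or.inr hC) w := Subtype.ext hj
      exact congrArg Subtype.val ((joinEquiv (Or.inr hC)).injective this)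
    by_cases hzc : Sum.map Subtype.val id z = Sum.inl c
    · have hz : Sum.map Subtype.val id
          (Equiv.sumCongr (joinEquiv (Or.inr hC)) (Equiv.refl L) z) = Sum.inl u := by
        rcases z with i | l
        · exact congrArg Sum.inl ((congrArg C.low (Sum.inl_injective hzc)).trans hC.low_self)
        · exact (Sum.inr_ne_inl hzc).elim
      rw [hz, hzc, hC.target]
      constructor
      · rintro (h1 | ⟨-, h2⟩)
        · exact (w.2 (Option.some_inj.1 h1).symm).elim
        · exact ⟨_, h2, rfl⟩
      · rintro ⟨j, h1, h2⟩
        rw [← hlow j h2]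
        · exact Or.inr ⟨rfl, h1⟩
        · rintro rfl
          exact T.target_ne _ h1
    · have hz : Sum.map Subtype.val id (Equiv.sumCongr (joinEquiv (Or.inr hC)) (Equiv.refl L) z) =
          Sum.map Subtype.val id z := by
        rcases z with i | l
        · exact congrArg Sum.inl (hC.low_of_ne _ fun hi => hzc (congrArg Sum.inl hi))
        · rfl
      have hzu : T.target (Sum.map Subtype.val id z) ≠ some u := fun h1 =>
        hzc (h.eq h1 hC.target)
      rw [hz]
      constructor
      · rintro (h1 | ⟨h1, -⟩)
        · exact ⟨_, h1, rfl⟩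
        · exact (hzu h1).elim
      · rintro ⟨j, h1, h2⟩
        rw [← hlow j h2]
        · exact Or.inl h1
        · rintro rfl
          exact hzu h1

/-- Each label of the tree without `u` corresponds, under the isomorphism `join_isIso`, to a label
of `T` transferred to the subtree that contains it. -/
theorem join_transfer (hC : C.IsJoin u c ∨ C.IsJoin c u) (h : T.Unary u) (V : GrSMod.{w, u} K)
    (x : ∀ v, V.ext (T.In v)) (i : {i // i ≠ u}) :
    (C.sub (joinEquiv hC i)).transfer V ⟨i.1, rfl⟩
      (C.restrict V x (joinEquiv hC i) ⟨i.1, rfl⟩) =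
      V.reindex ((join_isIso hC h).inEquiv i) (delLabel h V x i) := by
  have hinj : ∀ j j' : ι, j ≠ u → j' ≠ u → C.low j = C.low j' → j = j' := by
    intro j j' hj hj' h1
    have : joinEquiv hC ⟨j, hj⟩ = joinEquiv hC ⟨j', hj'⟩ := Subtype.ext h1
    exact congrArg Subtype.val ((joinEquiv hC).injective this)
  rw [transfer_eq V (g := (C.inEquiv (joinEquiv hC i) ⟨i.1, rfl⟩).trans
    ((delIn h i).symm.trans ((join_isIso hC h).inEquiv i)))]
  · unfold restrict delLabel
    rw [GrSMod.reindex_reindex, GrSMod.reindex_reindex]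
    rw [← Equiv.trans_assoc, Equiv.symm_trans_self, Equiv.refl_trans]
  · rintro ⟨j | y, hz⟩ ⟨j' | y', hz'⟩ h1 h2
    · have aux : ∀ j : C.Block (joinEquiv hC i),
          (C.sub (joinEquiv hC i)).target (Sum.inl j) = some ⟨i.1, rfl⟩ → j.1 = u := by
        intro j hj
        by_contra hju
        have h3 := hinj _ _ hju i.2 j.2
        have h4 := (C.sub_target_iff).1 hj
        have h4 : T.target (Sum.inl j.1) = some i.1 := h4
        rw [h3] at h4
        exact T.target_ne _ h4
      exact Subtype.ext (congrArg Sum.inl (Subtype.ext ((aux j hz).trans (aux j' hz').symm)))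
    · simp at h2
    · simp at h1
    · simp at h1
  · rintro ⟨z, hz0⟩ y rfl
    have hz := (C.sub_target_iff).1 hz0
    set z' := C.inEquiv (joinEquiv hC i) ⟨i.1, rfl⟩ ⟨Sum.inr y, hz0⟩ with hz'
    have hzv : z'.1 = Sum.map Subtype.val id y.1 := rfl
    change T.target (Sum.map Subtype.val id y.1) = some i.1 at hz
    rw [Equiv.trans_apply, Equiv.trans_apply]
    obtain ⟨q, hq⟩ := (delIn h i).surjective z'
    have hs : (delIn h i).symm z' = q := (Equiv.symm_apply_eq _).2 hq.symm
    refine (congrArg ((join_isIso hC h).inEquiv i) hs).trans (Subtype.ext ?_)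
    change Equiv.sumCongr (joinEquiv hC) (Equiv.refl L) q.1 = y.1
    -- the input `q` of `i` after the removal of `u` is determined by its image among the inputs
    -- of `i` in the whole tree
    suffices hmain : ∀ q' : {i // i ≠ u} ⊕ L,
        Equiv.sumCongr (joinEquiv hC) (Equiv.refl L) q' = y.1 → q.1 = q' by
      obtain ⟨q', hq'⟩ := (Equiv.sumCongr (joinEquiv hC) (Equiv.refl L)).surjective y.1
      rw [hmain q' hq', hq']
    intro q' hq'
    have hdel : (del h).target q' = some i := by
      rw [← (join_isIso hC h).target_iff, hq']
      exact y.2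
    suffices h5 : delIn h i ⟨q', hdel⟩ = z' by
      have := (delIn h i).injective (hq.trans h5.symm)
      rw [this]
    refine Subtype.ext ?_
    rw [hzv]
    rcases q' with j | l
    · have hy : y.1 = Sum.inl (joinEquiv hC j) := hq'.symm
      by_cases hj : C.low j.1 = j.1
      · have h6 : Sum.map Subtype.val id y.1 = (Sum.inl j.1 : ι ⊕ L) := by
          rw [hy]
          exact congrArg Sum.inl hj
        rw [h6] at hz ⊢
        exact delIn_of_target h _ hz
      · have h7 : C.low j.1 = u := by
          by_contra h8
          exact hj (hinj _ _ h8 j.2 (C.idem _))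
        have h6 : Sum.map Subtype.val id y.1 = (Sum.inl u : ι ⊕ L) := by
          rw [hy]
          exact congrArg Sum.inl h7
        rw [h6]
        refine delIn_of_not_target h _ fun h9 => ?_
        change T.target (Sum.inl j.1) = some i.1 at h9
        rcases C.cond j.1 with h10 | ⟨w, hw, h10⟩
        · exact hj h10
        · rw [h9] at hw
          cases hw
          rw [hinj _ _ j.2 i.2 h10] at h9
          exact T.target_ne _ h9
    · have h6 : Sum.map Subtype.val id y.1 = (Sum.inr l : ι ⊕ L) := by
        rw [← hq']
        rfl
      rw [h6] at hz ⊢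
      exact delIn_of_target h _ hz

variable [Fintype ι] [LinearOrder ι] [Finite L] {V : GrSMod.{w, u} K} {W : GrSMod.{w, u'} K}

/-- The value of `f` on the quotient that joins `u` to a neighbour is the value on the tree without
`u`. No sign appears if the label of `u` has even degree. -/
theorem map_join {k : ℤ} (hC : C.IsJoin u c ∨ C.IsJoin c u) (h : T.Unary u) (f : TreeMap V W k)
    {x : ∀ v, V.ext (T.In v)} {e : ι → ℤ} (hx : ∀ v, x v ∈ V.extGr _ (e v))
    (hu : par e u = 0) (y : ∀ s, V.ext (C.quot.In s))
    (hy : ∀ i : {i // i ≠ u}, y (joinEquiv hC i) = (C.sub (joinEquiv hC i)).transfer V ⟨i.1, rfl⟩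
      (C.restrict V x (joinEquiv hC i) ⟨i.1, rfl⟩)) :
    sgn K (kz C.low (par e)) • f.map C.quot y = f.map (del h) (delLabel h V x) := by
  have h1 := f.isGr.natural _ _ _ _ (join_isIso hC h) _ _ y (delLabel_mem h hx) fun i =>
    (hy i).trans (join_transfer hC h V x i)
  have h2 : kz (joinEquiv hC) (par fun i : {i // i ≠ u} => e i.1) = kz C.low (par e) := by
    unfold kz
    have aux : ∀ F : ι → ZMod 2, F u = 0 → ∑ i, F i = ∑ i : {i // i ≠ u}, F i.1 := by
      intro F hF
      exact (Finset.sum_erase _ hF).symm.trans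
        (Finset.sum_subtype (Finset.univ.erase u) (p := fun i => i ≠ u) (by simp) F)
    rw [aux (fun i => ∑ j, if i < j ∧ C.low j < C.low i then par e i * par e j else 0)
      (by simp [hu])]
    refine Finset.sum_congr rfl fun i _ => ?_
    rw [aux (fun j => if i.1 < j ∧ C.low j < C.low i.1 then par e i.1 * par e j else 0)
      (by simp [hu])]
    rfl
  rw [h2] at h1
  change sgn K (kz C.low (par e)) • f.toOMap.map C.quot y = _
  rw [h1, smul_smul, sgn_mul_self, one_smul]
  rfl

end RTree.Partition

/-! ### The curvature commutes with morphisms of cofree cooperads -/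

namespace DGSMod

variable (P : DGSMod.{w, u} K)

theorem theta_eq {X : Type} (e : X ≃ Fin 1) (φ : P.cogen.ext X) :
    P.theta X φ = (φ.1 1 e).2 ⟨rfl⟩ := by
  unfold theta
  have h : Nonempty (X ≃ Fin 1) := ⟨e⟩
  rw [dif_pos h, Subsingleton.elim h.some e]

theorem theta_of_isEmpty {X : Type} (h : ¬ Nonempty (X ≃ Fin 1)) (φ : P.cogen.ext X) :
    P.theta X φ = 0 := dif_neg h

/-- The curvature is linear. -/
noncomputable def thetaLin (X : Type) : P.cogen.ext X →ₗ[K] K where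
  toFun := P.theta X
  map_add' a b := by
    by_cases h : Nonempty (X ≃ Fin 1)
    · rw [P.theta_eq h.some, P.theta_eq h.some, P.theta_eq h.some]
      rfl
    · rw [P.theta_of_isEmpty h, P.theta_of_isEmpty h, P.theta_of_isEmpty h, add_zero]
  map_smul' c a := by
    by_cases h : Nonempty (X ≃ Fin 1)
    · rw [P.theta_eq h.some, P.theta_eq h.some]
      rfl
    · rw [P.theta_of_isEmpty h, P.theta_of_isEmpty h, smul_zero]

theorem thetaLin_apply {X : Type} (φ : P.cogen.ext X) : P.thetaLin X φ = P.theta X φ := rfl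

theorem theta_zero {X : Type} : P.theta X 0 = 0 := (P.thetaLin X).map_zero

theorem theta_reindex {X Y : Type} (g : X ≃ Y) (φ : P.cogen.ext X) :
    P.theta Y (P.cogen.reindex g φ) = P.theta X φ := by
  by_cases h : Nonempty (Y ≃ Fin 1)
  · rw [P.theta_eq h.some, P.theta_eq (g.trans h.some)]
    rfl
  · rw [P.theta_of_isEmpty h, P.theta_of_isEmpty fun h' => h ⟨g.symm.trans h'.some⟩]

theorem theta_of_mem {X : Type} {k : ℤ} (hk : k ≠ 2) {φ : P.cogen.ext X}
    (hφ : φ ∈ P.cogen.extGr X k) : P.theta X φ = 0 := by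
  by_cases h : Nonempty (X ≃ Fin 1)
  · rw [P.theta_eq h.some]
    have := (hφ 1 h.some).2
    change _ ∈ (if k = 2 then ⊤ else ⊥ : Submodule K _) at this
    rw [if_neg hk, Submodule.mem_bot] at this
    rw [this]
    rfl
  · exact P.theta_of_isEmpty h φ

variable {ι L : Type}

theorem unary_of_theta_ne_zero {T : RTree ι L} {u : ι} {y : P.cogen.ext (T.In u)}
    (hy : P.theta _ y ≠ 0) : T.Unary u := by
  have h : Nonempty (T.In u ≃ Fin 1) := by
    by_contra h
    exact hy (P.theta_of_isEmpty h y)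
  refine ⟨(h.some.symm 0).1, fun z => ⟨fun hz => ?_, ?_⟩⟩
  · have : h.some ⟨z, hz⟩ = 0 := Subsingleton.elim _ _
    rw [← this, Equiv.symm_apply_apply]
  · rintro rfl
    exact (h.some.symm 0).2

theorem theta_proj_of_unique [Fintype ι] [LinearOrder ι] [Finite L] (T : RTree ι L)
    (x : ∀ v, P.cogen.ext (T.In v)) {v : ι} (hv : ∀ w, w = v) :
    P.theta L (T.proj P.cogen x) = P.theta _ (x v) := by
  rw [TreeMap.proj_eq, TreeMap.ofEquiv_of_unique _ _ _ hv, EquivMap.id_ext,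
    RTree.transfer_of_unique hv, theta_reindex]

/-- The part of the curvature where `θ` is applied to the label of `u`. -/
noncomputable def curvTerm [Fintype ι] [LinearOrder ι] (T : RTree ι L)
    (x : ∀ v, P.cogen.ext (T.In v)) (u : ι) : P.cogen.ext L :=
  if Fintype.card ι = 2 then
    ∑ c, if u = c then 0 else
      (if T.target (Sum.inl u) = none then P.theta _ (x u) else -P.theta _ (x u)) •
        T.transfer P.cogen c (x c)
  else 0

theorem curvature_eq_sum [Fintype ι] [LinearOrder ι] (T : RTree ι L)
    (x : ∀ v, P.cogen.ext (T.In v)) : P.curvature T x = ∑ u, P.curvTerm T x u := by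
  unfold curvature curvTerm
  split_ifs
  · rfl
  · simp

theorem curvTerm_ne_zero [Fintype ι] [LinearOrder ι] {T : RTree ι L}
    {x : ∀ v, P.cogen.ext (T.In v)} {u : ι} (h : P.curvTerm T x u ≠ 0) :
    P.theta _ (x u) ≠ 0 ∧ ∃ c, c ≠ u ∧ ∀ i, i ≠ u → i = c := by
  unfold curvTerm at h
  by_cases hc : Fintype.card ι = 2
  · rw [if_pos hc] at h
    have hθ : P.theta _ (x u) ≠ 0 := by
      intro h0
      refine h (Finset.sum_eq_zero fun c _ => ?_)
      simp [h0]
    refine ⟨hθ, ?_⟩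
    obtain ⟨a, b, hab, huniv⟩ := Finset.card_eq_two.1 hc
    have hmem : ∀ i, i = a ∨ i = b := fun i => by
      have := Finset.mem_univ i
      rw [huniv] at this
      simpa using this
    rcases hmem u with rfl | rfl
    · exact ⟨b, hab.symm, fun i hi => (hmem i).resolve_left hi⟩
    · exact ⟨a, hab, fun i hi => (hmem i).resolve_right hi⟩
  · exact (h (if_neg hc)).elim

theorem curvTerm_eq [Fintype ι] [LinearOrder ι] {T : RTree ι L}
    {x : ∀ v, P.cogen.ext (T.In v)} {u c : ι} (hcu : c ≠ u) (hc : ∀ i, i ≠ u → i = c) :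
    P.curvTerm T x u =
      (if T.target (Sum.inl u) = none then P.theta _ (x u) else -P.theta _ (x u)) •
        T.transfer P.cogen c (x c) := by
  have hcard : Fintype.card ι = 2 := by
    refine Finset.card_eq_two.2 ⟨u, c, hcu.symm, ?_⟩
    ext i
    by_cases hi : i = u
    · simp [hi]
    · simp [hc i hi]
  unfold curvTerm
  rw [if_pos hcard, Finset.sum_eq_single c]
  · rw [if_neg hcu.symm]
  · intro i _ hi
    by_cases hiu : u = i
    · rw [if_pos hiu]
    · exact (hi (hc i (Ne.symm hiu))).elim
  · simp

end DGSMod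

namespace RTree.Partition

open DGSMod

variable {ι L : Type} [Fintype ι] [LinearOrder ι] [Finite L] {T : RTree ι L}
  {P : DGSMod.{w, u} K} {Q : DGSMod.{w, u'} K}

open scoped Classical in
/-- The value of a map `f` on the tree without the vertex `u`, times `θ` of the label of `u`. It
is zero unless `u` has exactly one input. -/
noncomputable def delTerm (f : TreeMap P.cogen Q.cogen 0) (T : RTree ι L)
    (x : ∀ v, P.cogen.ext (T.In v)) (u : ι) : Q.cogen.ext L :=
  if h : T.Unary u then P.theta _ (x u) • f.map (del h) (delLabel h P.cogen x) else 0

variable {f : TreeMap P.cogen Q.cogen 0} {x : ∀ v, P.cogen.ext (T.In v)} {e : ι → ℤ} {u : ι}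

section Left

/-- The contribution of the vertex `u` and of the partition `B` to the composite of the curvature
with a morphism. -/
noncomputable def leftTerm (f : TreeMap P.cogen Q.cogen 0) (x : ∀ v, P.cogen.ext (T.In v))
    (e : ι → ℤ) (u : ι) (B : T.Partition) : Q.cogen.ext L :=
  if h : B.low u = u then sgn K (kz B.low (par e)) •
    Q.curvTerm B.quot (fun r => f.map (B.sub r) (B.restrict P.cogen x r)) ⟨u, h⟩ else 0

/-- The composite of the curvature with a morphism, as a sum over the vertices where `θ` is applied.
-/
theorem sum_curvature_comp : ∑ B : T.Partition, sgn K (kz B.low (par e)) •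
    Q.curvature B.quot (fun r => f.map (B.sub r) (B.restrict P.cogen x r)) =
      ∑ u, ∑ B, leftTerm f x e u B := by
  rw [Finset.sum_comm]
  refine Finset.sum_congr rfl fun B _ => ?_
  rw [curvature_eq_sum, Finset.smul_sum]
  unfold leftTerm
  rw [← Finset.sum_filter_add_sum_filter_not Finset.univ (fun u => B.low u = u),
    Finset.sum_eq_zero (s := Finset.univ.filter fun u => ¬ B.low u = u), add_zero,
    Finset.sum_subtype (p := fun u => B.low u = u) _ (by simp)]
  · refine Finset.sum_congr rfl fun r _ => ?_
    rw [dif_pos r.2]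
  · intro u hu
    rw [dif_neg (Finset.mem_filter.1 hu).2]

variable (hf : ∀ {ι L : Type} [Fintype ι] [LinearOrder ι] [Finite L] (T : RTree ι L)
    (x : ∀ v : ι, P.cogen.ext (T.In v)), Q.theta L (f.map T x) = P.theta L (T.proj P.cogen x))
include hf

/-- Only partitions with `{u}` and its complement as subtrees contribute to the composite of the
curvature with a morphism. -/
theorem isolate_of_leftTerm {B : T.Partition} (h : leftTerm f x e u B ≠ 0) :
    ∃ r : B.Roots, ∀ i, B.low i = r.1 ↔ i ≠ u := by
  unfold leftTerm at h
  split_ifs at h with hu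
  · obtain ⟨hθ, c, hcu, hc⟩ := Q.curvTerm_ne_zero fun h0 => h (by rw [h0, smul_zero])
    refine ⟨c, fun i => ⟨?_, fun hi => ?_⟩⟩
    · rintro hi rfl
      exact hcu (Subtype.ext (hi.symm.trans hu))
    · have : B.root i ≠ ⟨u, hu⟩ := by
        intro hiu
        rw [hf] at hθ
        have hcard : Fintype.card (B.Block ⟨u, hu⟩) = 1 := by
          by_contra hcard
          rw [RTree.proj, if_neg hcard, theta_zero] at hθ
          exact hθ rfl
        obtain ⟨y, hy⟩ := Fintype.card_eq_one_iff.1 hcard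
        have h1 := (hy ⟨i, congrArg Subtype.val hiu⟩).trans (hy ⟨u, hu⟩).symm
        exact hi (congrArg Subtype.val h1)
      exact congrArg Subtype.val (hc _ this)
  · exact (h rfl).elim

theorem leftTerm_eq {B : T.Partition} {r : B.Roots} (hB : ∀ i, B.low i = r.1 ↔ i ≠ u)
    (h : T.Unary u) (he : par e u = 0) : leftTerm f x e u B =
      (if T.target (Sum.inl u) = none then 1 else -1 : K) • delTerm f T x u := by
  have hu := low_of_isolate hB
  have hr : r ≠ ⟨u, hu⟩ := fun h => (hB r.1).1 r.2 (congrArg Subtype.val h)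
  have hr' : ∀ s : B.Roots, s ≠ ⟨u, hu⟩ → s = r := fun s hs =>
    Subtype.ext (s.2.symm.trans ((hB s.1).2 fun h => hs (Subtype.ext h)))
  have hkz : kz B.low (par e) = 0 := by
    refine Finset.sum_eq_zero fun i _ => Finset.sum_eq_zero fun j _ => ?_
    by_cases hi : i = u
    · simp [hi, he]
    by_cases hj : j = u
    · simp [hj, he]
    rw [if_neg]
    rintro ⟨-, h1⟩
    rw [(hB i).2 hi, (hB j).2 hj] at h1
    exact h1.false
  have hblock : ∀ v : B.Block ⟨u, hu⟩, v = ⟨u, hu⟩ := by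
    intro v
    refine Subtype.ext ?_
    by_contra hv
    exact (hB r.1).1 r.2 (((hB v.1).2 hv).symm.trans v.2)
  have hθ : Q.theta _ (f.map (B.sub ⟨u, hu⟩) (B.restrict P.cogen x ⟨u, hu⟩)) =
      P.theta _ (x u) := by
    rw [hf, P.theta_proj_of_unique _ _ hblock]
    exact P.theta_reindex _ _
  unfold leftTerm delTerm
  rw [dif_pos hu, dif_pos h, hkz, sgn_zero, one_smul, Q.curvTerm_eq hr hr', hθ]
  have h1 := map_isolate hB f.toOMap h x
  change B.quot.transfer Q.cogen r (f.map (B.sub r) (B.restrict P.cogen x r)) = _ at h1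
  rw [h1, smul_smul]
  have h2 : B.quot.target (Sum.inl ⟨u, hu⟩) = none ↔ T.target (Sum.inl u) = none :=
    Option.map_eq_none_iff
  simp only [h2]
  congr 1
  split_ifs <;> simp

/-- The complement of the vertex `u` is a subtree in two cases: if `u` is the lowest vertex and its
input is a vertex, or if `u` is not the lowest vertex and its input is a leaf. -/
theorem sum_leftTerm (h : T.Unary u) (he : par e u = 0) : ∑ B, leftTerm f x e u B =
    (if T.target (Sum.inl u) = none then if ∃ i, T.target (Sum.inl i) = some u then 1 else 0
      else if ∃ i, T.target (Sum.inl i) = some u then 0 else -1 : K) • delTerm f T x u := by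
  have hex : ∀ {B : T.Partition} {r : B.Roots}, (∀ i, B.low i = r.1 ↔ i ≠ u) →
      T.target (Sum.inl u) = none → T.target (Sum.inl r.1) = some u := by
    intro B r hB hu
    rcases hr : T.target (Sum.inl r.1) with _ | w
    · exact ((hB r.1).1 r.2 (Sum.inl_injective (T.root.unique hr hu))).elim
    · by_contra hw
      exact B.parent_ne hr ((hB w).2 fun h => hw (congrArg some h))
  by_cases hu : T.target (Sum.inl u) = none
  · rw [if_pos hu]
    by_cases hc : ∃ i, T.target (Sum.inl i) = some u
    · rw [if_pos hc]
      obtain ⟨c, hc⟩ := hc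
      have hcu : c ≠ u := by
        rintro rfl
        exact T.target_ne _ hc
      let B : T.Partition :=
        { low := fun i => if i = u then u else c
          cond := fun i => by
            by_cases hi : i = u
            · simp [hi]
            by_cases hic : i = c
            · exact Or.inl ((if_neg hi).trans hic.symm)
            rcases ht : T.target (Sum.inl i) with _ | w
            · exact (hi (Sum.inl_injective (T.root.unique ht hu))).elim
            · have hw : w ≠ u := by
                rintro rfl
                exact hic (Sum.inl_injective (h.eq ht hc))
              exact Or.inr ⟨w, rfl, by rw [if_neg hi, if_neg hw]⟩ }
      have hB : ∀ i, B.low i = (⟨c, if_neg hcu⟩ : B.Roots).1 ↔ i ≠ u := by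
        intro i
        change (if i = u then u else c) = c ↔ _
        split_ifs with hi
        · simp [hi, hcu.symm]
        · simp [hi]
      rw [Finset.sum_eq_single B, leftTerm_eq hf hB h he, if_pos hu]
      · intro B' _ hne
        by_contra h0
        obtain ⟨r, hB'⟩ := isolate_of_leftTerm hf h0
        refine hne (ext_low fun i => ?_)
        by_cases hi : i = u
        · rw [hi, low_of_isolate hB, low_of_isolate hB']
        · rw [(hB i).2 hi, (hB' i).2 hi]
          exact Sum.inl_injective (h.eq (hex hB' hu) hc)
      · simp
    · rw [if_neg hc, zero_smul]
      refine Finset.sum_eq_zero fun B _ => ?_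
      by_contra h0
      obtain ⟨r, hB⟩ := isolate_of_leftTerm hf h0
      exact hc ⟨r.1, hex hB hu⟩
  · rw [if_neg hu]
    obtain ⟨w, hw⟩ := Option.ne_none_iff_exists'.1 hu
    by_cases hc : ∃ i, T.target (Sum.inl i) = some u
    · rw [if_pos hc, zero_smul]
      refine Finset.sum_eq_zero fun B _ => ?_
      by_contra h0
      obtain ⟨r, hB⟩ := isolate_of_leftTerm hf h0
      obtain ⟨i, hi⟩ := hc
      exact parent_of_isolate hB hi hw
    · rw [if_neg hc]
      obtain ⟨c, hc0⟩ := @exists_root_vertex _ _ ⟨u⟩ T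
      have hcu : c ≠ u := by
        rintro rfl
        exact hu hc0
      let B : T.Partition :=
        { low := fun i => if i = u then u else c
          cond := fun i => by
            by_cases hi : i = u
            · simp [hi]
            rcases ht : T.target (Sum.inl i) with _ | w
            · rw [if_neg hi]
              exact Or.inl (Sum.inl_injective (T.root.unique hc0 ht))
            · have hw : w ≠ u := by
                rintro rfl
                exact hc ⟨i, ht⟩
              exact Or.inr ⟨w, rfl, by rw [if_neg hi, if_neg hw]⟩ }
      have hB : ∀ i, B.low i = (⟨c, if_neg hcu⟩ : B.Roots).1 ↔ i ≠ u := by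
        intro i
        change (if i = u then u else c) = c ↔ _
        split_ifs with hi
        · simp [hi, hcu.symm]
        · simp [hi]
      rw [Finset.sum_eq_single B, leftTerm_eq hf hB h he, if_neg hu]
      · intro B' _ hne
        by_contra h0
        obtain ⟨r, hB'⟩ := isolate_of_leftTerm hf h0
        refine hne (ext_low fun i => ?_)
        by_cases hi : i = u
        · rw [hi, low_of_isolate hB, low_of_isolate hB']
        · rw [(hB i).2 hi, (hB' i).2 hi]
          exact ((hB' c).2 hcu).symm.trans (B'.low_eq_of_target_none hc0)
      · simp

end Left

section Right

theorem root_spec (B : T.Partition) (i : ι) : B.low i = (B.root i).1 := rfl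

/-- The contribution of the vertex `u` and of the partition `B` to the composite of a map `f` with
the coderivation that extends the curvature. -/
noncomputable def rightTerm (f : TreeMap P.cogen Q.cogen 0) (x : ∀ v, P.cogen.ext (T.In v))
    (e : ι → ℤ) (u : ι) (B : T.Partition) (r : B.Roots) (hr : B.low u = r.1) : Q.cogen.ext L :=
  sgn K (kz B.low (par e)) • f.map B.quot (Function.update
    (fun s => (B.sub s).proj P.cogen (B.restrict P.cogen x s)) r
    (P.curvTerm (B.sub r) (B.restrict P.cogen x r) ⟨u, hr⟩))

/-- The composite of a map with the coderivation that extends the curvature, as a sum over the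
vertices where `θ` is applied. -/
theorem sum_comp_curvature : ∑ B : T.Partition, ∑ r : B.Roots, sgn K (kz B.low (par e)) •
    f.map B.quot (fun s => if s = r then P.curvature (B.sub s) (B.restrict P.cogen x s)
      else (B.sub s).proj P.cogen (B.restrict P.cogen x s)) =
      ∑ u, ∑ B : T.Partition, rightTerm f x e u B (B.root u) (B.root_spec u) := by
  rw [Finset.sum_comm]
  refine Finset.sum_congr rfl fun B _ => ?_
  rw [← B.sum_blocks fun r a => rightTerm f x e a.1 B r a.2]
  refine Finset.sum_congr rfl fun r _ => ?_
  have h1 : (fun s => if s = r then P.curvature (B.sub s) (B.restrict P.cogen x s)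
      else (B.sub s).proj P.cogen (B.restrict P.cogen x s)) = Function.update
      (fun s => (B.sub s).proj P.cogen (B.restrict P.cogen x s)) r
      (∑ a, P.curvTerm (B.sub r) (B.restrict P.cogen x r) a) := by
    funext s
    by_cases hs : s = r
    · subst hs
      rw [if_pos rfl, Function.update_self, curvature_eq_sum]
    · rw [if_neg hs, Function.update_of_ne hs]
  rw [h1, MultilinearMap.map_update_sum, Finset.smul_sum]
  rfl

/-- Only partitions that join `u` to its parent or to a child contribute to the composite of a map
with the coderivation that extends the curvature. -/
theorem isJoin_of_rightTerm {B : T.Partition} {r : B.Roots} {hr : B.low u = r.1}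
    (h : rightTerm f x e u B r hr ≠ 0) : ∃ c, B.IsJoin u c ∨ B.IsJoin c u := by
  unfold rightTerm at h
  have hcurv : P.curvTerm (B.sub r) (B.restrict P.cogen x r) ⟨u, hr⟩ ≠ 0 := by
    intro h0
    refine h ?_
    rw [h0, MultilinearMap.map_coord_zero _ r (Function.update_self ..), smul_zero]
  have hproj : ∀ s : B.Roots, s ≠ r → Fintype.card (B.Block s) = 1 := by
    intro s hs
    by_contra hcard
    refine h ?_
    rw [MultilinearMap.map_coord_zero _ s, smul_zero]
    rw [Function.update_of_ne hs]
    exact if_neg hcard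
  have hlow : ∀ i, B.low i ≠ r.1 → B.low i = i := by
    intro i hi
    obtain ⟨y, hy⟩ := Fintype.card_eq_one_iff.1 (hproj (B.root i)
      fun h => hi (congrArg Subtype.val h))
    have := (hy ⟨B.low i, B.idem i⟩).trans (hy ⟨i, rfl⟩).symm
    exact congrArg Subtype.val this
  obtain ⟨-, c, hcu, hc⟩ := P.curvTerm_ne_zero hcurv
  have hcu' : c.1 ≠ u := fun h => hcu (Subtype.ext h)
  have hmem : ∀ i, B.low i = r.1 → i = u ∨ i = c.1 := by
    intro i hi
    by_cases hiu : i = u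
    · exact Or.inl hiu
    · exact Or.inr (congrArg Subtype.val (hc ⟨i, hi⟩ fun h => hiu (congrArg Subtype.val h)))
  refine ⟨c.1, ?_⟩
  rcases hmem r.1 r.2 with hru | hrc
  · right
    refine ⟨?_, c.2.trans hru, fun i hi => ?_⟩
    · rcases B.cond c.1 with h1 | ⟨w, hw, h1⟩
      · exact (hcu' (h1.symm.trans (c.2.trans hru))).elim
      · rcases hmem w (h1.symm.trans c.2) with rfl | rfl
        · exact hw
        · exact (T.target_ne _ hw).elim
    · by_cases h2 : B.low i = r.1
      · rcases hmem i h2 with rfl | rfl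
        · exact h2.trans hru
        · exact (hi rfl).elim
      · exact hlow i h2
  · left
    refine ⟨?_, hr.trans hrc, fun i hi => ?_⟩
    · rcases B.cond u with h1 | ⟨w, hw, h1⟩
      · exact (hcu' (hrc.symm.trans (hr.symm.trans h1))).elim
      · rcases hmem w (h1.symm.trans hr) with rfl | rfl
        · exact (T.target_ne _ hw).elim
        · exact hw
    · by_cases h2 : B.low i = r.1
      · rcases hmem i h2 with rfl | rfl
        · exact (hi rfl).elim
        · exact h2.trans hrc
      · exact hlow i h2

theorem rightTerm_eq {B : T.Partition} {c : ι} (hC : B.IsJoin u c ∨ B.IsJoin c u) (h : T.Unary u)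
    (hx : ∀ v, x v ∈ P.cogen.extGr _ (e v)) (he : par e u = 0) {r : B.Roots}
    (hr : B.low u = r.1) : rightTerm f x e u B r hr =
      (if T.target (Sum.inl u) = some c then -1 else 1 : K) • delTerm f T x u := by
  have hcu : c ≠ u := by
    rcases hC with hC | hC
    · exact hC.ne
    · exact hC.ne.symm
  have hcr : B.low c = r.1 := by
    rw [← hr]
    rcases hC with hC | hC
    · rw [hC.low_self, hC.low_of_ne _ hC.ne]
    · rw [hC.low_self, hC.low_of_ne _ hC.ne]
  have hinj : ∀ j j' : ι, j ≠ u → j' ≠ u → B.low j = B.low j' → j = j' := by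
    intro j j' hj hj' h1
    have : joinEquiv hC ⟨j, hj⟩ = joinEquiv hC ⟨j', hj'⟩ := Subtype.ext h1
    exact congrArg Subtype.val ((joinEquiv hC).injective this)
  have hblock : ∀ i : B.Block r, i ≠ ⟨u, hr⟩ → i = ⟨c, hcr⟩ := by
    intro i hi
    exact Subtype.ext (hinj _ _ (fun h => hi (Subtype.ext h)) hcu (i.2.trans hcr.symm))
  have hne : (⟨c, hcr⟩ : B.Block r) ≠ ⟨u, hr⟩ := fun h => hcu (congrArg Subtype.val h)
  have htarget : (B.sub r).target (Sum.inl ⟨u, hr⟩) = none ↔ T.target (Sum.inl u) ≠ some c := by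
    rw [Option.eq_none_iff_forall_ne_some]
    constructor
    · exact fun h1 h2 => h1 ⟨c, hcr⟩ (sub_target_iff _ |>.2 h2)
    · intro h1 w hw
      have hw' := (sub_target_iff _).1 hw
      change T.target (Sum.inl u) = some w.1 at hw'
      by_cases hwu : w = ⟨u, hr⟩
      · subst hwu
        exact T.target_ne _ hw'
      · rw [hblock w hwu] at hw'
        exact h1 hw'
  have hθ : P.theta _ (B.restrict P.cogen x r ⟨u, hr⟩) = P.theta _ (x u) := P.theta_reindex _ _
  unfold rightTerm delTerm
  rw [P.curvTerm_eq hne hblock, dif_pos h, MultilinearMap.map_update_smul, hθ,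
    ← map_join hC h f hx he (Function.update
      (fun s => (B.sub s).proj P.cogen (B.restrict P.cogen x s)) r
      ((B.sub r).transfer P.cogen ⟨c, hcr⟩ (B.restrict P.cogen x r ⟨c, hcr⟩)))]
  · rw [smul_comm, smul_smul (if T.target (Sum.inl u) = some c then -1 else 1 : K)]
    congr 1
    simp only [htarget]
    by_cases h1 : T.target (Sum.inl u) = some c
    · simp [h1]
    · simp [h1]
  · have gen : ∀ (i : ι) (s : B.Roots) (hs : B.low i = s.1), i ≠ u → Function.update
        (fun s => (B.sub s).proj P.cogen (B.restrict P.cogen x s)) r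
        ((B.sub r).transfer P.cogen ⟨c, hcr⟩ (B.restrict P.cogen x r ⟨c, hcr⟩)) s =
        (B.sub s).transfer P.cogen ⟨i, hs⟩ (B.restrict P.cogen x s ⟨i, hs⟩) := by
      intro i s hs hiu
      by_cases hsr : s = r
      · subst hsr
        obtain rfl : i = c := hinj _ _ hiu hcu (hs.trans hcr.symm)
        rw [Function.update_self]
      · rw [Function.update_of_ne hsr, TreeMap.proj_eq, TreeMap.ofEquiv_of_unique _ _ _
          (v := ⟨i, hs⟩), EquivMap.id_ext]
        intro j
        refine Subtype.ext (hinj _ _ ?_ hiu (j.2.trans hs.symm))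
        intro hj
        exact hsr (Subtype.ext (j.2.symm.trans ((congrArg B.low hj).trans hr)))
    exact fun i => gen i.1 _ _ i.2

/-- The contribution is `1` for the child of `u`, and `-1` for its parent, if they exist. -/
theorem sum_rightTerm (h : T.Unary u) (hx : ∀ v, x v ∈ P.cogen.extGr _ (e v))
    (he : par e u = 0) : ∑ B : T.Partition, rightTerm f x e u B (B.root u) (B.root_spec u) =
    ((if ∃ i, T.target (Sum.inl i) = some u then 1 else 0) +
      (if T.target (Sum.inl u) = none then 0 else -1) : K) • delTerm f T x u := by
  have hzero : ∀ B : T.Partition, (∀ c, ¬ B.IsJoin u c) → (∀ c, ¬ B.IsJoin c u) →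
      rightTerm f x e u B (B.root u) (B.root_spec u) = 0 := by
    intro B h1 h2
    by_contra h0
    obtain ⟨c, hc | hc⟩ := isJoin_of_rightTerm h0
    · exact h1 c hc
    · exact h2 c hc
  by_cases hu : T.target (Sum.inl u) = none
  · rw [if_pos hu]
    have h1 : ∀ (B : T.Partition) c, ¬ B.IsJoin u c := by
      intro B c hB
      rw [hB.target] at hu
      cases hu
    by_cases hc : ∃ i, T.target (Sum.inl i) = some u
    · rw [if_pos hc]
      obtain ⟨c, hc⟩ := hc
      rw [Finset.sum_eq_single (join hc), rightTerm_eq (Or.inr (isJoin_join hc)) h hx he, hu]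
      · simp
      · intro B _ hB
        refine hzero B (h1 B) fun c' hc' => hB ?_
        obtain rfl := Sum.inl_injective (h.eq hc'.target hc)
        exact hc'.unique (isJoin_join hc)
      · simp
    · rw [if_neg hc, add_zero, zero_smul]
      exact Finset.sum_eq_zero fun B _ => hzero B (h1 B) fun c' hc' => hc ⟨c', hc'.target⟩
  · rw [if_neg hu]
    obtain ⟨w, hw⟩ := Option.ne_none_iff_exists'.1 hu
    have h1 : ∀ (B : T.Partition) c, B.IsJoin u c → B = join hw := by
      intro B c hB
      have h2 := hB.target
      rw [hw] at h2
      cases h2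
      exact hB.unique (isJoin_join hw)
    by_cases hc : ∃ i, T.target (Sum.inl i) = some u
    · rw [if_pos hc]
      obtain ⟨c, hc⟩ := hc
      have hwc : w ≠ c := by
        rintro rfl
        exact T.wf.asymmetric _ _ hc hw
      have hne : join hw ≠ join hc := by
        intro h2
        have h3 := (isJoin_join hw).low_self
        rw [h2, (isJoin_join hc).low_of_ne u (isJoin_join hc).ne] at h3
        exact (isJoin_join hw).ne h3.symm
      rw [Finset.sum_eq_add (join hw) (join hc) hne, rightTerm_eq (Or.inl (isJoin_join hw)) h hx he,
        rightTerm_eq (Or.inr (isJoin_join hc)) h hx he, hw, if_pos rfl,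
        if_neg fun h => hwc (Option.some_inj.1 h), ← add_smul, add_comm]
      · rintro B - ⟨hB1, hB2⟩
        refine hzero B (fun c' hc' => hB1 (h1 B c' hc')) fun c' hc' => hB2 ?_
        obtain rfl := Sum.inl_injective (h.eq hc'.target hc)
        exact hc'.unique (isJoin_join hc)
      · simp
      · simp
    · rw [if_neg hc, zero_add]
      rw [Finset.sum_eq_single (join hw), rightTerm_eq (Or.inl (isJoin_join hw)) h hx he, hw,
        if_pos rfl]
      · intro B _ hB
        exact hzero B (fun c' hc' => hB (h1 B c' hc')) fun c' hc' => hc ⟨c', hc'.target⟩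
      · simp

end Right

/-- A map that is compatible with `θ` commutes with the curvatures. On both sides, the terms where
`θ` is applied to the label of a vertex `u` are multiples of the value of the map on the tree
without `u`. If `n` and `c` are `1` or `0` according to whether `u` has a parent, respectively a
child, or not, then the multiples are `(1 - n) c - n (1 - c)` and `c - n`. -/
theorem curvature_natural (hf : ∀ {ι L : Type} [Fintype ι] [LinearOrder ι] [Finite L]
    (T : RTree ι L) (x : ∀ v : ι, P.cogen.ext (T.In v)),
      Q.theta L (f.map T x) = P.theta L (T.proj P.cogen x))
    (hx : ∀ v, x v ∈ P.cogen.extGr _ (e v)) :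
    ∑ B : T.Partition, sgn K (kz B.low (par e)) •
      Q.curvature B.quot (fun r => f.map (B.sub r) (B.restrict P.cogen x r)) =
    ∑ B : T.Partition, ∑ r : B.Roots, sgn K (kz B.low (par e)) •
      f.map B.quot (fun s => if s = r then P.curvature (B.sub s) (B.restrict P.cogen x s)
        else (B.sub s).proj P.cogen (B.restrict P.cogen x s)) := by
  rw [sum_curvature_comp, sum_comp_curvature]
  refine Finset.sum_congr rfl fun u _ => ?_
  by_cases hθ : P.theta _ (x u) = 0
  · rw [Finset.sum_eq_zero, Finset.sum_eq_zero]
    · intro B _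
      have : P.curvTerm (B.sub (B.root u)) (B.restrict P.cogen x (B.root u)) ⟨u, rfl⟩ = 0 := by
        by_contra h0
        exact (P.curvTerm_ne_zero h0).1 ((P.theta_reindex _ _).trans hθ)
      unfold rightTerm
      rw [this, MultilinearMap.map_coord_zero _ (B.root u) (Function.update_self ..), smul_zero]
    · intro B _
      unfold leftTerm
      split_ifs with hu
      · have : Q.curvTerm B.quot
            (fun r => f.map (B.sub r) (B.restrict P.cogen x r)) ⟨u, hu⟩ = 0 := by
          by_contra h0
          refine (Q.curvTerm_ne_zero h0).1 ?_
          rw [hf]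
          by_cases hcard : Fintype.card (B.Block ⟨u, hu⟩) = 1
          · obtain ⟨y, hy⟩ := Fintype.card_eq_one_iff.1 hcard
            rw [P.theta_proj_of_unique _ _ fun v => (hy v).trans (hy ⟨u, hu⟩).symm]
            exact (P.theta_reindex _ _).trans hθ
          · rw [RTree.proj, if_neg hcard, theta_zero]
        rw [this, smul_zero]
      · rfl
  · have h := P.unary_of_theta_ne_zero hθ
    have he : par e u = 0 := by
      have : e u = 2 := by
        by_contra h2
        exact hθ (P.theta_of_mem h2 (hx u))
      rw [par, this]
      rfl
    rw [sum_leftTerm hf h he, sum_rightTerm h hx he]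
    congr 1
    split_ifs <;> simp

end RTree.Partition

/-! ### Transport of structures along isotopies -/

namespace RTree.Partition

variable {ι L : Type} [Fintype ι] [LinearOrder ι] [Finite L] {T : RTree ι L} {B : T.Partition}

theorem card_roots_lt (h : B ≠ discrete T) : Fintype.card B.Roots < Fintype.card ι := by
  by_contra! hc
  refine h (ext_low fun v => ?_)
  by_contra hv
  exact (Fintype.card_subtype_lt (p := fun r => B.low r = r) hv).not_ge hc

theorem card_block_lt {v₀ : ι} (hv₀ : T.target (Sum.inl v₀) = none) (h : B ≠ whole T v₀ hv₀)
    (r : B.Roots) : Fintype.card (B.Block r) < Fintype.card ι := by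
  by_contra! hc
  have hr : ∀ v, B.low v = r.1 := by
    intro v
    by_contra hv
    exact (Fintype.card_subtype_lt (p := fun v => B.low v = r.1) hv).not_ge hc
  refine h (ext_low fun v => ?_)
  change B.low v = v₀
  rw [hr v, ← hr v₀, B.low_eq_of_target_none hv₀]

theorem card_block_discrete (r : (discrete T).Roots) :
    Fintype.card ((discrete T).Block r) = 1 :=
  Fintype.card_eq_one_iff.2 ⟨_, block_unique_of_discrete (discrete T) (fun _ => rfl) r⟩

theorem discrete_ne_whole {v₀ : ι} (hv₀ : T.target (Sum.inl v₀) = none)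
    (h : 2 ≤ Fintype.card ι) : discrete T ≠ whole T v₀ hv₀ := by
  intro heq
  have : ∀ v, v = v₀ := fun v => congrArg (fun B : T.Partition => B.low v) heq
  have := Fintype.card_le_one_iff.2 fun a b => (this a).trans (this b).symm
  omega

end RTree.Partition

namespace DGSMod

open RTree.Partition

variable {ι L ι' L' : Type} [Fintype ι] [LinearOrder ι] [Fintype ι'] [LinearOrder ι']

theorem curvature_reindex (P : DGSMod.{w, u} K) {T : RTree ι L} {T' : RTree ι' L'} {φ : ι ≃ ι'}
    {ψ : L ≃ L'} (h : T.IsIso T' φ ψ) {x : ∀ v, P.cogen.ext (T.In v)}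
    {x' : ∀ v, P.cogen.ext (T'.In v)}
    (hx : ∀ v, x' (φ v) = P.cogen.reindex (h.inEquiv v) (x v)) :
    P.curvature T' x' = P.cogen.reindex ψ (P.curvature T x) := by
  unfold curvature
  rw [← Fintype.card_congr φ]
  by_cases hc : Fintype.card ι = 2
  · rw [if_pos hc, if_pos hc, map_sum, ← φ.sum_comp]
    refine Finset.sum_congr rfl fun a _ => ?_
    rw [map_sum, ← φ.sum_comp]
    refine Finset.sum_congr rfl fun c _ => ?_
    by_cases hac : a = c
    · rw [if_pos hac, if_pos (congrArg φ hac), map_zero]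
    · have hu : ∀ z z' : T.In c, z.1.isLeft → z'.1.isLeft → z = z' := by
        rintro ⟨i | l, hz⟩ ⟨i' | l', hz'⟩ h1 h2
        · have hi : i ≠ c := by
            rintro rfl
            exact T.target_ne _ hz
          have hi' : i' ≠ c := by
            rintro rfl
            exact T.target_ne _ hz'
          have : i = i' := by
            by_contra hii
            have := Finset.card_le_univ ({c, i, i'} : Finset ι)
            rw [hc, Finset.card_eq_three.2 ⟨c, i, i', hi.symm, hi'.symm, hii, rfl⟩] at this
            omega
          exact Subtype.ext (congrArg Sum.inl this)
        · simp at h2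
        · simp at h1
        · simp at h1
      have ht : T'.target (Sum.inl (φ a)) = none ↔ T.target (Sum.inl a) = none := by
        have := h (Sum.inl a)
        rw [Equiv.sumCongr_apply, Sum.map_inl] at this
        rw [this, Option.map_eq_none_iff]
      rw [if_neg hac, if_neg fun h => hac (φ.injective h), hx, hx, P.theta_reindex,
        RTree.transfer_natural h _ hu, map_smul]
      simp only [ht]
  · rw [if_neg hc, if_neg hc, map_zero]

theorem curvature_discrete {P : DGSMod.{w, u} K} {Q : DGSMod.{w, u'} K} [Finite L] {T : RTree ι L}
    (φ : EquivMap P.cogen Q.cogen 0) (x : ∀ v, P.cogen.ext (T.In v)) :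
    Q.curvature (discrete T).quot (fun r => (TreeMap.ofEquiv φ).map ((discrete T).sub r)
      ((discrete T).restrict P.cogen x r)) = Q.curvature T fun v => φ.ext _ (x v) :=
  ((Q.curvature_reindex ((discrete T).quot_isIso_of_discrete fun _ => rfl) fun r =>
    (discrete T).reindex_of_discrete (fun _ => rfl) φ x r).trans (GrSMod.reindex_refl _)).symm

end DGSMod

namespace TreeMap

open RTree.Partition

variable {V : GrSMod.{w, u} K} {W : GrSMod.{w, u'} K} {W' : GrSMod.{w, u''} K} {k l m : ℤ}

theorem ext_map {f g : TreeMap V W k} (h : ∀ {ι L : Type} [Fintype ι] [LinearOrder ι] [Finite L]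
    (T : RTree ι L), f.map T = g.map T) : f = g := by
  cases f
  cases g
  congr
  funext ι L _ _ _ T
  exact h T

instance : Zero (TreeMap V W k) where
  zero :=
    { map := fun _ => 0
      map_mem := fun _ _ _ _ => Submodule.zero_mem _
      natural := fun _ _ _ _ _ _ _ _ _ _ => by simp
      map_trivial := fun _ => rfl }

instance : Sub (TreeMap V W k) where
  sub f g :=
    { map := fun T => f.map T - g.map T
      map_mem := fun T x e hx => Submodule.sub_mem _ (f.map_mem T x e hx) (g.map_mem T x e hx)
      natural := fun T T' φ ψ h e x x' hx hx' => by
        have h1 := f.natural T T' φ ψ h e x x' hx hx'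
        have h2 := g.natural T T' φ ψ h e x x' hx hx'
        change f.map T' x' - g.map T' x' = _ • W.reindex ψ (f.map T x - g.map T x)
        rw [h1, h2, map_sub, smul_sub]
      map_trivial := fun {_ L} _ _ _ _ T => by
        rw [f.map_trivial, g.map_trivial]
        exact MultilinearMap.ext fun x => sub_zero (0 : W.ext L) }

theorem sub_apply (f g : TreeMap V W k) {ι L : Type} [Fintype ι] [LinearOrder ι] [Finite L]
    (T : RTree ι L) (x : ∀ v, V.ext (T.In v)) : (f - g).map T x = f.map T x - g.map T x := rfl

/-- The map that coincides with `G n` on the trees with `n` vertices. -/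
def diag (G : ℕ → TreeMap V W k) : TreeMap V W k where
  map {ι _} _ _ _ T := (G (Fintype.card ι)).map T
  map_mem {ι _} _ _ _ T := (G (Fintype.card ι)).map_mem T
  natural {ι L ι' L'} _ _ _ _ _ _ T T' φ := by
    have := (G (Fintype.card ι)).natural T T' φ
    rwa [← Fintype.card_congr φ]
  map_trivial {ι _} _ _ _ _ T := (G (Fintype.card ι)).map_trivial T

theorem diag_map (G : ℕ → TreeMap V W k) {ι L : Type} [Fintype ι] [LinearOrder ι] [Finite L]
    (T : RTree ι L) : (diag G).map T = (G (Fintype.card ι)).map T := rfl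

/-- The maps `f` and `g` coincide on the trees with less than `n` vertices. -/
def AgreeBelow (n : ℕ) (f g : TreeMap V W k) : Prop :=
  ∀ {ι L : Type} [Fintype ι] [LinearOrder ι] [Finite L] (T : RTree ι L),
    Fintype.card ι < n → f.map T = g.map T

/-- The restriction of `f` to the trees with one vertex is `φ`. -/
def Extends (f : TreeMap V W k) (φ : EquivMap V W k) : Prop :=
  ∀ {ι L : Type} [Fintype ι] [LinearOrder ι] [Finite L] (T : RTree ι L),
    Fintype.card ι = 1 → f.map T = (ofEquiv φ).map T

variable {ι L : Type} [Fintype ι] [LinearOrder ι] [Finite L] {T : RTree ι L} {e : ι → ℤ}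
  {x : ∀ v, V.ext (T.In v)}

theorem glue_discrete {f : TreeMap V W 0} {φ : EquivMap V W 0} (hf : f.Extends φ)
    (g : TreeMap W W' k) :
    (discrete T).glue g.toOMap (fun _ => f.toOMap) x = g.map T fun v => φ.ext _ (x v) :=
  glue_of_discrete _ (fun _ => rfl) _ _ (fun _ => φ)
    (fun r => hf _ (card_block_discrete r)) x

theorem glue_whole_of_extends {g : TreeMap W W' l} {φ : EquivMap W W' l} (hg : g.Extends φ)
    (h : ι → OMap V W) {v₀ : ι} (hv₀ : T.target (Sum.inl v₀) = none) (x : ∀ v, V.ext (T.In v)) :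
    (whole T v₀ hv₀).glue g.toOMap h x = φ.ext _ ((h v₀).map T x) := by
  rw [← glue_whole φ h hv₀ x, glue_apply, glue_apply]
  have hc : Fintype.card (whole T v₀ hv₀).Roots = 1 :=
    Fintype.card_eq_one_iff.2 ⟨⟨v₀, rfl⟩, fun r => Subtype.ext r.2.symm⟩
  exact congrArg (fun F : MultilinearMap K _ _ => F _) (hg _ hc)

/-- The difference of two composites, if the maps differ only on the whole tree. -/
theorem comp_sub_comp {g g' : TreeMap W W' k} {f f' : TreeMap V W 0} {φ : EquivMap V W 0}
    {χ : EquivMap W W' k} (hf : f.Extends φ) (hf' : f'.Extends φ) (hg : g.Extends χ)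
    (hgg : g.AgreeBelow (Fintype.card ι) g') (hff : f.AgreeBelow (Fintype.card ι) f')
    (hc : 2 ≤ Fintype.card ι) (hx : ∀ v, x v ∈ V.extGr _ (e v)) :
    (g.comp f).map T x - (g'.comp f').map T x =
      (g.map T (fun v => φ.ext _ (x v)) - g'.map T fun v => φ.ext _ (x v)) +
        (χ.ext _ (f.map T x) - χ.ext _ (f'.map T x)) := by
  have : Nonempty ι := Fintype.card_pos_iff.1 (by omega)
  have hg' : g'.Extends χ := fun T' hT' => (hgg T' (by omega)).symm.trans (hg T' hT')
  obtain ⟨v₀, hv₀⟩ := T.exists_root_vertex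
  rw [comp_apply _ _ hx, comp_apply _ _ hx, ← Finset.sum_sub_distrib,
    Finset.sum_eq_add (discrete T) (whole T v₀ hv₀) (discrete_ne_whole hv₀ hc)]
  · rw [sexp_discrete_zero, sexp_whole, sgn_zero, one_smul, one_smul, one_smul, one_smul,
      glue_discrete hf, glue_discrete hf', glue_whole_of_extends hg, glue_whole_of_extends hg']
    rfl
  · rintro B - ⟨h1, h2⟩
    rw [sub_eq_zero, glue_apply, glue_apply]
    refine congrArg _ ?_
    change g.map B.quot _ = g'.map B.quot _
    rw [hgg _ (card_roots_lt h1)]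
    refine congrArg _ (funext fun r => ?_)
    change f.map (B.sub r) _ = f'.map (B.sub r) _
    rw [hff _ (card_block_lt hv₀ h2 r)]
  · simp
  · simp

theorem comp_of_card_one {g : TreeMap W W' k} {f : TreeMap V W 0} {φ : EquivMap V W 0}
    (hf : f.Extends φ) (hc : Fintype.card ι = 1) (hx : ∀ v, x v ∈ V.extGr _ (e v)) :
    (g.comp f).map T x = g.map T fun v => φ.ext _ (x v) := by
  rw [comp_apply _ _ hx, Finset.sum_eq_single (discrete T)]
  · rw [sexp_discrete_zero, sgn_zero, one_smul, glue_discrete hf]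
  · intro B _ hB
    have h1 := card_roots_lt hB
    have : Nonempty ι := Fintype.card_pos_iff.1 (by omega)
    obtain ⟨v₀, hv₀⟩ := T.exists_root_vertex
    have h2 : 0 < Fintype.card B.Roots :=
      Fintype.card_pos_iff.2 ⟨⟨v₀, B.low_eq_of_target_none hv₀⟩⟩
    rw [hc] at h1
    exact ((Nat.lt_one_iff.1 h1).not_gt h2).elim
  · simp

theorem star_congr_left {g g' : TreeMap V W k} (α : TreeMap V V l) (hm : k + l = m)
    (h : g.AgreeBelow (Fintype.card ι + 1) g') (hx : ∀ v, x v ∈ V.extGr _ (e v)) :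
    (g.star α hm).map T x = (g'.star α hm).map T x := by
  rw [star_apply _ _ _ hx, star_apply _ _ _ hx]
  refine Finset.sum_congr rfl fun B _ => Finset.sum_congr rfl fun r _ => congrArg _ ?_
  rw [glue_apply, glue_apply]
  change g.map B.quot _ = g'.map B.quot _
  rw [h _ (Nat.lt_succ_of_le (Fintype.card_subtype_le _))]

/-- The composite with the coderivation given by `α`, for a map that vanishes on the smaller trees,
depends only on the restriction of `α` to the trees with one vertex. -/
theorem star_of_agreeBelow {g g' : TreeMap V W k} {α : TreeMap V V l} {χ : EquivMap V V l}
    (hα : α.Extends χ) (hm : k + l = m) (h : g.AgreeBelow (Fintype.card ι) g')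
    (hx : ∀ v, x v ∈ V.extGr _ (e v)) : (g.star α hm).map T x - (g'.star α hm).map T x =
      ((g - g').star (ofEquiv χ) hm).map T x := by
  rw [star_apply _ _ _ hx, star_apply _ _ _ hx, star_apply _ _ _ hx, ← Finset.sum_sub_distrib]
  refine Finset.sum_congr rfl fun B _ => ?_
  rw [← Finset.sum_sub_distrib]
  refine Finset.sum_congr rfl fun r _ => ?_
  refine (smul_sub _ _ _).symm.trans (congrArg _ ?_)
  rw [glue_apply, glue_apply, glue_apply]
  change g.map B.quot _ - g'.map B.quot _ = g.map B.quot _ - g'.map B.quot _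
  by_cases hB : B = discrete T
  · subst hB
    have : ∀ s : (discrete T).Roots, (if s.1 = r.1 then α.toOMap
        else (ofEquiv (EquivMap.id V)).toOMap).map ((discrete T).sub s) =
        (if s.1 = r.1 then (ofEquiv χ).toOMap
        else (ofEquiv (EquivMap.id V)).toOMap).map ((discrete T).sub s) := by
      intro s
      split_ifs
      · exact hα _ (card_block_discrete s)
      · rfl
    simp only [this]
  · rw [h _ (card_roots_lt hB), sub_self, sub_self]

/-- The composite with the coderivation given by a map of generators of odd degree. -/
theorem star_ofEquiv (g : TreeMap V W k) (χ : EquivMap V V l) (hm : k + l = m)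
    (hx : ∀ v, x v ∈ V.extGr _ (e v)) : (g.star (ofEquiv χ) hm).map T x =
      ∑ t, sgn K (∑ i with i < t, (l : ZMod 2) * par e i) •
        g.map T (Function.update x t (χ.ext _ (x t))) := by
  rw [star_apply _ _ _ hx, Finset.sum_eq_single (discrete T)]
  · refine sum_equiv_of (α := (discrete T).Roots)
      (Equiv.subtypeUnivEquiv fun _ => rfl) fun t => ?_
    change _ = sgn K (∑ i with i < t.1, (l : ZMod 2) * par e i) •
      g.map T (Function.update x t.1 (χ.ext _ (x t.1)))
    rw [sexp_single]
    have h0 : kz (discrete T).low (par e) = 0 := kz_of_strictMono (fun _ _ h => h) _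
    rw [h0, zero_add]
    refine congrArg _ ?_
    rw [glue_apply]
    refine Eq.trans ?_ (g.toOMap.nat _ _ _ _ ((discrete T).quot_isIso_of_discrete fun _ => rfl)
      (fun _ _ h => h) (fun r => (if r.1 = t.1 then (ofEquiv χ).toOMap
        else (ofEquiv (EquivMap.id V)).toOMap).map ((discrete T).sub r)
          ((discrete T).restrict V x r)) _ fun r => ?_).symm
    · exact (GrSMod.reindex_refl _).symm
    · by_cases hr : r.1 = t.1
      · rw [if_pos hr]
        obtain rfl : r = t := Subtype.ext hr
        exact (Function.update_self ..).trans
          ((discrete T).reindex_of_discrete (fun _ => rfl) χ x r)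
      · rw [if_neg hr]
        exact (Function.update_of_ne hr ..).trans
          ((discrete T).reindex_of_discrete (fun _ => rfl) (EquivMap.id V) x r)
  · intro B _ hB
    refine Finset.sum_eq_zero fun r _ => ?_
    have : ∃ s : B.Roots, Fintype.card (B.Block s) ≠ 1 := by
      by_contra! h
      exact hB (eq_discrete h)
    obtain ⟨s, hs⟩ := this
    rw [glue_eq_zero _ _ _ s, _root_.zero_apply, smul_zero]
    split_ifs
    · exact ofEquiv_of_card_ne _ _ hs
    · exact ofEquiv_of_card_ne _ _ hs
  · simp

section Transport

variable (f : TreeMap V V 0) (γ : TreeMap V V l)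

/-- The approximations of the transported coderivation: the `n`-th one has the right values on the
trees with at most `n` vertices. -/
noncomputable def transportAux : ℕ → TreeMap V V l
  | 0 => 0
  | n + 1 => diag fun m => if m = n + 1 then
      f.star γ (zero_add l) - ((transportAux n).comp f - transportAux n) else transportAux n

/-- The coderivation transported along the morphism given by `f`. -/
noncomputable def transport : TreeMap V V l := diag (transportAux f γ)

theorem transportAux_eq {n : ℕ} {ι L : Type} [Fintype ι] [LinearOrder ι] [Finite L]
    (T : RTree ι L) (h : Fintype.card ι ≤ n) :
    (transportAux f γ n).map T = (transport f γ).map T := by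
  induction n, h using Nat.le_induction with
  | base => rfl
  | succ n hn ih =>
    rw [← ih]
    change (if Fintype.card ι = n + 1 then _ else transportAux f γ n).map T = _
    rw [if_neg (by omega)]

variable {f γ}

/-- The morphism given by `f` intertwines `γ` and the transported coderivation. This equation
determines the latter, by induction on the number of vertices. -/
theorem transport_comp (hf : f.Extends (EquivMap.id V)) :
    (transport f γ).comp f = f.star γ (zero_add l) := by
  refine ext_map fun {ι L} _ _ _ T => ext_homogeneous fun e x hx => ?_
  rcases hn : Fintype.card ι with _ | n
  · have := Fintype.card_eq_zero_iff.1 hn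
    rw [map_trivial, map_trivial]
  · have h1 : (transport f γ).map T = (f.star γ (zero_add l) -
        ((transportAux f γ n).comp f - transportAux f γ n)).map T := by
      change (transportAux f γ (Fintype.card ι)).map T = _
      rw [hn]
      change (if Fintype.card ι = n + 1 then _ else transportAux f γ n).map T = _
      rw [if_pos hn]
    have h2 : ((transport f γ).comp f).map T x - ((transportAux f γ n).comp f).map T x =
        (transport f γ).map T x - (transportAux f γ n).map T x := by
      rw [comp_apply _ _ hx, comp_apply _ _ hx, ← Finset.sum_sub_distrib,
        Finset.sum_eq_single (discrete T)]
      · rw [sexp_discrete_zero, sgn_zero, one_smul, one_smul, glue_discrete hf, glue_discrete hf]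
        rfl
      · intro B _ hB
        rw [sub_eq_zero, glue_apply, glue_apply]
        refine congrArg _ ?_
        change (transport f γ).map B.quot _ = (transportAux f γ n).map B.quot _
        have := card_roots_lt hB
        rw [transportAux_eq f γ B.quot (by omega)]
      · simp
    rw [h1, sub_apply, sub_apply] at h2
    have h3 := sub_eq_iff_eq_add.1 h2
    rw [h3]
    abel

end Transport

end TreeMap

namespace HomotopyOperad

open TreeMap RTree.Partition

variable {P : DGSMod.{w, u} K} {Q : DGSMod.{w, u'} K}

theorem extends_barDiff (hP : HomotopyOperad P) : hP.γ.Extends (P.barDiff hP.one hP.one_mem) := by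
  intro ι L _ _ _ T hc
  obtain ⟨v, hv⟩ := Fintype.card_eq_one_iff.1 hc
  let _ : Unique ι := ⟨⟨v⟩, hv⟩
  ext1 x
  rw [hP.γ_generators, ofEquiv_of_unique _ _ _ hv]
  rfl

theorem star_γ (hP : HomotopyOperad P) {ι L : Type} [Fintype ι] [LinearOrder ι] [Finite L]
    (T : RTree ι L) {e : ι → ℤ} {x : ∀ v, P.cogen.ext (T.In v)}
    (hx : ∀ v, x v ∈ P.cogen.extGr _ (e v)) :
    (hP.γ.star hP.γ (m := -2) (by norm_num)).map T x = P.curvature T x := by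
  rw [star_eq_compCoder _ _ _ hx]
  exact hP.γ_γ T e x hx

/-- If a map `f` compatible with `θ` intertwines the coderivation of `hP` with a coderivation `γ`,
then the square of `γ` composed with `f` is the curvature composed with `f`. -/
theorem star_star_comp (hP : HomotopyOperad P) {γ : TreeMap Q.cogen Q.cogen (-1)}
    {f : TreeMap P.cogen Q.cogen 0} (hfγ : γ.comp f = f.star hP.γ (zero_add _))
    (hf : ∀ {ι L : Type} [Fintype ι] [LinearOrder ι] [Finite L] (T : RTree ι L)
      (x : ∀ v : ι, P.cogen.ext (T.In v)), Q.theta L (f.map T x) = P.theta L (T.proj P.cogen x))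
    {ι L : Type} [Fintype ι] [LinearOrder ι] [Finite L] {T : RTree ι L} {e : ι → ℤ}
    {x : ∀ v, P.cogen.ext (T.In v)} (hx : ∀ v, x v ∈ P.cogen.extGr _ (e v)) :
    ∑ B : T.Partition, sgn K (kz B.low (par e)) •
      (γ.star γ (m := -2) (by norm_num)).map B.quot
        (fun r => f.map (B.sub r) (B.restrict P.cogen x r)) =
    ∑ B : T.Partition, sgn K (kz B.low (par e)) •
      Q.curvature B.quot (fun r => f.map (B.sub r) (B.restrict P.cogen x r)) := by
  have h1 : ((γ.star γ (m := -2) (by norm_num)).comp f).map T x =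
      (f.star (hP.γ.star hP.γ (m := -2) (by norm_num)) (zero_add _)).map T x := by
    rw [star_comp, hfγ, ← comp_star, hfγ, TreeMap.star_star]
    exact ⟨-1, rfl⟩
  rw [curvature_natural hf hx]
  rw [comp_apply _ _ hx, star_apply _ _ _ hx] at h1
  refine Eq.trans ?_ (h1.trans ?_)
  · refine Finset.sum_congr rfl fun B _ => ?_
    rw [sexp_zero]
    rfl
  · refine Finset.sum_congr rfl fun B _ => Finset.sum_congr rfl fun r _ => ?_
    rw [sexp_single]
    have h2 : ((-2 : ℤ) : ZMod 2) = 0 := rfl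
    simp only [h2, zero_mul, Finset.sum_const_zero, add_zero]
    refine congrArg _ ?_
    rw [glue_apply]
    change f.map B.quot _ = _
    refine congrArg _ (funext fun s => ?_)
    by_cases hs : s = r
    · rw [if_pos hs, if_pos (congrArg Subtype.val hs)]
      exact hP.star_γ _ (B.restrict_mem hx s)
    · rw [if_neg hs, if_neg fun h => hs (Subtype.ext h)]
      rfl

end HomotopyOperad

open TreeMap RTree.Partition

theorem TreeMap.agreeBelow_two {V : GrSMod.{w, u} K} {W : GrSMod.{w, u'} K} {k : ℤ}
    {f : TreeMap V W k} {φ : EquivMap V W k} (hf : f.Extends φ) : f.AgreeBelow 2 (ofEquiv φ) := by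
  intro ι L _ _ _ T hc
  rcases Nat.lt_succ_iff_lt_or_eq.1 hc with h0 | h1
  · have := Fintype.card_eq_zero_iff.1 (Nat.lt_one_iff.1 h0)
    rw [map_trivial, map_trivial]
  · exact hf T h1

theorem TreeMap.ofEquiv_star {V : GrSMod.{w, u} K} {W : GrSMod.{w, u'} K} {k l m : ℤ}
    (φ : EquivMap V W k) (γ : TreeMap V V l) (hm : k + l = m) {ι L : Type} [Fintype ι]
    [LinearOrder ι] [Finite L] [Nonempty ι] {T : RTree ι L} {e : ι → ℤ} {x : ∀ v, V.ext (T.In v)}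
    (hx : ∀ v, x v ∈ V.extGr _ (e v)) : ((ofEquiv φ).star γ hm).map T x = φ.ext _ (γ.map T x) := by
  unfold star mix
  rw [ofParity_apply _ _ _ _ T hx, mixRaw_ofEquiv_left]
  rfl

theorem TreeMap.star_of_card_one {V : GrSMod.{w, u} K} {W : GrSMod.{w, u'} K} {k l m : ℤ}
    {f : TreeMap V W k} {φ : EquivMap V W k} (hf : f.Extends φ) (γ : TreeMap V V l) (hm : k + l = m)
    {ι L : Type} [Fintype ι] [LinearOrder ι] [Finite L] {T : RTree ι L} (hc : Fintype.card ι = 1)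
    {e : ι → ℤ} {x : ∀ v, V.ext (T.In v)} (hx : ∀ v, x v ∈ V.extGr _ (e v)) :
    (f.star γ hm).map T x = φ.ext _ (γ.map T x) := by
  have : Nonempty ι := Fintype.card_pos_iff.1 (by omega)
  rw [star_congr_left (g' := ofEquiv φ) γ hm (by rw [hc]; exact agreeBelow_two hf) hx,
    ofEquiv_star _ _ _ hx]

namespace TreeMap

variable {V : GrSMod.{w, u} K} {l : ℤ} {f f' : TreeMap V V 0} {γ : TreeMap V V l}
  {χ : EquivMap V V l}

theorem transport_extends (hf : f.Extends (EquivMap.id V)) (hγ : γ.Extends χ) :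
    (transport f γ).Extends χ := by
  intro ι L _ _ _ T hc
  refine ext_homogeneous fun e x hx => ?_
  have h : ((transport f γ).comp f).map T x = (f.star γ (zero_add l)).map T x := by
    rw [transport_comp hf]
  rw [comp_of_card_one hf hc hx, star_of_card_one hf _ _ hc hx, hγ T hc] at h
  exact h

/-- The change of the transported coderivation on the smallest trees where the morphisms differ. -/
theorem transport_sub_transport (hf : f.Extends (EquivMap.id V)) (hf' : f'.Extends (EquivMap.id V))
    (hγ : γ.Extends χ) {ι L : Type} [Fintype ι] [LinearOrder ι] [Finite L]
    (h : f'.AgreeBelow (Fintype.card ι) f)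
    (h' : (transport f' γ).AgreeBelow (Fintype.card ι) (transport f γ)) (hc : 2 ≤ Fintype.card ι)
    {T : RTree ι L} {e : ι → ℤ} {x : ∀ v, V.ext (T.In v)} (hx : ∀ v, x v ∈ V.extGr _ (e v)) :
    (transport f' γ).map T x = (transport f γ).map T x +
      (((f' - f).star (ofEquiv χ) (zero_add l)).map T x -
        (χ.ext _ (f'.map T x) - χ.ext _ (f.map T x))) := by
  have h1 := comp_sub_comp hf' hf (transport_extends hf' hγ) h' h hc hx
  rw [transport_comp hf, transport_comp hf', star_of_agreeBelow hγ _ h hx] at h1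
  rw [h1, add_sub_cancel_right]
  exact (add_sub_cancel ((transport f γ).map T x) ((transport f' γ).map T x)).symm

theorem transport_agreeBelow (hf : f.Extends (EquivMap.id V)) (hf' : f'.Extends (EquivMap.id V))
    (hγ : γ.Extends χ) {n : ℕ} (h : f'.AgreeBelow n f) :
    (transport f' γ).AgreeBelow n (transport f γ) := by
  suffices h1 : ∀ (m : ℕ) {ι L : Type} [Fintype ι] [LinearOrder ι] [Finite L] (T : RTree ι L),
      Fintype.card ι = m → m < n → (transport f' γ).map T = (transport f γ).map T from
    fun {_ _} _ _ _ T hc => h1 _ T rfl hc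
  intro m
  induction m using Nat.strong_induction_on with
  | _ m ih =>
  intro ι L _ _ _ T hm hn
  rcases Nat.lt_or_ge m 2 with h2 | h2
  · exact ((agreeBelow_two (transport_extends hf' hγ)) T (by omega)).trans
      ((agreeBelow_two (transport_extends hf hγ)) T (by omega)).symm
  · refine ext_homogeneous fun e x hx => ?_
    have h3 : ∀ y, (f' - f).map T y = 0 := by
      intro y
      rw [sub_apply, h T (by omega)]
      exact sub_self (f.map T y)
    rw [transport_sub_transport hf hf' hγ (fun T' hT' => h T' (by omega))
      (fun T' hT' => ih _ (by omega) T' rfl (by omega)) (by omega) hx, h T (by omega),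
      star_ofEquiv _ _ _ hx]
    simp only [h3, smul_zero, Finset.sum_const_zero]
    rw [sub_self (χ.ext L (f.map T x))]
    exact (congrArg _ (sub_zero (0 : V.ext L))).trans (add_zero _)

end TreeMap

namespace HomotopyOperad

variable {P : DGSMod.{w, u} K} (hP : HomotopyOperad P) {f : TreeMap P.cogen P.cogen 0}

variable (hf : f.Extends (EquivMap.id P.cogen))
  (hθ : ∀ {ι L : Type} [Fintype ι] [LinearOrder ι] [Finite L] (T : RTree ι L)
    (x : ∀ v : ι, P.cogen.ext (T.In v)), P.theta L (f.map T x) = P.theta L (T.proj P.cogen x))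
include hf hθ

/-- The transported structure takes its values in `sP`. -/
theorem theta_transport {ι L : Type} [Fintype ι] [LinearOrder ι] [Finite L] (T : RTree ι L)
    (x : ∀ v : ι, P.cogen.ext (T.In v)) : P.theta L ((transport f hP.γ).map T x) = 0 := by
  suffices h : ∀ (n : ℕ) {ι L : Type} [Fintype ι] [LinearOrder ι] [Finite L] (T : RTree ι L),
      Fintype.card ι = n → (P.thetaLin L).compMultilinearMap ((transport f hP.γ).map T) = 0 from
    congrArg (fun F : MultilinearMap K _ _ => F x) (h _ T rfl)
  intro n
  induction n using Nat.strong_induction_on with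
  | _ n ih =>
  intro ι L _ _ _ T hn
  refine multilinear_ext_homogeneous fun e x hx => ?_
  have h1 : ((transport f hP.γ).comp f).map T x = (f.star hP.γ (zero_add _)).map T x := by
    rw [transport_comp hf]
  have h2 : P.thetaLin L ((f.star hP.γ (zero_add _)).map T x) = 0 := by
    rw [star_apply _ _ _ hx, map_sum]
    refine Finset.sum_eq_zero fun B _ => ?_
    rw [map_sum]
    refine Finset.sum_eq_zero fun r _ => ?_
    rw [map_smul, glue_apply]
    change _ • P.theta L (f.map B.quot _) = 0
    rw [hθ]
    by_cases hc : Fintype.card B.Roots = 1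
    · obtain ⟨y, hy⟩ := Fintype.card_eq_one_iff.1 hc
      rw [P.theta_proj_of_unique B.quot _ (v := r) fun s => (hy s).trans (hy r).symm, if_pos rfl]
      have := hP.theta_γ (B.sub r) (B.restrict P.cogen x r)
      exact (congrArg _ this).trans (smul_zero _)
    · rw [RTree.proj, if_neg hc, P.theta_zero, smul_zero]
  rw [← h1, comp_apply _ _ hx, map_sum, Finset.sum_eq_single (discrete T), sexp_discrete_zero,
    sgn_zero, one_smul, glue_discrete hf] at h2
  · exact h2
  · intro B _ hB
    rw [map_smul, glue_apply]
    have := congrArg (fun F : MultilinearMap K _ _ => F fun r => f.map (B.sub r)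
      (B.restrict P.cogen x r)) (ih _ (hn ▸ card_roots_lt hB) B.quot rfl)
    exact (congrArg _ this).trans (smul_zero _)
  · simp

/-- The square of the transported coderivation is given by the curvature. This holds after the
composition with `f`, hence by induction on the number of vertices, since `f` is the identity on the
generators. -/
theorem transport_star_transport {ι L : Type} [Fintype ι] [LinearOrder ι] [Finite L]
    (T : RTree ι L) {e : ι → ℤ} {x : ∀ v : ι, P.cogen.ext (T.In v)}
    (hx : ∀ v, x v ∈ P.cogen.extGr _ (e v)) :
    ((transport f hP.γ).star (transport f hP.γ) (m := -2) (by norm_num)).map T x =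
      P.curvature T x := by
  suffices h : ∀ (n : ℕ) {ι L : Type} [Fintype ι] [LinearOrder ι] [Finite L] (T : RTree ι L)
      (e : ι → ℤ) (x : ∀ v : ι, P.cogen.ext (T.In v)), Fintype.card ι = n →
      (∀ v, x v ∈ P.cogen.extGr _ (e v)) →
      ((transport f hP.γ).star (transport f hP.γ) (m := -2) (by norm_num)).map T x =
      P.curvature T x from h _ T e x rfl hx
  intro n
  induction n using Nat.strong_induction_on with
  | _ n ih =>
  intro ι L _ _ _ T e x hn hx
  have h := hP.star_star_comp (transport_comp hf) hθ (T := T) hx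
  rw [← sub_eq_zero, ← Finset.sum_sub_distrib, Finset.sum_eq_single (discrete T)] at h
  · have h0 : kz (discrete T).low (par e) = 0 := kz_of_strictMono (fun _ _ h => h) _
    rw [h0, sgn_zero, one_smul, one_smul, sub_eq_zero] at h
    have h1 : (fun r => f.map ((discrete T).sub r) ((discrete T).restrict P.cogen x r)) =
        fun r => (ofEquiv (EquivMap.id P.cogen)).map ((discrete T).sub r)
          ((discrete T).restrict P.cogen x r) := by
      funext r
      rw [hf _ (card_block_discrete r)]
    have h2 := glue_discrete hf (T := T) (x := x)
      ((transport f hP.γ).star (transport f hP.γ) (m := -2) (by norm_num))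
    rw [glue_apply] at h2
    refine h2.symm.trans (h.trans ?_)
    rw [h1, DGSMod.curvature_discrete]
    rfl
  · intro B _ hB
    have hmem := B.glue_label_mem (h := fun _ => f.toOMap) (fun _ => f.isGr) hx
    rw [sub_eq_zero]
    exact congrArg _ (ih _ (hn ▸ card_roots_lt hB) B.quot _ _ rfl hmem)
  · simp

/-- The homotopy operad structure transported along a map `f` which is the identity on the
generators. -/
noncomputable def transportOperad : HomotopyOperad P where
  one := hP.one
  one_mem := hP.one_mem
  γ := transport f hP.γ
  theta_γ := hP.theta_transport hf hθ
  γ_generators {ι L} _ _ _ _ T x := by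
    rw [transport_extends hf hP.extends_barDiff T
        (Fintype.card_eq_one_iff.2 ⟨default, fun v => Unique.eq_default v⟩),
      ofEquiv_of_unique _ _ _ fun v => Unique.eq_default v]
  γ_γ T e x hx := by
    rw [← star_eq_compCoder _ _ (by norm_num : (-1 : ℤ) + -1 = -2) hx]
    exact hP.transport_star_transport hf hθ T hx

/-- The `∞`-morphism along which a homotopy operad structure is transported. -/
noncomputable def transportMorphism : InfMorphism hP (hP.transportOperad hf hθ) where
  f := f
  theta_f := hθ
  f_γ T e x hx := by
    rw [← comp_eq_compMor _ _ hx, ← star_eq_compCoder _ _ (zero_add _) hx]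
    change ((transport f hP.γ).comp f).map T x = _
    rw [transport_comp hf]

theorem transportMorphism_isIsotopy : (hP.transportMorphism hf hθ).IsIsotopy := by
  intro ι L _ _ _ _ T x
  change f.map T _ = _
  rw [hf T (Fintype.card_eq_one_iff.2 ⟨default, fun v => Unique.eq_default v⟩),
    ofEquiv_of_unique _ _ _ fun v => Unique.eq_default v]
  rfl

end HomotopyOperad

/-! ### Equivariant sections and contractions -/

/-- A linear choice of preimages in `A` of the elements of `B`. -/
theorem exists_linear_choice {M N : Type*} [AddCommGroup M] [Module K M] [AddCommGroup N]
    [Module K N] (p : M →ₗ[K] N) (A : Submodule K M) (B : Submodule K N)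
    (h : ∀ y ∈ B, ∃ x ∈ A, p x = y) : ∃ F : N →ₗ[K] M, ∀ y ∈ B, F y ∈ A ∧ p (F y) = y := by
  obtain ⟨g, hg⟩ := (p.domRestrict A).rangeRestrict.exists_rightInverse_of_surjective
    (LinearMap.range_rangeRestrict _)
  obtain ⟨F, hF⟩ := LinearMap.exists_extend g
  refine ⟨A.subtype ∘ₗ F, fun y hy => ?_⟩
  obtain ⟨x, hx, hxy⟩ := h y hy
  have hy' : y ∈ LinearMap.range (p.domRestrict A) := ⟨⟨x, hx⟩, hxy⟩
  have h1 : F y = g ⟨y, hy'⟩ := congrArg (fun G => G ⟨y, hy'⟩) hF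
  refine ⟨(F y).2, ?_⟩
  have h2 := congrArg (fun G => (G ⟨y, hy'⟩).1) hg
  change p (F y).1 = y
  rw [h1]
  exact h2

namespace GrSMod

variable [CharZero K] {V : GrSMod.{w, u} K} {W : GrSMod.{w, u'} K} {k : ℤ}

theorem ρ_mul (V : GrSMod.{w, u} K) {n : ℕ} (σ τ : Equiv.Perm (Fin n)) (x : V.obj n) :
    V.ρ n (σ * τ) x = V.ρ n σ (V.ρ n τ x) := by
  rw [map_mul]
  rfl

/-- The average over the symmetric groups of a family of homogeneous linear maps. -/
noncomputable def average (F : ∀ n, V.obj n →ₗ[K] W.obj n)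
    (hF : ∀ n l, ∀ x ∈ V.gr n l, F n x ∈ W.gr n (l + k)) : EquivMap V W k where
  map n := (Fintype.card (Equiv.Perm (Fin n)) : K)⁻¹ •
    ∑ σ, W.ρ n σ ∘ₗ F n ∘ₗ V.ρ n σ⁻¹
  map_mem n l x hx := by
    rw [LinearMap.smul_apply, LinearMap.sum_apply]
    exact Submodule.smul_mem _ _ (Submodule.sum_mem _ fun σ _ =>
      W.ρ_mem n σ _ _ (hF n l _ (V.ρ_mem n σ⁻¹ _ _ hx)))
  map_ρ n τ x := by
    rw [LinearMap.smul_apply, LinearMap.smul_apply, LinearMap.sum_apply, LinearMap.sum_apply,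
      map_smul, map_sum]
    congr 1
    symm
    refine Fintype.sum_equiv (Equiv.mulLeft τ) _ _ fun σ => ?_
    rw [LinearMap.comp_apply, LinearMap.comp_apply, LinearMap.comp_apply, LinearMap.comp_apply,
      ← ρ_mul, ← ρ_mul, Equiv.coe_mulLeft, mul_inv_rev, mul_assoc, inv_mul_cancel, mul_one]

theorem average_apply {F : ∀ n, V.obj n →ₗ[K] W.obj n}
    (hF : ∀ n l, ∀ x ∈ V.gr n l, F n x ∈ W.gr n (l + k)) (n : ℕ) (x : V.obj n) :
    (average F hF).map n x = (Fintype.card (Equiv.Perm (Fin n)) : K)⁻¹ •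
      ∑ σ, W.ρ n σ (F n (V.ρ n σ⁻¹ x)) := by
  change ((_ : K) • ∑ σ, W.ρ n σ ∘ₗ F n ∘ₗ V.ρ n σ⁻¹) x = _
  rw [LinearMap.smul_apply, LinearMap.sum_apply]
  rfl

theorem inv_card_smul_sum_const {M : Type*} [AddCommGroup M] [Module K M] (n : ℕ) (x : M) :
    (Fintype.card (Equiv.Perm (Fin n)) : K)⁻¹ • ∑ _σ : Equiv.Perm (Fin n), x = x := by
  rw [Finset.sum_const, Finset.card_univ, ← Nat.cast_smul_eq_nsmul K, smul_smul,
    inv_mul_cancel₀ (Nat.cast_ne_zero.2 Fintype.card_ne_zero), one_smul]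

theorem ρ_ρ_inv (V : GrSMod.{w, u} K) {n : ℕ} (σ : Equiv.Perm (Fin n)) (x : V.obj n) :
    V.ρ n σ (V.ρ n σ⁻¹ x) = x := by
  rw [← ρ_mul, mul_inv_cancel, map_one]
  rfl

end GrSMod

namespace DGSMod.Hom

variable [CharZero K] {P : DGSMod.{w, u} K} {Q : DGSMod.{w, u'} K} {p : P.Hom Q}

/-- A fibration of dg `𝕊`-modules has an equivariant section of degree `0`, since the
characteristic is zero. -/
theorem exists_section (hp : p.IsFibration) :
    ∃ s : EquivMap Q.toGrSMod P.toGrSMod 0, ∀ n y, p.map n (s.map n y) = y := by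
  have h1 : ∀ n k, ∃ F : Q.obj n →ₗ[K] P.obj n, ∀ y ∈ Q.gr n k, F y ∈ P.gr n k ∧
      p.map n (F y) = y := fun n k => exists_linear_choice _ _ _ (hp n k)
  choose F hF using h1
  let S : ∀ n, Q.obj n →ₗ[K] P.obj n := fun n => GrSMod.assemble (Q.internal n) (F n)
  have hS : ∀ n k, ∀ y ∈ Q.gr n k, S n y = F n k y := fun n k y hy =>
    GrSMod.assemble_apply (Q.internal n) (F n) hy
  have hSp : ∀ n y, p.map n (S n y) = y := by
    intro n y
    have : p.map n ∘ₗ S n = LinearMap.id := GrSMod.linear_ext (Q.internal n) fun k y hy => by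
      rw [LinearMap.comp_apply, hS n k y hy, (hF n k y hy).2]
      rfl
    exact congrArg (fun G => G y) this
  refine ⟨GrSMod.average S fun n l y hy => ?_, fun n y => ?_⟩
  · rw [hS n l y hy, add_zero]
    exact (hF n l y hy).1
  · rw [GrSMod.average_apply, map_smul, map_sum]
    simp only [p.map_ρ, hSp, GrSMod.ρ_ρ_inv]
    exact GrSMod.inv_card_smul_sum_const n y

/-- The kernel of an acyclic fibration is acyclic. -/
theorem exists_boundary (hp : p.IsAcyclicFibration) {n : ℕ} {k : ℤ} {z : P.obj n}
    (hz : z ∈ P.gr n k) (hpz : p.map n z = 0) (hdz : P.d.map n z = 0) :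
    ∃ w ∈ P.gr n (k + 1), p.map n w = 0 ∧ P.d.map n w = z := by
  obtain ⟨w, hw, hdw⟩ := (hp.2 n k).1 z hz hdz ⟨0, Submodule.zero_mem _, by rw [hpz, map_zero]⟩
  have hpw : p.map n w ∈ Q.gr n (k + 1) := by
    have := p.map_mem n _ w hw
    rwa [add_zero] at this
  obtain ⟨x, hx, hdx, y, hy, hxy⟩ := (hp.2 n (k + 1)).2 (p.map n w) hpw
    (by rw [← p.comm, hdw, hpz])
  obtain ⟨y', hy', rfl⟩ := hp.1 n _ y hy
  refine ⟨w - x + P.d.map n y', ?_, ?_, ?_⟩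
  · have := P.d.map_mem n _ y' hy'
    rw [add_neg_cancel_right] at this
    exact Submodule.add_mem _ (Submodule.sub_mem _ hw hx) this
  · rw [map_add, map_sub, p.comm, ← hxy]
    abel
  · rw [map_add, map_sub, hdw, hdx, P.d_d]
    abel

/-- The kernel of an acyclic fibration is contractible, by an equivariant homotopy that is defined
on the whole dg `𝕊`-module, since the characteristic is zero. -/
theorem exists_contraction (hp : p.IsAcyclicFibration) :
    ∃ k : EquivMap P.toGrSMod P.toGrSMod 1, (∀ n x, p.map n (k.map n x) = 0) ∧
      ∀ n x, p.map n x = 0 → P.d.map n (k.map n x) + k.map n (P.d.map n x) = x := by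
  obtain ⟨s, hs⟩ := exists_section hp.1
  have h1 : ∀ n k, ∃ F : P.obj n →ₗ[K] P.obj n,
      ∀ z ∈ P.gr n k ⊓ (LinearMap.ker (p.map n) ⊓ LinearMap.ker (P.d.map n)),
        F z ∈ P.gr n (k + 1) ⊓ LinearMap.ker (p.map n) ∧ P.d.map n (F z) = z := by
    refine fun n k => exists_linear_choice _ _ _ fun z hz => ?_
    obtain ⟨w, hw, hpw, hdw⟩ := exists_boundary hp hz.1 (LinearMap.mem_ker.1 hz.2.1)
      (LinearMap.mem_ker.1 hz.2.2)
    exact ⟨w, ⟨hw, LinearMap.mem_ker.2 hpw⟩, hdw⟩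
  choose F hF using h1
  let S : ∀ n, P.obj n →ₗ[K] P.obj n := fun n => GrSMod.assemble (P.internal n) (F n)
  have hS : ∀ n k, ∀ z ∈ P.gr n k, p.map n z = 0 → P.d.map n z = 0 →
      S n z ∈ P.gr n (k + 1) ∧ p.map n (S n z) = 0 ∧ P.d.map n (S n z) = z := by
    intro n k z hz hpz hdz
    have h2 : S n z = F n k z := GrSMod.assemble_apply (P.internal n) (F n) hz
    obtain ⟨⟨h3, h4⟩, h5⟩ := hF n k z ⟨hz, LinearMap.mem_ker.2 hpz, LinearMap.mem_ker.2 hdz⟩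
    rw [h2]
    exact ⟨h3, LinearMap.mem_ker.1 h4, h5⟩
  -- the projection onto the kernel of `p` along the section
  let r : ∀ n, P.obj n →ₗ[K] P.obj n := fun n => LinearMap.id - s.map n ∘ₗ p.map n
  have hr : ∀ n x, r n x = x - s.map n (p.map n x) := fun _ _ => rfl
  have hpr : ∀ n x, p.map n (r n x) = 0 := by
    intro n x
    rw [hr, map_sub, hs, sub_self]
  have hr_mem : ∀ n k, ∀ x ∈ P.gr n k, r n x ∈ P.gr n k := by
    intro n k x hx
    have h3 := s.map_mem n _ _ (p.map_mem n _ x hx)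
    rw [add_zero, add_zero] at h3
    exact Submodule.sub_mem _ hx h3
  have hd_mem : ∀ n k, ∀ x ∈ P.gr n k, P.d.map n x ∈ P.gr n (k - 1) := fun n k x hx =>
    P.d.map_mem n k x hx
  have hrid : ∀ n x, p.map n x = 0 → r n x = x := by
    intro n x hx
    rw [hr, hx, map_zero, sub_zero]
  -- on the kernel of `p`, `x - S (d x)` is a cycle, and `G x` is a choice of its preimage under `d`
  let G : ∀ n, P.obj n →ₗ[K] P.obj n := fun n => S n ∘ₗ (r n - S n ∘ₗ P.d.map n ∘ₗ r n)
  have hG : ∀ n x, G n x = S n (r n x - S n (P.d.map n (r n x))) := fun _ _ => rfl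
  have key : ∀ n k, ∀ x ∈ P.gr n k,
      (G n x ∈ P.gr n (k + 1) ∧ p.map n (G n x) = 0) ∧
        (p.map n x = 0 → P.d.map n (G n x) + G n (P.d.map n x) = x) := by
    intro n k x hx
    have h3 : p.map n (P.d.map n (r n x)) = 0 := by rw [p.comm, hpr, map_zero]
    obtain ⟨h4, h5, h6⟩ := hS n _ _ (hd_mem n _ _ (hr_mem n k x hx)) h3 (P.d_d n _)
    rw [sub_add_cancel] at h4
    obtain ⟨h7, h8, h9⟩ := hS n k (r n x - S n (P.d.map n (r n x)))
      (Submodule.sub_mem _ (hr_mem n k x hx) h4) (by rw [map_sub, hpr, h5, sub_zero])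
      (by rw [map_sub, h6, sub_self])
    refine ⟨⟨h7, h8⟩, fun hpx => ?_⟩
    have h10 : p.map n (P.d.map n x) = 0 := by rw [p.comm, hpx, map_zero]
    rw [hG, hG, h9, hrid n _ h10, hrid n _ hpx, P.d_d, map_zero, sub_zero, sub_add_cancel]
  have hpG : ∀ n x, p.map n (G n x) = 0 := by
    intro n x
    have : p.map n ∘ₗ G n = 0 := GrSMod.linear_ext (P.internal n) fun k x hx =>
      (key n k x hx).1.2
    exact congrArg (fun H => H x) this
  have hGd : ∀ n x, p.map n x = 0 → P.d.map n (G n x) + G n (P.d.map n x) = x := by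
    intro n x hx
    have : (P.d.map n ∘ₗ G n + G n ∘ₗ P.d.map n) ∘ₗ r n = r n :=
      GrSMod.linear_ext (P.internal n) fun k x hx =>
        (key n k _ (hr_mem n k x hx)).2 (hpr n x)
    have h3 := congrArg (fun H => H x) this
    change P.d.map n (G n (r n x)) + G n (P.d.map n (r n x)) = r n x at h3
    rwa [hrid n x hx] at h3
  refine ⟨GrSMod.average G fun n l x hx => (key n l x hx).1.1, fun n x => ?_, fun n x hx => ?_⟩
  · rw [GrSMod.average_apply, map_smul, map_sum]
    simp only [p.map_ρ, hpG, map_zero, Finset.sum_const_zero, smul_zero]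
  · rw [GrSMod.average_apply, GrSMod.average_apply, map_smul, map_sum, ← smul_add,
      ← Finset.sum_add_distrib]
    have h3 : ∀ σ : Equiv.Perm (Fin n), P.d.map n (P.ρ n σ (G n (P.ρ n σ⁻¹ x))) +
        P.ρ n σ (G n (P.ρ n σ⁻¹ (P.d.map n x))) = x := by
      intro σ
      rw [P.d.map_ρ n σ, ← P.d.map_ρ n σ⁻¹, ← map_add, hGd, GrSMod.ρ_ρ_inv]
      rw [p.map_ρ, hx, map_zero]
    simp only [h3]
    exact GrSMod.inv_card_smul_sum_const n x

end DGSMod.Hom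

/-! ### The contraction on the generators of the bar construction -/

namespace EquivMap

/-- The map `sx + c·v ↦ s(g x) + c·v`. -/
noncomputable def cogen {P : DGSMod.{w, u} K} {Q : DGSMod.{w, u'} K}
    (g : EquivMap P.toGrSMod Q.toGrSMod 0) : EquivMap P.cogen Q.cogen 0 where
  map n := (g.map n).prodMap LinearMap.id
  map_mem n l x hx := by
    refine ⟨?_, ?_⟩
    · have := g.map_mem n _ _ hx.1
      change g.map n x.1 ∈ Q.gr n (l + 0 - 1)
      rwa [show l + 0 - 1 = l - 1 + 0 by ring]
    · have := hx.2
      rwa [show l + 0 = l by ring]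
  map_ρ n σ x := Prod.ext (g.map_ρ n σ x.1) rfl

/-- The map `sx + c·v ↦ -s(k x)`. -/
noncomputable def cogenHomotopy {P : DGSMod.{w, u} K} (k : EquivMap P.toGrSMod P.toGrSMod 1) :
    EquivMap P.cogen P.cogen 1 where
  map n := -(LinearMap.inl K (P.obj n) (PLift (n = 1) → K) ∘ₗ k.map n ∘ₗ
    LinearMap.fst K (P.obj n) (PLift (n = 1) → K))
  map_mem n l x hx := by
    refine Submodule.neg_mem _ ⟨?_, Submodule.zero_mem _⟩
    have := k.map_mem n _ _ hx.1
    change k.map n x.1 ∈ P.gr n (l + 1 - 1)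
    rwa [show l + 1 - 1 = l - 1 + 1 by ring]
  map_ρ n σ x := by
    refine Prod.ext ?_ ?_
    · change -k.map n (P.ρ n σ x.1) = P.ρ n σ (-k.map n x.1)
      rw [k.map_ρ, map_neg]
    · change -0 = -0
      rfl

/-- The commutator `d h + h d` of maps of opposite degrees. -/
def commutator {V : GrSMod.{w, u} K} (d : EquivMap V V (-1)) (h : EquivMap V V 1) :
    EquivMap V V 0 where
  map n := d.map n ∘ₗ h.map n + h.map n ∘ₗ d.map n
  map_mem n l x hx := by
    have h1 := d.map_mem n _ _ (h.map_mem n _ _ hx)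
    have h2 := h.map_mem n _ _ (d.map_mem n _ _ hx)
    rw [add_neg_cancel_right] at h1
    rw [neg_add_cancel_right] at h2
    rw [add_zero]
    exact Submodule.add_mem _ h1 h2
  map_ρ n σ x := by
    change d.map n (h.map n (V.ρ n σ x)) + h.map n (d.map n (V.ρ n σ x)) =
      V.ρ n σ (d.map n (h.map n x) + h.map n (d.map n x))
    rw [h.map_ρ, d.map_ρ, d.map_ρ, h.map_ρ, map_add]

end EquivMap

open TreeMap RTree

/-- The tree with one vertex and with set of leaves `X`. -/
def RTree.corolla (X : Type) : RTree Unit X where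
  target := Sum.elim (fun _ => none) fun _ => some ()
  root := ⟨Sum.inl (), rfl, by
    rintro (z | z) hz
    · rfl
    · cases hz⟩
  wf := ⟨fun a => ⟨a, fun b hb => by cases hb⟩⟩

namespace HomotopyOperad

variable {P : DGSMod.{w, u} K} (hP : HomotopyOperad P)
include hP

/-- The square of the differential on the generators of the bar construction is zero. In
particular, the unit is a cycle. -/
theorem barDiff_barDiff {X : Type} (y : P.cogen.ext X) :
    (P.barDiff hP.one hP.one_mem).ext X ((P.barDiff hP.one hP.one_mem).ext X y) = 0 := by
  by_cases hX : Finite X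
  · suffices h : (P.barDiff hP.one hP.one_mem).ext X ∘ₗ (P.barDiff hP.one hP.one_mem).ext X = 0 from
      congrArg (fun F => F y) h
    refine LinearMap.ext_on (GrSMod.span_extGr X) ?_
    rintro y ⟨k, hy⟩
    have hv : ∀ w : Unit, w = () := fun _ => rfl
    have hx : ∀ v, P.cogen.reindex (RTree.uniqueIn (T := corolla X) (v := v) hv).symm y ∈
        P.cogen.extGr ((corolla X).In v) ((fun _ => k : Unit → ℤ) v) :=
      fun v => GrSMod.reindex_mem _ hy
    have h1 := hP.star_γ (corolla X) hx
    rw [star_of_card_one hP.extends_barDiff _ _ rfl hx, hP.extends_barDiff _ rfl,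
      ofEquiv_of_unique _ _ _ hv, RTree.transfer_of_unique hv, EquivMap.ext_reindex,
      EquivMap.ext_reindex, EquivMap.ext_reindex, GrSMod.reindex_apply_symm] at h1
    exact h1.trans (if_neg (by decide))
  · refine Subtype.ext (funext fun n => funext fun e => ?_)
    exact (hX (Finite.of_equiv _ e.symm)).elim

end HomotopyOperad

section Cogen

variable {P : DGSMod.{w, u} K} {Q : DGSMod.{w, u'} K} {X : Type}

theorem DGSMod.Hom.cogen_barDiff (p : P.Hom Q) {one : P.obj 1} (h : one ∈ P.gr 1 0)
    (h' : p.map 1 one ∈ Q.gr 1 0) (x : P.cogen.ext X) :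
    p.toEquivMap.cogen.ext X ((P.barDiff one h).ext X x) =
      (Q.barDiff (p.map 1 one) h').ext X (p.toEquivMap.cogen.ext X x) := by
  refine Subtype.ext (funext fun n => funext fun e => Prod.ext ?_ rfl)
  change p.map n (P.unitMap one n (x.1 n e).2 - P.d.map n (x.1 n e).1) =
    Q.unitMap (p.map 1 one) n (x.1 n e).2 - Q.d.map n (p.map n (x.1 n e).1)
  rw [map_sub, p.comm, DGSMod.unitMap, DGSMod.unitMap, LinearMap.sum_apply, LinearMap.sum_apply,
    map_sum]
  congr 1
  refine Finset.sum_congr rfl fun h _ => ?_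
  obtain ⟨rfl⟩ := h
  exact map_smul _ _ _

theorem EquivMap.cogen_comp_cogen {p : EquivMap P.toGrSMod Q.toGrSMod 0}
    {s : EquivMap Q.toGrSMod P.toGrSMod 0} (h : ∀ n y, p.map n (s.map n y) = y)
    (y : Q.cogen.ext X) : p.cogen.ext X (s.cogen.ext X y) = y :=
  Subtype.ext (funext fun n => funext fun _ => Prod.ext (h n _) rfl)

theorem EquivMap.cogen_cogenHomotopy {p : EquivMap P.toGrSMod Q.toGrSMod 0}
    {k : EquivMap P.toGrSMod P.toGrSMod 1} (h : ∀ n x, p.map n (k.map n x) = 0)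
    (x : P.cogen.ext X) : p.cogen.ext X ((cogenHomotopy k).ext X x) = 0 := by
  refine Subtype.ext (funext fun n => funext fun e => Prod.ext ?_ neg_zero)
  change p.map n (-k.map n (x.1 n e).1) = 0
  rw [map_neg, h, neg_zero]

theorem EquivMap.commutator_ext {V : GrSMod.{w, u} K} (d : EquivMap V V (-1)) (h : EquivMap V V 1)
    (x : V.ext X) : (commutator d h).ext X x = d.ext X (h.ext X x) + h.ext X (d.ext X x) := rfl

theorem EquivMap.commutator_of_mem_ker {p : EquivMap P.toGrSMod Q.toGrSMod 0}
    {k : EquivMap P.toGrSMod P.toGrSMod 1} (hk : ∀ n x, p.map n x = 0 →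
      P.d.map n (k.map n x) + k.map n (P.d.map n x) = x) {one : P.obj 1} (h : one ∈ P.gr 1 0)
    {x : P.cogen.ext X} (hx : p.cogen.ext X x = 0) :
    (commutator (P.barDiff one h) (cogenHomotopy k)).ext X x = x := by
  refine Subtype.ext (funext fun n => funext fun e => ?_)
  have hx' : p.cogen.map n (x.1 n e) = 0 := congrArg (fun y : Q.cogen.ext X => y.1 n e) hx
  have h1 : p.map n (x.1 n e).1 = 0 := congrArg Prod.fst hx'
  have h2 : (x.1 n e).2 = 0 := congrArg Prod.snd hx'
  refine Prod.ext ?_ ?_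
  · change (P.unitMap one n (-0) - P.d.map n (-k.map n (x.1 n e).1)) +
      -k.map n (P.unitMap one n (x.1 n e).2 - P.d.map n (x.1 n e).1) = (x.1 n e).1
    rw [h2, neg_zero, map_zero, map_neg, zero_sub, zero_sub, map_neg, neg_neg, neg_neg, hk n _ h1]
  · change (0 + -0 : PLift (n = 1) → K) = (x.1 n e).2
    rw [h2, neg_zero, add_zero]

theorem EquivMap.theta_cogen (p : EquivMap P.toGrSMod Q.toGrSMod 0) (x : P.cogen.ext X) :
    Q.theta X (p.cogen.ext X x) = P.theta X x := rfl

end Cogen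

/-! ### Homotopies on tensor products -/

namespace EquivMap

variable {V : GrSMod.{w, u} K}

/-- The complementary map `1 - π`. -/
def compl (π : EquivMap V V 0) : EquivMap V V 0 where
  map n := LinearMap.id - π.map n
  map_mem n l x hx := by
    have h := π.map_mem n l x hx
    rw [add_zero] at h ⊢
    exact Submodule.sub_mem _ hx h
  map_ρ n σ x := by
    change V.ρ n σ x - π.map n (V.ρ n σ x) = V.ρ n σ (x - π.map n x)
    rw [π.map_ρ, map_sub]

theorem compl_ext (π : EquivMap V V 0) {X : Type} (x : V.ext X) :
    π.compl.ext X x = x - π.ext X x := rfl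

/-- The map `π` at the elements of `S`, and the map `1 - π` at the other ones. -/
def part (π : EquivMap V V 0) {ι : Type} [DecidableEq ι] (S : Finset ι) (i : ι) : EquivMap V V 0 :=
  if i ∈ S then π else π.compl

theorem part_of_mem (π : EquivMap V V 0) {ι : Type} [DecidableEq ι] {S : Finset ι} {i : ι}
    (h : i ∈ S) : π.part S i = π := if_pos h

theorem part_of_notMem (π : EquivMap V V 0) {ι : Type} [DecidableEq ι] {S : Finset ι} {i : ι}
    (h : i ∉ S) : π.part S i = π.compl := if_neg h

end EquivMap

namespace TreeMap

variable {V : GrSMod.{w, u} K} {W : GrSMod.{w, u'} K} {k l l' m m' n : ℤ}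

/-- The map `∑_S |S|⁻¹ A((⨂_{i ∈ S} π) ⊗ (⨂_{i ∉ S} (1 - π)))`, where the sum runs over the
nonempty sets `S` of vertices (the term of the empty set vanishes, since `0⁻¹ = 0`). If `π` is
idempotent, this is `A` composed with the inverse of `∑_v π_v` on the image of this operator. -/
noncomputable def spread (A : TreeMap V W k) (π : EquivMap V V 0) : TreeMap V W k where
  map {ι _} _ _ _ T := ∑ S : Finset ι, (S.card : K)⁻¹ •
    (A.map T).compLinearMap fun i => (π.part S i).ext (T.In i)
  map_mem {ι _} _ _ _ T x e hx := by
    rw [_root_.sum_apply]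
    refine Submodule.sum_mem _ fun S _ => Submodule.smul_mem _ _ ?_
    refine A.map_mem T _ e fun v => ?_
    have := (π.part S v).ext_mem (hx v)
    rwa [add_zero] at this
  natural {ι L ι' L'} _ _ _ _ _ _ T T' φ ψ h e x x' hx hx' := by
    rw [_root_.sum_apply, _root_.sum_apply, map_sum, Finset.smul_sum]
    symm
    refine Fintype.sum_equiv φ.finsetCongr _ _ fun S => ?_
    change koszul φ e • W.reindex ψ ((S.card : K)⁻¹ • A.map T fun i =>
      (π.part S i).ext (T.In i) (x i)) = ((S.map φ.toEmbedding).card : K)⁻¹ • A.map T' fun i =>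
        (π.part (S.map φ.toEmbedding) i).ext (T'.In i) (x' i)
    have h1 := A.natural T T' φ ψ h e (fun i => (π.part S i).ext (T.In i) (x i))
      (fun i => (π.part (S.map φ.toEmbedding) i).ext (T'.In i) (x' i)) (fun v => by
        have := (π.part S v).ext_mem (hx v)
        rwa [add_zero] at this) fun v => by
        rw [hx', EquivMap.ext_reindex]
        have : π.part (S.map φ.toEmbedding) (φ v) = π.part S v := by
          unfold EquivMap.part
          simp only [Finset.mem_map_equiv, Equiv.symm_apply_apply]
        rw [this]
    rw [h1, Finset.card_map, koszul_smul (K := K), koszul_smul (K := K), map_smul, smul_comm]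
  map_trivial {ι _} _ _ _ _ T := by
    refine Finset.sum_eq_zero fun S _ => ?_
    rw [A.map_trivial]
    exact smul_zero _

variable {ι L : Type} [Fintype ι] [LinearOrder ι] [Finite L] {T : RTree ι L} {e : ι → ℤ}
  {x : ∀ v, V.ext (T.In v)}

theorem spread_apply (A : TreeMap V W k) (π : EquivMap V V 0) (T : RTree ι L)
    (x : ∀ v, V.ext (T.In v)) : (A.spread π).map T x = ∑ S : Finset ι, (S.card : K)⁻¹ •
      A.map T fun i => (π.part S i).ext (T.In i) (x i) := by
  change (∑ S : Finset ι, (S.card : K)⁻¹ •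
    (A.map T).compLinearMap fun i => (π.part S i).ext (T.In i)) x = _
  rw [_root_.sum_apply]
  rfl

/-- The map `A.spread π` inverts the operator `∑_v π_v`, except on the part of `A` where `1 - π` is
applied to all the labels. -/
theorem sum_spread_update [CharZero K] (A : TreeMap V W k) {π : EquivMap V V 0}
    (hπ : ∀ (X : Type) (x : V.ext X), π.ext X (π.ext X x) = π.ext X x) (T : RTree ι L)
    (x : ∀ v, V.ext (T.In v)) :
    ∑ t, (A.spread π).map T (Function.update x t (π.ext _ (x t))) =
      A.map T x - A.map T fun v => x v - π.ext _ (x v) := by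
  have key : ∀ (S : Finset ι) (t : ι), (A.map T fun i => (π.part S i).ext (T.In i)
      (Function.update x t (π.ext _ (x t)) i)) =
      if t ∈ S then A.map T fun i => (π.part S i).ext (T.In i) (x i) else 0 := by
    intro S t
    split_ifs with h
    · congr 1
      funext i
      by_cases hi : i = t
      · subst hi
        rw [Function.update_self, π.part_of_mem h, hπ]
      · rw [Function.update_of_ne hi]
    · refine MultilinearMap.map_coord_zero _ t ?_
      rw [Function.update_self, π.part_of_notMem h, EquivMap.compl_ext, hπ]
      exact sub_self (π.ext _ (x t))
  have h1 : ∀ S : Finset ι, ∑ t, ((S.card : K)⁻¹ • A.map T fun i => (π.part S i).ext (T.In i)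
      (Function.update x t (π.ext _ (x t)) i)) =
      (A.map T fun i => (π.part S i).ext (T.In i) (x i)) -
        if S = ∅ then A.map T fun v => x v - π.ext _ (x v) else 0 := by
    intro S
    simp only [key]
    rw [← Finset.smul_sum, Finset.sum_ite_mem, Finset.univ_inter, Finset.sum_const,
      ← Nat.cast_smul_eq_nsmul K, smul_smul]
    split_ifs with h
    · subst h
      rw [Finset.card_empty, Nat.cast_zero, mul_zero, zero_smul, eq_comm, sub_eq_zero]
      congr 1
    · rw [inv_mul_cancel₀, one_smul]
      · exact (sub_zero (A.map T fun i => (π.part S i).ext (T.In i) (x i))).symm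
      · exact Nat.cast_ne_zero.2 (Finset.card_ne_zero.2 (Finset.nonempty_iff_ne_empty.2 h))
  simp only [spread_apply]
  rw [Finset.sum_comm, Finset.sum_congr rfl fun S _ => h1 S, Finset.sum_sub_distrib,
    Finset.sum_ite_eq' Finset.univ, if_pos (Finset.mem_univ _)]
  congr 1
  have h2 := (A.map T).map_add_univ (fun i => π.ext _ (x i)) fun i => x i - π.ext _ (x i)
  have h3 : ((fun i => π.ext _ (x i)) + fun i => x i - π.ext _ (x i)) = x :=
    funext fun i => add_sub_cancel (π.ext _ (x i)) (x i)
  rw [h3] at h2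
  rw [h2]
  refine Finset.sum_congr rfl fun S _ => congrArg _ (funext fun i => ?_)
  by_cases hi : i ∈ S
  · rw [π.part_of_mem hi, Finset.piecewise_eq_of_mem _ _ _ hi]
  · rw [π.part_of_notMem hi, Finset.piecewise_eq_of_notMem _ _ _ hi]
    rfl

theorem update_mem {φ : EquivMap V V l} (hx : ∀ v, x v ∈ V.extGr _ (e v)) (t v : ι) :
    Function.update x t (φ.ext _ (x t)) v ∈ V.extGr _ (Function.update e t (e t + l) v) := by
  by_cases h : v = t
  · subst h
    rw [Function.update_self, Function.update_self]
    exact φ.ext_mem (hx v)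
  · rw [Function.update_of_ne h, Function.update_of_ne h]
    exact hx v

theorem par_update (hl : (l : ZMod 2) = 1) (s t : ι) :
    ∑ i with i < t, par (Function.update e s (e s + l)) i =
      ∑ i with i < t, par e i + if s < t then 1 else 0 := by
  have : ∀ i, par (Function.update e s (e s + l)) i = par e i + if s = i then 1 else 0 := by
    intro i
    unfold par
    by_cases h : s = i
    · subst h
      rw [Function.update_self, if_pos rfl, Int.cast_add, hl]
    · rw [Function.update_of_ne (Ne.symm h), if_neg h, add_zero]
  simp only [this, Finset.sum_add_distrib, Finset.sum_ite_eq, Finset.mem_filter, Finset.mem_univ,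
    true_and]

theorem neg_smul_add_smul {M : Type*} [AddCommGroup M] [Module K M] (a : K) (y : M) :
    (-a) • y + a • y = 0 := by
  rw [neg_smul, neg_add_cancel]

/-- The coderivations given by two maps of generators of odd degrees anticommute, up to the
coderivation given by their anticommutator. -/
theorem star_ofEquiv_add_star_ofEquiv (B : TreeMap V W k) (φ : EquivMap V V l)
    (φ' : EquivMap V V l') (hl : (l : ZMod 2) = 1) (hl' : (l' : ZMod 2) = 1) (hm : k + l = m)
    (hm' : k + l' = m') (hn : m + l' = n) (hn' : m' + l = n) (hx : ∀ v, x v ∈ V.extGr _ (e v)) :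
    ((B.star (ofEquiv φ) hm).star (ofEquiv φ') hn).map T x +
      ((B.star (ofEquiv φ') hm').star (ofEquiv φ) hn').map T x =
    ∑ t, B.map T (Function.update x t (φ.ext _ (φ'.ext _ (x t)) + φ'.ext _ (φ.ext _ (x t)))) := by
  have key : ∀ {l l' m : ℤ} (φ : EquivMap V V l) (φ' : EquivMap V V l') (_ : (l : ZMod 2) = 1)
      (_ : (l' : ZMod 2) = 1) (hm : k + l = m) (hn : m + l' = n),
      ((B.star (ofEquiv φ) hm).star (ofEquiv φ') hn).map T x =
      ∑ s, ∑ t, sgn K (∑ i with i < s, par e i + ∑ i with i < t, par e i +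
        if s < t then 1 else 0) • B.map T (Function.update (Function.update x s (φ'.ext _ (x s))) t
          (φ.ext _ (Function.update x s (φ'.ext _ (x s)) t))) := by
    intro l l' m φ φ' hl hl' hm hn
    rw [star_ofEquiv _ _ _ hx]
    refine Finset.sum_congr rfl fun s _ => ?_
    rw [star_ofEquiv _ _ _ (update_mem hx s), Finset.smul_sum]
    refine Finset.sum_congr rfl fun t _ => ?_
    simp only [hl, hl', one_mul]
    rw [par_update hl', smul_smul, ← sgn_add, add_assoc]
  rw [key φ φ' hl hl', key φ' φ hl' hl, Finset.sum_comm (s := Finset.univ (α := ι)),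
    ← Finset.sum_add_distrib]
  refine Finset.sum_congr rfl fun s _ => ?_
  rw [← Finset.sum_add_distrib, Finset.sum_eq_single s]
  · rw [if_neg (lt_irrefl s), add_zero, CharTwo.add_self_eq_zero, sgn_zero, one_smul, one_smul,
      Function.update_self, Function.update_self, Function.update_idem, Function.update_idem]
    exact ((B.map T).map_update_add x s _ _).symm
  · intro t _ hts
    rw [Function.update_of_ne hts, Function.update_of_ne (Ne.symm hts),
      Function.update_comm hts]
    rcases lt_or_gt_of_ne hts with h | h
    · rw [if_pos h, if_neg h.not_gt, add_zero, sgn_add, sgn_one, mul_neg_one,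
        add_comm (∑ i with i < t, par e i)]
      exact neg_smul_add_smul _ _
    · rw [if_pos h, if_neg h.not_gt, add_zero, sgn_add _ 1, sgn_one, mul_neg_one,
        add_comm (∑ i with i < t, par e i)]
      exact (add_comm _ _).trans (neg_smul_add_smul _ _)
  · simp

/-- The map `A.spread π` composed with a coderivation given by a map of generators that commutes
with `π`. -/
theorem spread_star_ofEquiv (A : TreeMap V W k) {π : EquivMap V V 0} {φ : EquivMap V V l}
    (h : ∀ (X : Type) (x : V.ext X), π.ext X (φ.ext X x) = φ.ext X (π.ext X x)) (hm : k + l = m)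
    (hx : ∀ v, x v ∈ V.extGr _ (e v)) : ((A.spread π).star (ofEquiv φ) hm).map T x =
      ∑ S : Finset ι, (S.card : K)⁻¹ • (A.star (ofEquiv φ) hm).map T
        fun i => (π.part S i).ext (T.In i) (x i) := by
  have hxS : ∀ (S : Finset ι) v, (π.part S v).ext (T.In v) (x v) ∈ V.extGr _ (e v) := by
    intro S v
    have := (π.part S v).ext_mem (hx v)
    rwa [add_zero] at this
  have hS : ∀ (S : Finset ι) (i : ι) (y : V.ext (T.In i)), (π.part S i).ext _ (φ.ext _ y) =
      φ.ext _ ((π.part S i).ext _ y) := by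
    intro S i y
    by_cases hi : i ∈ S
    · rw [π.part_of_mem hi, h]
    · rw [π.part_of_notMem hi, EquivMap.compl_ext, EquivMap.compl_ext, h]
      exact (map_sub (φ.ext _) y (π.ext _ y)).symm
  rw [star_ofEquiv _ _ _ hx]
  simp only [spread_apply, Finset.smul_sum]
  rw [Finset.sum_comm]
  refine Finset.sum_congr rfl fun S _ => ?_
  rw [star_ofEquiv _ _ _ (hxS S), Finset.smul_sum]
  refine Finset.sum_congr rfl fun t _ => ?_
  rw [smul_comm]
  refine congrArg _ (congrArg _ (congrArg _ (funext fun i => ?_)))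
  by_cases hi : i = t
  · subst hi
    rw [Function.update_self, Function.update_self, hS]
  · rw [Function.update_of_ne hi, Function.update_of_ne hi]

end TreeMap

/-! ### Maps that preserve the kernel of a projection -/

open TreeMap RTree RTree.Partition

theorem RTree.Partition.card_roots_eq_one_iff {ι L : Type} [Fintype ι] [LinearOrder ι] [Finite L]
    {T : RTree ι L} {B : T.Partition} {v₀ : ι} (hv₀ : T.target (Sum.inl v₀) = none) :
    Fintype.card B.Roots = 1 ↔ B = whole T v₀ hv₀ := by
  refine ⟨fun h => eq_whole h hv₀, ?_⟩
  rintro rfl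
  exact Fintype.card_eq_one_iff.2 ⟨⟨v₀, rfl⟩, fun r => Subtype.ext r.2.symm⟩

namespace TreeMap

variable {V : GrSMod.{w, u} K} {W : GrSMod.{w, u'} K} {k l m : ℤ}

/-- On the trees with at most `n` vertices, the map `α` sends the homogeneous labellings with at
least one label in the kernel of `p` to the kernel of `p`. -/
def PreservesKernel (p : EquivMap V W 0) (n : ℕ) (α : TreeMap V V k) : Prop :=
  ∀ {ι L : Type} [Fintype ι] [LinearOrder ι] [Finite L] (T : RTree ι L) (e : ι → ℤ)
    (x : ∀ v, V.ext (T.In v)), Fintype.card ι ≤ n → (∀ v, x v ∈ V.extGr _ (e v)) →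
    ∀ v, p.ext _ (x v) = 0 → p.ext L (α.map T x) = 0

variable {p : EquivMap V W 0} {n n' : ℕ}

theorem preservesKernel_ofEquiv {φ : EquivMap V V k}
    (h : ∀ (X : Type) (x : V.ext X), p.ext X x = 0 → p.ext X (φ.ext X x) = 0) :
    (ofEquiv φ).PreservesKernel p n := by
  intro ι L _ _ _ T e x _ _ v hv
  by_cases hc : Fintype.card ι = 1
  · obtain ⟨y, hy⟩ := Fintype.card_eq_one_iff.1 hc
    rw [ofEquiv_of_unique φ T x (v := v) fun s => (hy s).trans (hy v).symm, ← transfer_ext,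
      h _ _ hv, map_zero]
  · rw [ofEquiv_of_card_ne φ T hc]
    exact map_zero _

variable {ι L : Type} [Fintype ι] [LinearOrder ι] [Finite L] {T : RTree ι L} {e : ι → ℤ}
  {x : ∀ v, V.ext (T.In v)}

theorem PreservesKernel.glue {g : TreeMap V V k} {α : TreeMap V V l} (hg : g.PreservesKernel p n)
    (hα : α.PreservesKernel p n') {B : T.Partition} (r : B.Roots)
    (hB : Fintype.card B.Roots ≤ n) (hB' : ∀ s, Fintype.card (B.Block s) ≤ n')
    (hx : ∀ v, x v ∈ V.extGr _ (e v)) {v : ι} (hv : p.ext _ (x v) = 0) :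
    p.ext L (B.glue g.toOMap (fun v => if v = r.1 then α.toOMap
      else (ofEquiv (EquivMap.id V)).toOMap) x) = 0 := by
  have hgr : ∀ v, (if v = r.1 then α.toOMap
      else (ofEquiv (EquivMap.id V)).toOMap).IsGr (if v = r.1 then l else 0) := by
    intro v
    split_ifs
    · exact α.isGr
    · exact (ofEquiv (EquivMap.id V)).isGr
  rw [glue_apply]
  refine hg B.quot _ _ hB (B.glue_label_mem hgr hx) (B.root v) ?_
  have hw : p.ext _ (B.restrict V x (B.root v) ⟨v, rfl⟩) = 0 := by
    unfold restrict
    rw [EquivMap.ext_reindex, hv, map_zero]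
  split_ifs
  · exact hα _ _ _ (hB' _) (B.restrict_mem hx _) _ hw
  · exact preservesKernel_ofEquiv (n := n') (φ := EquivMap.id V) (fun _ _ h => h) _ _ _ (hB' _)
      (B.restrict_mem hx _) _ hw

/-- If `γ` preserves the kernel of `p` on the smaller trees, then modulo this kernel only the
differential of generators contributes to the square of the coderivation given by `γ`. -/
theorem PreservesKernel.ext_star_self {γ : TreeMap V V k} {d : EquivMap V V k}
    (hγ : γ.PreservesKernel p n) (hd : γ.Extends d)
    (hpd : ∀ (X : Type) (x : V.ext X), p.ext X x = 0 → p.ext X (d.ext X x) = 0)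
    (hm : k + k = m) (hn : 1 ≤ n) (hc : Fintype.card ι = n + 1)
    (hx : ∀ v, x v ∈ V.extGr _ (e v)) {v : ι} (hv : p.ext _ (x v) = 0) :
    p.ext L ((γ.star γ hm).map T x) = p.ext L ((γ.star (ofEquiv d) hm).map T x) +
      p.ext L (d.ext L (γ.map T x)) := by
  have : Nonempty ι := ⟨v⟩
  obtain ⟨v₀, hv₀⟩ := T.exists_root_vertex
  rw [← ofEquiv_star _ _ hm hx, star_apply _ _ _ hx, star_apply _ _ _ hx, star_apply _ _ _ hx,
    map_sum, map_sum, map_sum, ← Finset.sum_add_distrib]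
  refine Finset.sum_congr rfl fun B _ => ?_
  rw [map_sum, map_sum, map_sum, ← Finset.sum_add_distrib]
  refine Finset.sum_congr rfl fun r _ => ?_
  rw [map_smul, map_smul, map_smul]
  refine Eq.trans (congrArg _ ?_) (smul_add _ _ _)
  have hz : ∀ C : T.Partition, Fintype.card C.Roots ≠ 1 → ∀ h : ι → OMap V V,
      p.ext L (C.glue (ofEquiv d).toOMap h x) = 0 := by
    intro C hC h
    rw [C.glue_ofEquiv_left d h hC]
    exact map_zero _
  rcases eq_or_ne B (whole T v₀ hv₀) with rfl | hB
  · have h1 := (card_roots_eq_one_iff hv₀).2 rfl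
    have h2 : Fintype.card ((whole T v₀ hv₀).Block r) ≠ 1 := by
      have h3 : Fintype.card ((whole T v₀ hv₀).Block r) = Fintype.card ι :=
        Fintype.card_congr (Equiv.subtypeUnivEquiv fun _ => r.2)
      omega
    have h4 : (whole T v₀ hv₀).glue γ.toOMap (fun v => if v = r.1 then (ofEquiv d).toOMap
        else (ofEquiv (EquivMap.id V)).toOMap) = 0 := by
      refine glue_eq_zero _ _ _ r ?_
      rw [if_pos rfl]
      exact ofEquiv_of_card_ne d _ h2
    rw [h4, _root_.zero_apply, map_zero]
    refine Eq.trans ?_ (zero_add _).symm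
    rw [glue_apply, glue_apply]
    exact congrArg _ (congrArg (fun F : MultilinearMap K _ _ => F _) (hd _ h1))
  · rw [hz B fun h => hB ((card_roots_eq_one_iff hv₀).1 h)]
    refine Eq.trans ?_ (add_zero _).symm
    rcases eq_or_ne B (discrete T) with rfl | hB'
    · rw [glue_apply, glue_apply]
      refine congrArg _ (congrArg _ (funext fun s => ?_))
      split_ifs
      · exact congrArg (fun F : MultilinearMap K _ _ => F _) (hd _ (card_block_discrete s))
      · rfl
    · have h1 := card_roots_lt hB'
      have h2 := fun s => Nat.le_of_lt_succ (hc ▸ card_block_lt hv₀ hB s)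
      rw [hγ.glue hγ r (by omega) h2 hx hv,
        hγ.glue (preservesKernel_ofEquiv hpd) r (by omega) h2 hx hv]

end TreeMap

section Cogen

variable {P : DGSMod.{w, u} K} {Q : DGSMod.{w, u'} K}

theorem EquivMap.ext_curvature (p : EquivMap P.toGrSMod Q.toGrSMod 0) {ι L : Type} [Fintype ι]
    [LinearOrder ι] (T : RTree ι L) (x : ∀ v, P.cogen.ext (T.In v)) :
    p.cogen.ext L (P.curvature T x) = Q.curvature T fun v => p.cogen.ext _ (x v) := by
  unfold DGSMod.curvature
  split_ifs
  · rw [map_sum]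
    refine Finset.sum_congr rfl fun u _ => ?_
    rw [map_sum]
    refine Finset.sum_congr rfl fun c _ => ?_
    split_ifs
    · exact map_zero _
    · rw [map_smul, transfer_ext, EquivMap.theta_cogen]
    · rw [map_smul, transfer_ext, EquivMap.theta_cogen]
  · exact map_zero _

theorem DGSMod.curvature_eq_zero {ι L : Type} [Fintype ι] [LinearOrder ι] {T : RTree ι L}
    {x : ∀ v, P.cogen.ext (T.In v)} {v : ι} (hv : x v = 0) : P.curvature T x = 0 := by
  unfold DGSMod.curvature
  split_ifs with hc
  · refine Finset.sum_eq_zero fun u _ => Finset.sum_eq_zero fun c _ => ?_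
    by_cases huc : u = c
    · rw [if_pos huc]
    rw [if_neg huc]
    by_cases hu : u = v
    · subst hu
      rw [hv, DGSMod.theta_zero, neg_zero, ite_self]
      exact zero_smul K (T.transfer P.cogen c (x c))
    · by_cases hcv : c = v
      · subst hcv
        rw [hv, map_zero, smul_zero]
      · have h1 : ({u, c, v} : Finset ι).card = 3 := Finset.card_eq_three.2
          ⟨u, c, v, huc, hu, hcv, rfl⟩
        have h2 := Finset.card_le_univ ({u, c, v} : Finset ι)
        omega
  · rfl

end Cogen

namespace HomotopyOperad

variable [CharZero K] {P : DGSMod.{w, u} K} {Q : DGSMod.{w, u'} K} (hP : HomotopyOperad P)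
  (p : P.Hom Q)

/-- The map `f` gives an `∞`-isotopy with source `hP`, whose target preserves the kernel of `p` on
the trees with at most `n` vertices. -/
structure IsAdapted (n : ℕ) (f : TreeMap P.cogen P.cogen 0) : Prop where
  ext : f.Extends (EquivMap.id P.cogen)
  theta : ∀ {ι L : Type} [Fintype ι] [LinearOrder ι] [Finite L] (T : RTree ι L)
    (x : ∀ v : ι, P.cogen.ext (T.In v)), P.theta L (f.map T x) = P.theta L (T.proj P.cogen x)
  ker : (transport f hP.γ).PreservesKernel p.toEquivMap.cogen n

theorem barDiff_mem_ker {X : Type} {x : P.cogen.ext X} (hx : p.toEquivMap.cogen.ext X x = 0) :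
    p.toEquivMap.cogen.ext X ((P.barDiff hP.one hP.one_mem).ext X x) = 0 := by
  have h := p.map_mem 1 0 _ hP.one_mem
  rw [add_zero] at h
  rw [p.cogen_barDiff hP.one_mem h, hx, map_zero]

theorem isAdapted_one : hP.IsAdapted p 1 (ofEquiv (EquivMap.id P.cogen)) where
  ext _ _ := rfl
  theta T x := by rw [proj_eq]
  ker := by
    intro ι L _ _ _ T e x hc hx v hv
    have h := transport_extends (f := ofEquiv (EquivMap.id P.cogen)) (fun _ _ => rfl)
      hP.extends_barDiff T (hc.antisymm (Fintype.card_pos_iff.2 ⟨v⟩))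
    rw [h]
    exact preservesKernel_ofEquiv (n := 1) (fun _ _ => hP.barDiff_mem_ker p) T e x hc hx v hv

variable {hP p}

/-- An adapted map can be corrected so that it is adapted up to the next number of vertices. -/
theorem IsAdapted.exists_next {n : ℕ} (hn : 1 ≤ n) {f : TreeMap P.cogen P.cogen 0}
    (hf : hP.IsAdapted p n f) {k : EquivMap P.toGrSMod P.toGrSMod 1}
    (hk : ∀ n x, p.map n (k.map n x) = 0)
    (hk' : ∀ n x, p.map n x = 0 → P.d.map n (k.map n x) + k.map n (P.d.map n x) = x) :
    ∃ f' : TreeMap P.cogen P.cogen 0, hP.IsAdapted p (n + 1) f' ∧ f'.AgreeBelow (n + 1) f := by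
  set q := p.toEquivMap.cogen with hq
  set d := P.barDiff hP.one hP.one_mem with hd
  set h := EquivMap.cogenHomotopy k with hh
  set π := EquivMap.commutator d h with hπ
  set A := transport f hP.γ with hA
  have hone := p.map_mem 1 0 _ hP.one_mem
  rw [add_zero] at hone
  set dQ := Q.barDiff (p.map 1 hP.one) hone with hdQ
  have hqd : ∀ (X : Type) (x : P.cogen.ext X), q.ext X (d.ext X x) = dQ.ext X (q.ext X x) :=
    fun X x => p.cogen_barDiff hP.one_mem hone x
  have hqh : ∀ (X : Type) (x : P.cogen.ext X), q.ext X (h.ext X x) = 0 :=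
    fun X x => EquivMap.cogen_cogenHomotopy hk x
  have hdd : ∀ (X : Type) (x : P.cogen.ext X), d.ext X (d.ext X x) = 0 :=
    fun X x => hP.barDiff_barDiff x
  have hqπ : ∀ (X : Type) (x : P.cogen.ext X), q.ext X (π.ext X x) = 0 := by
    intro X x
    rw [hπ, EquivMap.commutator_ext, map_add, hqd, hqh, hqh, map_zero]
    exact add_zero _
  have hπid : ∀ (X : Type) (x : P.cogen.ext X), q.ext X x = 0 → π.ext X x = x :=
    fun X x hx => EquivMap.commutator_of_mem_ker hk' hP.one_mem hx
  have hππ : ∀ (X : Type) (x : P.cogen.ext X), π.ext X (π.ext X x) = π.ext X x :=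
    fun X x => hπid X _ (hqπ X x)
  have hπd : ∀ (X : Type) (x : P.cogen.ext X), π.ext X (d.ext X x) = d.ext X (π.ext X x) := by
    intro X x
    rw [hπ, EquivMap.commutator_ext, EquivMap.commutator_ext, map_add, hdd, hdd, map_zero]
    exact (add_zero _).trans (zero_add _).symm
  have hAd : A.Extends d := transport_extends hf.ext hP.extends_barDiff
  have hqd0 : ∀ (X : Type) (x : P.cogen.ext X), q.ext X x = 0 → q.ext X (d.ext X x) = 0 :=
    fun X x hx => by rw [hqd, hx, map_zero]
  -- the correction of `f` on the trees with `n + 1` vertices: `A` composed with a contraction of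
  -- the tensors with at least one factor in the kernel of `p`. This contraction is `h` followed by
  -- the inverse of `∑_v π_v`, which is the commutator of `d` and `h` on tensors
  let u : TreeMap P.cogen P.cogen 0 := (A.spread π).star (ofEquiv h) (neg_add_cancel 1)
  let f' : TreeMap P.cogen P.cogen 0 := diag fun m => if m = n + 1 then f - u else f
  have hf'n : ∀ {ι L : Type} [Fintype ι] [LinearOrder ι] [Finite L] (T : RTree ι L),
      Fintype.card ι ≠ n + 1 → f'.map T = f.map T := by
    intro ι L _ _ _ T hc
    rw [diag_map, if_neg hc]
  have hf'u : ∀ {ι L : Type} [Fintype ι] [LinearOrder ι] [Finite L] (T : RTree ι L)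
      (x : ∀ v, P.cogen.ext (T.In v)), Fintype.card ι = n + 1 →
      f'.map T x = f.map T x - u.map T x := by
    intro ι L _ _ _ T x hc
    rw [diag_map, if_pos hc, TreeMap.sub_apply]
  have hagree : f'.AgreeBelow (n + 1) f := fun T hc => hf'n T hc.ne
  have hext : f'.Extends (EquivMap.id P.cogen) := fun T hc =>
    (hf'n T (by omega)).trans (hf.ext T hc)
  have hθA : ∀ {ι L : Type} [Fintype ι] [LinearOrder ι] [Finite L] (T : RTree ι L)
      (x : ∀ v, P.cogen.ext (T.In v)), P.thetaLin L ((A.spread π).map T x) = 0 := by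
    intro ι L _ _ _ T x
    rw [spread_apply, map_sum]
    refine Finset.sum_eq_zero fun S _ => ?_
    rw [map_smul, DGSMod.thetaLin_apply, hP.theta_transport hf.ext hf.theta, smul_zero]
  have hθu : ∀ {ι L : Type} [Fintype ι] [LinearOrder ι] [Finite L] (T : RTree ι L)
      (x : ∀ v, P.cogen.ext (T.In v)), P.thetaLin L (u.map T x) = 0 := by
    intro ι L _ _ _ T x
    suffices h : (P.thetaLin L).compMultilinearMap (u.map T) = 0 from
      congrArg (fun F : MultilinearMap K _ _ => F x) h
    refine multilinear_ext_homogeneous fun e x hx => ?_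
    change P.thetaLin L (u.map T x) = 0
    rw [star_ofEquiv _ _ _ hx, map_sum]
    refine Finset.sum_eq_zero fun t _ => ?_
    rw [map_smul, hθA, smul_zero]
  refine ⟨f', ⟨hext, fun {ι L} _ _ _ T x => ?_, ?_⟩, hagree⟩
  · by_cases hc : Fintype.card ι = n + 1
    · rw [hf'u T x hc, ← DGSMod.thetaLin_apply]
      refine (map_sub (P.thetaLin L) _ _).trans ?_
      rw [hθu, sub_zero, DGSMod.thetaLin_apply, hf.theta]
    · rw [hf'n T hc, hf.theta]
  intro ι L _ _ _ T e x hc hx v hv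
  rcases Nat.lt_or_ge (Fintype.card ι) (n + 1) with hc' | hc'
  · rw [transport_agreeBelow hf.ext hext hP.extends_barDiff hagree T hc']
    exact hf.ker T e x (by omega) hx v hv
  have hcn : Fintype.card ι = n + 1 := by omega
  -- on labels one of which is in the kernel of `p`, the map `A` anticommutes with the differentials
  -- modulo this kernel
  have hA2 : ∀ (z : ∀ v, P.cogen.ext (T.In v)) (e : ι → ℤ),
      (∀ v, z v ∈ P.cogen.extGr _ (e v)) → ∀ v, q.ext _ (z v) = 0 →
      q.ext L ((A.star (ofEquiv d) (m := -2) (by norm_num)).map T z) =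
        -dQ.ext L (q.ext L (A.map T z)) := by
    intro z e hz v hv
    have h1 := PreservesKernel.ext_star_self (T := T) hf.ker hAd hqd0 (m := -2) (by norm_num) hn hcn
      hz hv
    rw [hP.transport_star_transport hf.ext hf.theta T hz, EquivMap.ext_curvature,
      DGSMod.curvature_eq_zero hv, hqd] at h1
    exact eq_neg_of_add_eq_zero_left h1.symm
  -- the labels in `A.spread π` are in the kernel of `p` at the elements of `S`
  have hA3 : ∀ (z : ∀ v, P.cogen.ext (T.In v)) (e : ι → ℤ),
      (∀ v, z v ∈ P.cogen.extGr _ (e v)) →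
      q.ext L (((A.spread π).star (ofEquiv d) (m := -2) (by norm_num)).map T z) =
        -dQ.ext L (q.ext L ((A.spread π).map T z)) := by
    intro z e hz
    rw [spread_star_ofEquiv A hπd _ hz, spread_apply, map_sum, map_sum, map_sum]
    refine Eq.trans ?_ (Finset.sum_neg_distrib _)
    refine Finset.sum_congr rfl fun S _ => ?_
    rw [map_smul, map_smul, map_smul]
    refine Eq.trans ?_ (smul_neg _ _)
    rcases S.eq_empty_or_nonempty with rfl | ⟨s, hs⟩
    · rw [Finset.card_empty, Nat.cast_zero, inv_zero]
      exact (zero_smul K _).trans (zero_smul K _).symm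
    · refine congrArg _ (hA2 _ e (fun v => ?_) s ?_)
      · have := (π.part S v).ext_mem (hz v)
        rwa [add_zero] at this
      · rw [π.part_of_mem hs, hqπ]
  have hA4 : q.ext L ((((A.spread π).star (ofEquiv d) (m := -2) (by norm_num)).star (ofEquiv h)
      (m := -1) (by norm_num)).map T x) = -dQ.ext L (q.ext L (u.map T x)) := by
    rw [star_ofEquiv _ _ _ hx, star_ofEquiv _ _ _ hx, map_sum, map_sum, map_sum]
    refine Eq.trans ?_ (Finset.sum_neg_distrib _)
    refine Finset.sum_congr rfl fun t _ => ?_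
    rw [map_smul, map_smul, map_smul, hA3 _ _ (update_mem hx t)]
    exact smul_neg _ _
  -- on labels one of which is in the kernel of `p`, the commutator of `u` and the differentials is
  -- `A` modulo the kernel of `p`, so that the correction cancels `A`
  have hA5 := star_ofEquiv_add_star_ofEquiv (A.spread π) h d (l := 1) (l' := -1) (m := 0)
    (m' := -2) (n := -1) rfl rfl (by norm_num) (by norm_num) (by norm_num) (by norm_num) hx
  have hA6 : ∑ t, (A.spread π).map T (Function.update x t
      (h.ext _ (d.ext _ (x t)) + d.ext _ (h.ext _ (x t)))) = A.map T x := by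
    have h1 := sum_spread_update A hππ T x
    have h2 : A.map T (fun v => x v - π.ext _ (x v)) = 0 := by
      refine MultilinearMap.map_coord_zero _ v ?_
      rw [hπid _ _ hv]
      exact sub_self (x v)
    rw [h2] at h1
    refine Eq.trans (Finset.sum_congr rfl fun t _ => ?_) (h1.trans (sub_zero (A.map T x)))
    rw [hπ, EquivMap.commutator_ext, add_comm]
  rw [hA6] at hA5
  have hA7 : ((f' - f).star (ofEquiv d) (zero_add (-1))).map T x =
      -(u.star (ofEquiv d) (zero_add (-1))).map T x := by
    rw [star_ofEquiv _ _ _ hx, star_ofEquiv _ _ _ hx]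
    refine Eq.trans ?_ (Finset.sum_neg_distrib _)
    refine Finset.sum_congr rfl fun t _ => ?_
    rw [TreeMap.sub_apply, hf'u T _ hcn]
    refine Eq.trans ?_ (smul_neg _ _)
    exact congrArg _ (sub_sub_cancel_left (f.map T _) (u.map T _))
  rw [transport_sub_transport hf.ext hext hP.extends_barDiff (fun T' hT' => hagree T' (by omega))
    (fun T' hT' => transport_agreeBelow hf.ext hext hP.extends_barDiff hagree T' (by omega))
    (by omega) hx, hA7, hf'u T x hcn, ← hA]
  have hA8 := congrArg (q.ext L) hA5
  rw [map_add, hA4] at hA8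
  rw [map_add, map_sub, ← hA8, map_neg, map_sub, hqd, hqd, map_sub, map_sub]
  change _ + _ + (-q.ext L ((u.star (ofEquiv d) (zero_add (-1))).map T x) - _) = _
  abel

end HomotopyOperad

/-! ### The limit of the corrections and its direct image -/

open TreeMap RTree RTree.Partition

/-- A homotopy operad structure is isotopic to one that preserves the kernel of an acyclic
fibration. -/
theorem HomotopyOperad.exists_isAdapted [CharZero K] {P : DGSMod.{w, u} K} {Q : DGSMod.{w, u'} K}
    (hP : HomotopyOperad P) {p : P.Hom Q} (hp : p.IsAcyclicFibration) :
    ∃ f : TreeMap P.cogen P.cogen 0, ∀ n, hP.IsAdapted p n f := by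
  obtain ⟨k, hk, hk'⟩ := DGSMod.Hom.exists_contraction hp
  have step : ∀ n (f : {f : TreeMap P.cogen P.cogen 0 // hP.IsAdapted p (n + 1) f}),
      ∃ f' : {f : TreeMap P.cogen P.cogen 0 // hP.IsAdapted p (n + 2) f},
        f'.1.AgreeBelow (n + 2) f.1 := by
    intro n f
    obtain ⟨f', h1, h2⟩ := f.2.exists_next (Nat.succ_pos n) hk hk'
    exact ⟨⟨f', h1⟩, h2⟩
  choose next hnext using step
  let F : ∀ n, {f : TreeMap P.cogen P.cogen 0 // hP.IsAdapted p (n + 1) f} :=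
    fun n => Nat.rec ⟨_, hP.isAdapted_one p⟩ next n
  have hF : ∀ m n, m ≤ n → (F n).1.AgreeBelow (m + 2) (F m).1 := by
    intro m n hmn
    induction n, hmn using Nat.le_induction with
    | base => exact fun _ _ => rfl
    | succ n hn ih => exact fun T hT => (hnext n (F n) T (by omega)).trans (ih T hT)
  let f : TreeMap P.cogen P.cogen 0 := diag fun m => (F m).1
  have hf : ∀ n, f.AgreeBelow (n + 2) (F n).1 := by
    intro n ι L _ _ _ T hT
    rw [diag_map]
    rcases Nat.le_or_ge (Fintype.card ι) n with h | h
    · exact (hF _ _ h T (by omega)).symm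
    · exact hF _ _ h T hT
  have hext : f.Extends (EquivMap.id P.cogen) := fun T hT =>
    (hf 0 T (by omega)).trans ((F 0).2.ext T hT)
  refine ⟨f, fun n => ⟨hext, fun {ι L} _ _ _ T x => ?_, ?_⟩⟩
  · rw [hf (Fintype.card ι) T (by omega), (F _).2.theta]
  · intro ι L _ _ _ T e x hc hx v hv
    rw [transport_agreeBelow (F n).2.ext hext hP.extends_barDiff (hf n) T (by omega)]
    exact (F n).2.ker T e x (by omega) hx v hv

namespace TreeMap

variable {V : GrSMod.{w, u} K} {W : GrSMod.{w, u'} K} {k : ℤ}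

/-- The map `p ∘ α ∘ s` on the tree module of `W`, for maps of generators `p` from `V` to `W` and
`s` from `W` to `V`. -/
def pushforward (α : TreeMap V V k) (p : EquivMap V W 0) (s : EquivMap W V 0) : TreeMap W W k where
  map {ι L} _ _ _ T :=
    (p.ext L).compMultilinearMap ((α.map T).compLinearMap fun v => s.ext (T.In v))
  map_mem {ι L} _ _ _ T x e hx := by
    have h := p.ext_mem (α.map_mem T (fun v => s.ext _ (x v)) e fun v => by
      have := s.ext_mem (hx v)
      rwa [add_zero] at this)
    rwa [add_zero] at h
  natural {ι L ι' L'} _ _ _ _ _ _ T T' φ ψ h e x x' hx hx' := by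
    change p.ext L' (α.map T' fun v => s.ext _ (x' v)) =
      koszul φ e • W.reindex ψ (p.ext L (α.map T fun v => s.ext _ (x v)))
    rw [α.natural T T' φ ψ h e (fun v => s.ext _ (x v)) (fun v => s.ext _ (x' v))
      (fun v => by
        have := s.ext_mem (hx v)
        rwa [add_zero] at this)
      (fun v => by rw [hx', EquivMap.ext_reindex]), koszul_smul (K := K), koszul_smul (K := K),
      map_smul, EquivMap.ext_reindex]
  map_trivial {ι L} _ _ _ _ T := by
    rw [α.map_trivial]
    exact MultilinearMap.ext fun x => map_zero (p.ext L)

theorem pushforward_apply (α : TreeMap V V k) (p : EquivMap V W 0) (s : EquivMap W V 0)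
    {ι L : Type} [Fintype ι] [LinearOrder ι] [Finite L] (T : RTree ι L)
    (x : ∀ v, W.ext (T.In v)) :
    (α.pushforward p s).map T x = p.ext L (α.map T fun v => s.ext _ (x v)) := rfl

variable {α : TreeMap V V k} {p : EquivMap V W 0} {s : EquivMap W V 0}

/-- If `s` is a section of `p` and `α` preserves the kernel of `p`, then `p ∘ α` depends only on
the images of the labels. -/
theorem pushforward_map (hα : ∀ n, α.PreservesKernel p n)
    (hs : ∀ (X : Type) (y : W.ext X), p.ext X (s.ext X y) = y) {ι L : Type} [Fintype ι]
    [LinearOrder ι] [Finite L] {T : RTree ι L} {e : ι → ℤ} {x : ∀ v, V.ext (T.In v)}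
    (hx : ∀ v, x v ∈ V.extGr _ (e v)) :
    (α.pushforward p s).map T (fun v => p.ext _ (x v)) = p.ext L (α.map T x) := by
  have h1 := (α.map T).map_add_univ (fun i => s.ext _ (p.ext _ (x i)))
    fun i => x i - s.ext _ (p.ext _ (x i))
  have h2 : ((fun i => s.ext _ (p.ext _ (x i))) + fun i => x i - s.ext _ (p.ext _ (x i))) = x :=
    funext fun i => add_sub_cancel (s.ext _ (p.ext _ (x i))) (x i)
  rw [h2] at h1
  rw [h1, map_sum, Finset.sum_eq_single Finset.univ, Finset.piecewise_univ]
  · rfl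
  · intro S _ hS
    obtain ⟨v, hv⟩ : ∃ v, v ∉ S := by
      by_contra! h
      exact hS (Finset.eq_univ_of_forall h)
    have hmem : ∀ i, s.ext _ (p.ext _ (x i)) ∈ V.extGr _ (e i) := by
      intro i
      have := s.ext_mem (p.ext_mem (hx i))
      rwa [add_zero, add_zero] at this
    refine hα _ T e _ le_rfl (fun i => ?_) v ?_
    · by_cases hi : i ∈ S
      · rw [Finset.piecewise_eq_of_mem _ _ _ hi]
        exact hmem i
      · rw [Finset.piecewise_eq_of_notMem _ _ _ hi]
        exact Submodule.sub_mem _ (hx i) (hmem i)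
    · rw [Finset.piecewise_eq_of_notMem _ _ _ hv, map_sub, hs]
      exact sub_self (p.ext _ (x v))
  · simp

theorem pushforward_comp (hα : ∀ n, α.PreservesKernel p n)
    (hs : ∀ (X : Type) (y : W.ext X), p.ext X (s.ext X y) = y) :
    (α.pushforward p s).comp (ofEquiv p) = (ofEquiv p).star α (zero_add k) := by
  refine ext_map fun {ι L} _ _ _ T => ext_homogeneous fun e x hx => ?_
  rcases isEmpty_or_nonempty ι with h | h
  · rw [map_trivial, map_trivial]
  · rw [ofEquiv_star _ _ _ hx, ← pushforward_map hα hs hx, comp, ofParity_apply _ _ _ _ T hx,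
      compRaw_ofEquiv_right]
    rfl

theorem theta_ofEquiv_cogen {P : DGSMod.{w, u} K} {Q : DGSMod.{w, u'} K}
    (p : EquivMap P.toGrSMod Q.toGrSMod 0) {ι L : Type} [Fintype ι] [LinearOrder ι] [Finite L]
    (T : RTree ι L) (x : ∀ v : ι, P.cogen.ext (T.In v)) :
    Q.theta L ((ofEquiv p.cogen).map T x) = P.theta L (T.proj P.cogen x) := by
  by_cases hc : Fintype.card ι = 1
  · obtain ⟨y, hy⟩ := Fintype.card_eq_one_iff.1 hc
    rw [proj_eq, ofEquiv_of_unique _ _ _ hy, ofEquiv_of_unique _ _ _ hy, transfer_ext,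
      EquivMap.theta_cogen]
    rfl
  · rw [proj_eq, ofEquiv_of_card_ne _ _ hc, ofEquiv_of_card_ne _ _ hc]
    exact Q.theta_zero.trans P.theta_zero.symm

end TreeMap

namespace HomotopyOperad

variable {P : DGSMod.{w, u} K} {Q : DGSMod.{w, u'} K} (hP : HomotopyOperad P) {p : P.Hom Q}
  {s : EquivMap Q.toGrSMod P.toGrSMod 0} (hs : ∀ n y, p.map n (s.map n y) = y)
  (hker : ∀ n, hP.γ.PreservesKernel p.toEquivMap.cogen n)
include hs hker

/-- The square of the direct image is given by the curvature, since this holds after the composition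
with the surjection `p`. -/
theorem pushforward_star_pushforward {ι L : Type} [Fintype ι] [LinearOrder ι] [Finite L]
    (T : RTree ι L) {e : ι → ℤ} {y : ∀ v : ι, Q.cogen.ext (T.In v)}
    (hy : ∀ v, y v ∈ Q.cogen.extGr _ (e v)) :
    ((hP.γ.pushforward p.toEquivMap.cogen s.cogen).star
      (hP.γ.pushforward p.toEquivMap.cogen s.cogen) (m := -2) (by norm_num)).map T y =
      Q.curvature T y := by
  have hqs : ∀ (X : Type) (y : Q.cogen.ext X),
      p.toEquivMap.cogen.ext X (s.cogen.ext X y) = y := fun X y => EquivMap.cogen_comp_cogen hs y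
  have hx : ∀ v, s.cogen.ext _ (y v) ∈ P.cogen.extGr _ (e v) := by
    intro v
    have := s.cogen.ext_mem (hy v)
    rwa [add_zero] at this
  have h := hP.star_star_comp (pushforward_comp hker hqs) (theta_ofEquiv_cogen p.toEquivMap)
    (T := T) hx
  have hz : ∀ B : T.Partition, B ≠ discrete T → ∃ r : B.Roots,
      (ofEquiv p.toEquivMap.cogen).map (B.sub r)
        (B.restrict P.cogen (fun v => s.cogen.ext _ (y v)) r) = 0 := by
    intro B hB
    have : ∃ r : B.Roots, Fintype.card (B.Block r) ≠ 1 := by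
      by_contra! h
      exact hB (eq_discrete h)
    obtain ⟨r, hr⟩ := this
    refine ⟨r, ?_⟩
    rw [ofEquiv_of_card_ne _ _ hr]
    rfl
  rw [Finset.sum_eq_single (discrete T), Finset.sum_eq_single (discrete T)] at h
  · have h0 : kz (discrete T).low (par e) = 0 := kz_of_strictMono (fun _ _ h => h) _
    rw [h0, sgn_zero, one_smul, one_smul, DGSMod.curvature_discrete] at h
    have h2 := glue_discrete (f := ofEquiv p.toEquivMap.cogen) (fun _ _ => rfl) (T := T)
      (x := fun v => s.cogen.ext _ (y v)) ((hP.γ.pushforward p.toEquivMap.cogen s.cogen).star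
      (hP.γ.pushforward p.toEquivMap.cogen s.cogen) (m := -2) (by norm_num))
    rw [glue_apply] at h2
    have h3 := h2.symm.trans h
    simp only [hqs] at h3
    exact h3
  · intro B _ hB
    obtain ⟨r, hr⟩ := hz B hB
    rw [DGSMod.curvature_eq_zero hr, smul_zero]
  · simp
  · intro B _ hB
    obtain ⟨r, hr⟩ := hz B hB
    rw [MultilinearMap.map_coord_zero _ r hr, smul_zero]
  · simp

/-- The direct image of a homotopy operad structure which preserves the kernel of a fibration. -/
noncomputable def pushforwardOperad : HomotopyOperad Q where
  one := p.map 1 hP.one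
  one_mem := by
    have := p.map_mem 1 0 _ hP.one_mem
    rwa [add_zero] at this
  γ := hP.γ.pushforward p.toEquivMap.cogen s.cogen
  theta_γ T x := by
    rw [pushforward_apply, EquivMap.theta_cogen, hP.theta_γ]
  γ_generators {ι L} _ _ _ _ T x := by
    rw [pushforward_apply, hP.γ_generators, ← transfer_ext, p.cogen_barDiff,
      EquivMap.cogen_comp_cogen hs]
  γ_γ T e x hx := by
    rw [← star_eq_compCoder _ _ (by norm_num : (-1 : ℤ) + -1 = -2) hx]
    exact hP.pushforward_star_pushforward hs hker T hx

/-- The strict morphism from a homotopy operad to its direct image. -/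
noncomputable def pushforwardMorphism : InfMorphism hP (hP.pushforwardOperad hs hker) where
  f := ofEquiv p.toEquivMap.cogen
  theta_f := theta_ofEquiv_cogen p.toEquivMap
  f_γ T e x hx := by
    rw [← comp_eq_compMor _ _ hx, ← star_eq_compCoder _ _ (zero_add _) hx]
    change ((hP.γ.pushforward p.toEquivMap.cogen s.cogen).comp _).map T x = _
    rw [pushforward_comp hker fun X y => EquivMap.cogen_comp_cogen hs y]

theorem pushforwardMorphism_isStrict : (hP.pushforwardMorphism hs hker).IsStrict := by
  refine ⟨fun ι L _ _ _ T x hc => ?_, fun ι L _ _ _ _ T x hx => ?_⟩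
  · change (ofEquiv p.toEquivMap.cogen).map T x = 0
    rw [ofEquiv_of_card_ne _ _ (by omega)]
    rfl
  · change Q.desusp.ext L ((ofEquiv p.toEquivMap.cogen).map T x) = 0
    rw [ofEquiv_of_unique _ _ _ fun v => Unique.eq_default v, ← transfer_ext]
    have : Q.desusp.ext _ (p.toEquivMap.cogen.ext _ (x default)) =
        p.toEquivMap.ext _ (P.desusp.ext _ (x default)) := rfl
    rw [this, hx, map_zero, map_zero]

theorem pushforwardMorphism_restrictsTo :
    (hP.pushforwardMorphism hs hker).RestrictsTo p.toEquivMap := by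
  intro ι L _ _ _ _ T x
  change (ofEquiv p.toEquivMap.cogen).map T _ = _
  rw [ofEquiv_of_unique _ _ _ fun v => Unique.eq_default v]
  rfl

end HomotopyOperad

end HtpyOperad

/-- Homotopy transfer theorem for homotopy operads. -/
theorem theorem4p16 {K : Type*} [Field K] [CharZero K]
    (P : HtpyOperad.DGSMod K) (Q : HtpyOperad.DGSMod K)
    (p : P.Hom Q) (hp : p.IsAcyclicFibration) (hP : HtpyOperad.HomotopyOperad P) :
    ∃ (hP' : HtpyOperad.HomotopyOperad P) (f : HtpyOperad.InfMorphism hP hP')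
      (hQ : HtpyOperad.HomotopyOperad Q) (g : HtpyOperad.InfMorphism hP' hQ),
      f.IsIsotopy ∧ g.IsStrict ∧ g.RestrictsTo p.toEquivMap := by
  obtain ⟨f, hf⟩ := hP.exists_isAdapted hp
  obtain ⟨s, hs⟩ := HtpyOperad.DGSMod.Hom.exists_section hp.1
  let hP' := hP.transportOperad (hf 0).ext (hf 0).theta
  have hker : ∀ n, hP'.γ.PreservesKernel p.toEquivMap.cogen n := fun n => (hf n).ker
  exact ⟨hP', hP.transportMorphism (hf 0).ext (hf 0).theta,
    hP'.pushforwardOperad hs hker,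
    hP'.pushforwardMorphism hs hker,
    hP.transportMorphism_isIsotopy (hf 0).ext (hf 0).theta,
    hP'.pushforwardMorphism_isStrict hs hker,
    hP'.pushforwardMorphism_restrictsTo hs hker⟩
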